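/- All graphs are finite and simple; $|G|$ is the number of vertices of $G$, and the length of a path is its number of edges. Fix an integer $\ell\ge 5$. A *long pyramid* in $G$ is an induced subgraph on $V(P_1\cup P_2\cup P_3)$, where for some vertices $v_0,v_1,v_2,v_3$ of $G$ and $i=1,2,3$, $P_i$ is an induced path of $G$ between $v_0$ and $v_i$, such that - $P_1,P_2,P_3$ are pairwise vertex-disjoint except for $v_0$; - $v_1,v_2,v_3\ne v_0$, and at least two of $P_1,P_2,P_3$ have length at least $\ell$; - $v_1,v_2,v_3$ are pairwise adjacent; - for $1\le i<j\le 3$, the only edge of $G$ between $V(P_i)\setminus\{v_0\}$ and $V(P_j)\setminus\{v_0\}$ is $v_iv_j$. **Theorem.** For every integer $\ell\ge 5$ there is an algorithm that takes a graph $G$ as input, always halts, correctly decides whether $G$ contains a long pyramid, and has running time $O(|G|^{6\ell+8})$, where the implied constant depends only on $\ell$. Here the algorithm is a program (depending only on $\ell$) for a random access machine: the input is a graph with vertex set $\{0,\dots,n-1\}$, given by $n$ and its adjacency matrix; the memory consists of registers and arrays of natural numbers; and each of the following takes one step: setting a register to a constant, copying, adding or subtracting one, reading or writing an array entry at an index held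 in a register, reading an entry of the adjacency matrix, comparing two registers ($=$ or $<$), and doing nothing. -/

import Mathlib

/-! ## Long pyramids -/

/-- `v₀ : V`, `v : Fin 3 → V` and paths `P i` from `v₀` to `v i` form a long pyramid of `G`
(with apex `v₀` and base `{v 0, v 1, v 2}`), where a path is long if its length
(its number of edges) is at least `ℓ`. -/
structure FormsLongPyramid {V : Type*} (G : SimpleGraph V) (ℓ : ℕ) (v₀ : V) (v : Fin 3 → V)
    (P : ∀ i, G.Walk v₀ (v i)) : Prop where
  isPath : ∀ i, (P i).IsPath
  /-- Each path is an induced subgraph: all edges of `G` between its vertices belong to it. -/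
  induced : ∀ i, (P i).IsChordless
  disjoint : ∀ i j, i ≠ j → ∀ x, x ∈ (P i).support → x ∈ (P j).support → x = v₀
  ne_apex : ∀ i, v i ≠ v₀
  two_long : ∃ i j, i ≠ j ∧ ℓ ≤ (P i).length ∧ ℓ ≤ (P j).length
  base_adj : ∀ i j, i ≠ j → G.Adj (v i) (v j)
  only_edge : ∀ i j, i ≠ j → ∀ x ∈ (P i).support, ∀ y ∈ (P j).support, x ≠ v₀ → y ≠ v₀ →
    G.Adj x y → x = v i ∧ y = v j

/-- `G` contains a long pyramid. -/
def HasLongPyramid {V : Type*} (G : SimpleGraph V) (ℓ : ℕ) : Prop :=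
  ∃ (v₀ : V) (v : Fin 3 → V) (P : ∀ i, G.Walk v₀ (v i)), FormsLongPyramid G ℓ v₀ v P

/-! ## Random access machines on graphs, with a count of the steps

A program is a finite object, fixed before the input is chosen. It works on registers and on
arrays of natural numbers. The input graph has vertices `0, …, n - 1`; `n` is given in a register,
and the adjacency matrix can be read, one entry per step. The only arithmetic is adding or
subtracting one, so that in `t` steps no number beyond `max n c + t` arises, where `c` is the
largest constant in the program: no work can be hidden in operations on huge numbers. -/

namespace GraphRAM

/-- The memory of the machine: registers, and arrays indexed by name and position. -/
structure State where
  reg : ℕ → ℕ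
  arr : ℕ → ℕ → ℕ

def State.setReg (σ : State) (r x : ℕ) : State :=
  { σ with reg := Function.update σ.reg r x }

def State.setArr (σ : State) (a k x : ℕ) : State :=
  { σ with arr := Function.update σ.arr a (Function.update (σ.arr a) k x) }

/-- The elementary instructions. All their arguments are fixed numbers in the program text. -/
inductive Instr where
  /-- put the constant `c` into register `r` -/
  | const (r c : ℕ)
  /-- copy register `s` to register `r` -/
  | copy (r s : ℕ)
  /-- add one to register `r` -/
  | succ (r : ℕ)
  /-- subtract one from register `r` (zero stays zero) -/
  | pred (r : ℕ)
  /-- copy to register `r` the entry of array `a` at the position held in register `s` -/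
  | load (r a s : ℕ)
  /-- copy register `r` to array `a`, at the position held in register `s` -/
  | store (a s r : ℕ)
  /-- read into register `r` the entry of the adjacency matrix of the input graph in the row and
  column held in registers `s` and `t` -/
  | adj (r s t : ℕ)

/-- The effect of an instruction, when the adjacency matrix of the input graph is `A`. -/
def Instr.exec (A : ℕ → ℕ → ℕ) : Instr → State → State
  | .const r c, σ => σ.setReg r c
  | .copy r s, σ => σ.setReg r (σ.reg s)
  | .succ r, σ => σ.setReg r (σ.reg r + 1)
  | .pred r, σ => σ.setReg r (σ.reg r - 1)
  | .load r a s, σ => σ.setReg r (σ.arr a (σ.reg s))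
  | .store a s r, σ => σ.setArr a (σ.reg s) (σ.reg r)
  | .adj r s t, σ => σ.setReg r (A (σ.reg s) (σ.reg t))

/-- Comparisons of two registers. -/
inductive Test where
  | eq (r s : ℕ)
  | lt (r s : ℕ)

def Test.eval : Test → State → Bool
  | .eq r s, σ => decide (σ.reg r = σ.reg s)
  | .lt r s, σ => decide (σ.reg r < σ.reg s)

/-- Programs: instructions, sequences, branches and (unbounded) while-loops. -/
inductive Prog where
  | skip
  | instr (i : Instr)
  | seq (p q : Prog)
  | branch (b : Test) (p q : Prog)
  | loop (b : Test) (p : Prog)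

/-- `Run A p σ t τ`: on the input with adjacency matrix `A`, the program `p` started in state `σ`
halts after exactly `t` steps in state `τ`. Each instruction, and each evaluation of the test of a
branch or a loop, takes one step. -/
inductive Run (A : ℕ → ℕ → ℕ) : Prog → State → ℕ → State → Prop
  | skip (σ : State) : Run A .skip σ 1 σ
  | instr (i : Instr) (σ : State) : Run A (.instr i) σ 1 (i.exec A σ)
  | seq {p q : Prog} {σ τ υ : State} {s t : ℕ} :
      Run A p σ s τ → Run A q τ t υ → Run A (.seq p q) σ (s + t) υ
  | branch_true {b : Test} {p q : Prog} {σ τ : State} {t : ℕ} :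
      b.eval σ = true → Run A p σ t τ → Run A (.branch b p q) σ (t + 1) τ
  | branch_false {b : Test} {p q : Prog} {σ τ : State} {t : ℕ} :
      b.eval σ = false → Run A q σ t τ → Run A (.branch b p q) σ (t + 1) τ
  | loop_true {b : Test} {p : Prog} {σ τ υ : State} {s t : ℕ} :
      b.eval σ = true → Run A p σ s τ → Run A (.loop b p) τ t υ →
      Run A (.loop b p) σ (s + t + 1) υ
  | loop_false {b : Test} {p : Prog} {σ : State} :
      b.eval σ = false → Run A (.loop b p) σ 1 σ

/-- The machine is deterministic: a run determines its number of steps and its final state. -/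
theorem Run.deterministic {A : ℕ → ℕ → ℕ} {p : Prog} {σ τ τ' : State} {t t' : ℕ}
    (h : Run A p σ t τ) (h' : Run A p σ t' τ') : t = t' ∧ τ = τ' := by
  induction h generalizing t' τ' with
  | skip => cases h'; simp
  | instr => cases h'; simp
  | seq _ _ ih₁ ih₂ =>
    cases h' with
    | seq g₁ g₂ =>
      obtain ⟨rfl, rfl⟩ := ih₁ g₁
      obtain ⟨rfl, rfl⟩ := ih₂ g₂
      simp
  | branch_true hb _ ih =>
    cases h' with
    | branch_true _ g => obtain ⟨rfl, rfl⟩ := ih g; simp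
    | branch_false g => simp [hb] at g
  | branch_false hb _ ih =>
    cases h' with
    | branch_true g => simp [hb] at g
    | branch_false _ g => obtain ⟨rfl, rfl⟩ := ih g; simp
  | loop_true hb _ _ ih₁ ih₂ =>
    cases h' with
    | loop_true _ g₁ g₂ =>
      obtain ⟨rfl, rfl⟩ := ih₁ g₁
      obtain ⟨rfl, rfl⟩ := ih₂ g₂
      simp
    | loop_false g => simp [hb] at g
  | loop_false hb =>
    cases h' with
    | loop_true g => simp [hb] at g
    | loop_false => simp

open Classical in
/-- The adjacency matrix of a graph with vertices `0, …, n - 1` (zero outside the range). -/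
noncomputable def adjMatrix {n : ℕ} (G : SimpleGraph (Fin n)) (i j : ℕ) : ℕ :=
  if ∃ (hi : i < n) (hj : j < n), G.Adj ⟨i, hi⟩ ⟨j, hj⟩ then 1 else 0

/-- At the start register `0` holds the number of vertices, and all other memory is zero. -/
def initial (n : ℕ) : State where
  reg := fun r => if r = 0 then n else 0
  arr := fun _ _ => 0

/-- On the input `G`, the program `p` halts within `T` steps. It leaves `1` in register `0` if `Q`
holds, and `0` in register `0` otherwise. -/
def DecidesWithin (p : Prog) {n : ℕ} (G : SimpleGraph (Fin n)) (Q : Prop) (T : ℕ) : Prop :=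
  ∃ (t : ℕ) (τ : State), Run (adjMatrix G) p (initial n) t τ ∧ t ≤ T ∧
    (Q → τ.reg 0 = 1) ∧ (¬ Q → τ.reg 0 = 0)

end GraphRAM

/-! A long pyramid with the fewest vertices can be recognized from a bounded part of it, its frame:
the apex and, on each leg, `2 * ℓ` further vertices, namely the rest of the first `ℓ`, the middle
one, and the last `ℓ` (all vertices if the leg is short). The algorithm runs through all choices of
these `6 * ℓ + 1` vertices. What a long leg still lacks are two gaps, one on each side of its middle
vertex. For each leg `i` let `X i` consist of the guessed vertices other than the apex, together
with all vertices on shortest paths across the two gaps, where the inner vertices of such a path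
must be outside the frame and adjacent to no frame vertex except the three that end the gaps
(`InLeg`). The frame is accepted if the sets `X i` are disjoint, avoid the apex, have only the base
edges between them, connect the apex to the base, and two of them are long (`Certificate`).

Soundness: if a frame is accepted, shortest paths inside the sets `X i` form a long pyramid
(`Certificate.setPyramid`, `SetPyramid.exists_minPyramid`).

Completeness: let the frame come from a minimum pyramid. The crucial fact is that any shortest path
across a gap can replace the corresponding segment of its leg and gives another minimum pyramid with
the same frame and the same two other legs (`MinPyramid.reroute`). For this the path must have no
neighbours on the other two legs (`MinPyramid.not_adj_walk`). Otherwise follow it from the middle of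
leg `i` to its first vertex `z` with such a neighbour. The other two legs form a path through the
apex, the rim, and the neighbours of `z` on it are far from its ends and from the apex. If `z` has
just one neighbour there, this neighbour is the apex of a new pyramid; if two of them are at
distance at least two on the rim, `z` is the apex (`MinPyramid.not_shorter`); if they are two
consecutive vertices, they form with `z` the base of a new pyramid (`MinPyramid.not_triangle`). The
walk from the middle to `z` together with either half of leg `i` is shorter than leg `i`, so the new
pyramid is smaller, a contradiction. Rerouting leg `i` and then leg `j`, one finds for all `u` in `X
i` and `v` in `X j` a minimum pyramid with the given frame that contains both
(`MinPyramid.exists_through`). Hence the sets are separated as required (`MinPyramid.certificate`).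

Running time: there are `n ^ (6 * ℓ + 1)` frames, and a frame is checked in time `O(n ^ 5)`, by
breadth-first searches of cost `O(n ^ 3)` inside at most two quantifiers over vertices. The programs
are assembled from closure rules for expressions computable in time `O(n ^ k)` (`Comp`). -/

/-! ## Walks inside a set, and levels -/

/-- `WalkIn r W k u v`: there is an `r`-walk of length `k` from `u` to `v` all of whose vertices,
except perhaps `u`, belong to `W`. -/
def WalkIn {V : Type*} (r : V → V → Prop) (W : V → Prop) : ℕ → V → V → Prop
  | 0, u, v => u = v
  | k + 1, u, v => ∃ w, WalkIn r W k u w ∧ r w v ∧ W v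

/-- The distance from `s` to `v` in terms of `WalkIn`, cut off at `n`. -/
noncomputable def level {V : Type*} (n : ℕ) (r : V → V → Prop) (W : V → Prop) (s v : V) : ℕ :=
  sInf ({k | WalkIn r W k s v} ∪ {n})

section Level

variable {V : Type*} {n : ℕ} {r : V → V → Prop} {W : V → Prop} {s v : V} {k : ℕ}

theorem level_le : level n r W s v ≤ n := Nat.sInf_le (Or.inr rfl)

theorem level_le_of_walkIn (h : WalkIn r W k s v) : level n r W s v ≤ k := Nat.sInf_le (Or.inl h)

theorem walkIn_level (h : level n r W s v < n) : WalkIn r W (level n r W s v) s v := by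
  have : level n r W s v ∈ ({k | WalkIn r W k s v} ∪ {n} : Set ℕ) :=
    Nat.sInf_mem ⟨n, Or.inr rfl⟩
  rcases this with h' | h'
  · exact h'
  · exact absurd h' h.ne

theorem level_self (hn : 0 < n) : level n r W s v = 0 ↔ v = s := by
  constructor
  · intro h
    have := walkIn_level (n := n) (r := r) (W := W) (s := s) (v := v) (by omega)
    rw [h] at this
    exact this.symm
  · rintro rfl
    exact Nat.le_zero.1 (level_le_of_walkIn rfl)

/-- One round of breadth-first search. -/
theorem level_round (hk : k < n) [Decidable (level n r W s v ≤ k)]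
    [Decidable (level n r W s v ≤ k + 1)] [∀ u, Decidable (level n r W s u ≤ k)]
    [Decidable (W v ∧ ∃ u, (if level n r W s u ≤ k then level n r W s u else n) = k ∧ r u v)] :
    (if level n r W s v ≤ k + 1 then level n r W s v else n) =
      if level n r W s v ≤ k then level n r W s v else
        if W v ∧ ∃ u, (if level n r W s u ≤ k then level n r W s u else n) = k ∧ r u v
        then k + 1 else n := by
  by_cases h1 : level n r W s v ≤ k
  · rw [if_pos h1, if_pos (by omega)]
  rw [if_neg h1]
  split_ifs with h2 h3 h3
  · obtain ⟨hW, u, hu, hr⟩ := h3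
    omega
  -- The value `n` stands for "not reached". In the last round `k + 1 = n`, and then a level of `k +
  -- 1` and an unreached vertex are stored alike, so only `k + 1 ≠ n` needs an argument.
  · by_contra hne
    have hlev : level n r W s v = k + 1 := by omega
    have hlt : level n r W s v < n := by have := level_le (n := n) (r := r) (W := W) (s := s) (v := v); omega
    have := walkIn_level hlt
    rw [hlev] at this
    obtain ⟨u, hu, hr, hW⟩ := this
    refine h3 ⟨hW, u, ?_, hr⟩
    have h4 : level n r W s u ≤ k := level_le_of_walkIn hu
    rw [if_pos h4]
    by_contra h5
    have h6 : level n r W s u < n := by omega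
    have h7 : WalkIn r W (level n r W s u + 1) s v := ⟨u, walkIn_level h6, hr, hW⟩
    have := level_le_of_walkIn (n := n) h7
    omega
  · exfalso
    obtain ⟨hW, u, hu, hr⟩ := h3
    have h4 : level n r W s u = k := by
      split_ifs at hu <;> omega
    have h7 : WalkIn r W (k + 1) s v := ⟨u, by rw [← h4]; exact walkIn_level (by omega), hr, hW⟩
    have := level_le_of_walkIn (n := n) h7
    omega
  · rfl

end Level

/-! ## Total correctness with a bound on the number of steps -/

namespace GraphRAM

@[simp] theorem State.setReg_reg (σ : State) (r x i : ℕ) :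
    (σ.setReg r x).reg i = if i = r then x else σ.reg i := by
  simp [State.setReg, Function.update_apply]

@[simp] theorem State.setReg_arr (σ : State) (r x : ℕ) : (σ.setReg r x).arr = σ.arr := rfl

@[simp] theorem State.setArr_reg (σ : State) (a k x : ℕ) : (σ.setArr a k x).reg = σ.reg := rfl

@[simp] theorem State.setArr_arr (σ : State) (a k x b j : ℕ) :
    (σ.setArr a k x).arr b j = if b = a ∧ j = k then x else σ.arr b j := by
  by_cases hb : b = a
  · subst hb
    simp [State.setArr, Function.update_apply]
  · simp [State.setArr, hb]

/-- Started in `σ`, the program `p` halts within `T` steps, in a state satisfying `Q`. -/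
def Within (A : ℕ → ℕ → ℕ) (p : Prog) (σ : State) (T : ℕ) (Q : State → Prop) : Prop :=
  ∃ t τ, Run A p σ t τ ∧ t ≤ T ∧ Q τ

section Rules

variable {A : ℕ → ℕ → ℕ} {p q : Prog} {σ : State} {S T : ℕ} {Q Q' : State → Prop}

theorem Within.mono (h : Within A p σ S Q) (hT : S ≤ T) (hQ : ∀ τ, Q τ → Q' τ) :
    Within A p σ T Q' := by
  obtain ⟨t, τ, hr, ht, hq⟩ := h
  exact ⟨t, τ, hr, ht.trans hT, hQ τ hq⟩

theorem Within.skip (h : Q σ) : Within A .skip σ 1 Q := ⟨1, σ, .skip σ, le_rfl, h⟩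

theorem Within.instr {i : Instr} (h : Q (i.exec A σ)) : Within A (.instr i) σ 1 Q :=
  ⟨1, _, .instr i σ, le_rfl, h⟩

theorem Within.seq (h : Within A p σ S (fun τ => Within A q τ T Q)) :
    Within A (.seq p q) σ (S + T) Q := by
  obtain ⟨t, τ, hr, ht, t', τ', hr', ht', hq⟩ := h
  exact ⟨t + t', τ', .seq hr hr', by omega, hq⟩

theorem Within.instr_seq {i : Instr} (h : Within A q (i.exec A σ) T Q) :
    Within A (.seq (.instr i) q) σ (1 + T) Q :=
  Within.seq (Within.instr h)

theorem Within.branch {b : Test} (hp : b.eval σ = true → Within A p σ T Q)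
    (hq : b.eval σ = false → Within A q σ T Q) : Within A (.branch b p q) σ (T + 1) Q := by
  cases hb : b.eval σ
  · obtain ⟨t, τ, hr, ht, h⟩ := hq hb
    exact ⟨t + 1, τ, .branch_false hb hr, by omega, h⟩
  · obtain ⟨t, τ, hr, ht, h⟩ := hp hb
    exact ⟨t + 1, τ, .branch_true hb hr, by omega, h⟩

/-- A loop whose counter `i` runs up to the value `n` of register `b`. -/
theorem Within.forLoop {i b n : ℕ} {I : ℕ → State → Prop}
    (hi : ∀ j τ, I j τ → τ.reg i = j ∧ τ.reg b = n)
    (hstep : ∀ j τ, j < n → I j τ → Within A p τ T (I (j + 1))) (h0 : I 0 σ) :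
    Within A (.loop (.lt i b) p) σ (n * (T + 1) + 1) (I n) := by
  suffices H : ∀ d j τ, j + d = n → I j τ →
      Within A (.loop (.lt i b) p) τ (d * (T + 1) + 1) (I n) from H n 0 σ (by omega) h0
  intro d
  induction d with
  | zero =>
    intro j τ hj hI
    obtain ⟨h1, h2⟩ := hi j τ hI
    refine ⟨1, τ, .loop_false ?_, by omega, ?_⟩
    · simp [Test.eval, h1, h2]; omega
    · have : j = n := by omega
      exact this ▸ hI
  | succ d ih =>
    intro j τ hj hI
    obtain ⟨h1, h2⟩ := hi j τ hI
    obtain ⟨t, τ', hr, ht, hI'⟩ := hstep j τ (by omega) hI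
    obtain ⟨t', τ'', hr', ht', hq⟩ := ih (j + 1) τ' (by omega) hI'
    refine ⟨t + t' + 1, τ'', .loop_true ?_ hr hr', ?_, hq⟩
    · simp [Test.eval, h1, h2]; omega
    · rw [Nat.succ_mul]; omega

end Rules

/-! ## Expressions computable in polynomial time

The registers below `M` are the variables: register `0` holds the number `n` of vertices,
and the others hold vertices. -/

/-- Expressions in the adjacency matrix and the values of the registers. -/
abbrev Expr (α : Type) := (ℕ → ℕ → ℕ) → (ℕ → ℕ) → α

/-- Positivity of `n` makes `n ^ k` increasing in `k` and at least `1`, so constant costs can be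
absorbed; the empty graph is treated separately by the final program. -/
structure Valid (M : ℕ) (ρ : ℕ → ℕ) : Prop where
  pos : 0 < ρ 0
  lt : ∀ i, 0 < i → i < M → ρ i < ρ 0

/-- The expression `e` in the registers below `M` can be computed in time `O(n ^ k)`, with all
registers below any `N ≥ M` preserved and the result in register `N`. If `keep` holds then the
arrays are preserved as well. -/
structure Comp (M : ℕ) (keep : Prop) (k : ℕ) (e : Expr ℕ) : Prop where
  pos : 0 < M
  supp : ∀ A ρ ρ', (∀ i < M, ρ i = ρ' i) → e A ρ = e A ρ'
  -- `N` acts as a stack pointer: everything from `N` on is scratch space, so a compound expression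
  -- evaluates its parts with larger `N` without losing earlier results. The constant `C` is chosen
  -- before the input.
  prog : ∀ N, M ≤ N → ∃ (p : Prog) (C : ℕ), ∀ A σ, Valid M σ.reg →
    Within A p σ (C * σ.reg 0 ^ k) (fun τ =>
      τ.reg N = e A σ.reg ∧ (∀ i < N, τ.reg i = σ.reg i) ∧ (keep → τ.arr = σ.arr))

open Classical in
/-- The expression with value `1` where `φ` holds and `0` elsewhere. -/
noncomputable def indic (φ : Expr Prop) : Expr ℕ := fun A ρ => if φ A ρ then 1 else 0

/-- The property `φ` of the registers below `M` can be decided in time `O(n ^ k)`. -/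
def CompP (M : ℕ) (keep : Prop) (k : ℕ) (φ : Expr Prop) : Prop := Comp M keep k (indic φ)

section Comp

variable {M k k' : ℕ} {keep : Prop} {e e₁ e₂ : Expr ℕ} {φ ψ : Expr Prop}

theorem Valid.congr {ρ ρ' : ℕ → ℕ} (h : Valid M ρ) (hM : 0 < M) (h' : ∀ i < M, ρ' i = ρ i) :
    Valid M ρ' :=
  ⟨h' 0 hM ▸ h.pos, fun i hi hi' => by rw [h' i hi', h' 0 hM]; exact h.lt i hi hi'⟩

theorem Comp.mono (h : Comp M keep k e) (hk : k ≤ k') : Comp M keep k' e := by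
  refine ⟨h.pos, h.supp, fun N hN => ?_⟩
  obtain ⟨p, C, hp⟩ := h.prog N hN
  refine ⟨p, C, fun A σ hσ => (hp A σ hσ).mono ?_ fun _ h => h⟩
  exact Nat.mul_le_mul_left _ (Nat.pow_le_pow_right hσ.pos hk)

theorem Comp.var (hM : 0 < M) {x : ℕ} (hx : x < M) : Comp M keep 0 (fun _ ρ => ρ x) := by
  refine ⟨hM, fun A ρ ρ' h => h x hx, fun N hN => ⟨.instr (.copy N x), 1, fun A σ hσ => ?_⟩⟩
  refine (Within.instr ?_).mono (by simp) fun _ h => h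
  simp only [Instr.exec, State.setReg_reg, if_pos, State.setReg_arr, implies_true, and_true,
    true_and]
  intro i hi
  simp [hi.ne]

theorem Comp.const (hM : 0 < M) (c : ℕ) : Comp M keep 0 (fun _ _ => c) := by
  refine ⟨hM, fun A ρ ρ' h => rfl, fun N hN => ⟨.instr (.const N c), 1, fun A σ hσ => ?_⟩⟩
  refine (Within.instr ?_).mono (by simp) fun _ h => h
  simp only [Instr.exec, State.setReg_reg, if_pos, State.setReg_arr, implies_true, and_true,
    true_and]
  intro i hi
  simp [hi.ne]

theorem Comp.adj (hM : 0 < M) {x y : ℕ} (hx : x < M) (hy : y < M) :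
    Comp M keep 0 (fun A ρ => A (ρ x) (ρ y)) := by
  refine ⟨hM, fun A ρ ρ' h => by simp only [h x hx, h y hy],
    fun N hN => ⟨.instr (.adj N x y), 1, fun A σ hσ => ?_⟩⟩
  refine (Within.instr ?_).mono (by simp) fun _ h => h
  simp only [Instr.exec, State.setReg_reg, if_pos, State.setReg_arr, implies_true, and_true,
    true_and]
  intro i hi
  simp [hi.ne]

/-- Binary operations; the operation may assume a relation between `n` and the second operand. -/
theorem Comp.bin (h₁ : Comp M keep k e₁) (h₂ : Comp M keep k e₂) (op : ℕ → ℕ → ℕ)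
    (P : ℕ → ℕ → Prop) (hP : ∀ A ρ, Valid M ρ → P (ρ 0) (e₂ A ρ))
    (hop : ∀ N, 0 < N → ∃ (p : Prog) (C : ℕ), ∀ A σ, 0 < σ.reg 0 → P (σ.reg 0) (σ.reg (N + 1)) →
      Within A p σ (C * σ.reg 0 ^ k) (fun τ => τ.reg N = op (σ.reg N) (σ.reg (N + 1)) ∧
        (∀ i < N, τ.reg i = σ.reg i) ∧ τ.arr = σ.arr)) :
    Comp M keep k (fun A ρ => op (e₁ A ρ) (e₂ A ρ)) := by
  have hM := h₁.pos
  refine ⟨hM, fun A ρ ρ' h => by rw [h₁.supp A ρ ρ' h, h₂.supp A ρ ρ' h], fun N hN => ?_⟩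
  obtain ⟨p₁, C₁, hp₁⟩ := h₁.prog N hN
  obtain ⟨p₂, C₂, hp₂⟩ := h₂.prog (N + 1) (by omega)
  obtain ⟨p₃, C₃, hp₃⟩ := hop N (by omega)
  refine ⟨.seq p₁ (.seq p₂ p₃), C₁ + (C₂ + C₃), fun A σ hσ => ?_⟩
  rw [add_mul, add_mul]
  refine Within.seq ((hp₁ A σ hσ).mono le_rfl ?_)
  rintro τ ⟨hv, hr, ha⟩
  have hn : τ.reg 0 = σ.reg 0 := hr 0 (by omega)
  have hτ : Valid M τ.reg := hσ.congr hM fun i hi => hr i (by omega)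
  refine Within.seq ((hp₂ A τ hτ).mono (by rw [hn]) ?_)
  rintro υ ⟨hv', hr', ha'⟩
  have hn' : υ.reg 0 = σ.reg 0 := by rw [hr' 0 (by omega), hn]
  have he : e₂ A τ.reg = e₂ A σ.reg := h₂.supp A _ _ fun i hi => hr i (by omega)
  refine (hp₃ A υ (by rw [hn']; exact hσ.pos) (by rw [hv', hn', he]; exact hP A _ hσ)).mono
    (by rw [hn']) ?_
  rintro ω ⟨hv'', hr'', ha''⟩
  refine ⟨?_, fun i hi => by rw [hr'' i hi, hr' i (by omega), hr i hi], fun hk => ?_⟩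
  · rw [hv'', hv', hr' N (by omega), hv, he]
  · rw [ha'', ha' hk, ha hk]

theorem CompP.congr (h : CompP M keep k φ) (h' : ∀ A ρ, φ A ρ ↔ ψ A ρ) : CompP M keep k ψ := by
  have : φ = ψ := by funext A ρ; exact propext (h' A ρ)
  exact this ▸ h

theorem CompP.supp (h : CompP M keep k φ) {A : ℕ → ℕ → ℕ} {ρ ρ' : ℕ → ℕ}
    (h' : ∀ i < M, ρ i = ρ' i) : φ A ρ ↔ φ A ρ' := by
  have := Comp.supp h A ρ ρ' h'
  unfold indic at this
  by_cases h1 : φ A ρ <;> by_cases h2 : φ A ρ' <;> simp_all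

theorem CompP.mono (h : CompP M keep k φ) (hk : k ≤ k') : CompP M keep k' φ := Comp.mono h hk

theorem Comp.test (h₁ : Comp M keep k e₁) (h₂ : Comp M keep k e₂) (b : ℕ → ℕ → Test)
    (R : ℕ → ℕ → Prop) (hb : ∀ r s σ, (b r s).eval σ = true ↔ R (σ.reg r) (σ.reg s)) :
    CompP M keep k (fun A ρ => R (e₁ A ρ) (e₂ A ρ)) := by
  classical
  have := Comp.bin h₁ h₂ (fun x y => if R x y then 1 else 0) (fun _ _ => True) (by simp)
    (fun N hN => ⟨.branch (b N (N + 1)) (.instr (.const N 1)) (.instr (.const N 0)), 2,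
      fun A σ hσ _ => ?_⟩)
  · unfold CompP
    convert this using 1
    funext A ρ
    simp [indic]
  · refine (Within.branch (T := 1) (fun h => Within.instr ?_) fun h => Within.instr ?_).mono
      (by nlinarith [Nat.one_le_pow k _ hσ]) fun _ h => h
    · rw [hb] at h
      simp only [Instr.exec, State.setReg_reg, if_pos, h, State.setReg_arr, and_true, true_and]
      intro i hi
      simp [hi.ne]
    · rw [← Bool.not_eq_true, hb] at h
      simp only [Instr.exec, State.setReg_reg, if_pos, h, State.setReg_arr, and_true, true_and,
        if_false]
      intro i hi
      simp [hi.ne]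

theorem Comp.eqP (h₁ : Comp M keep k e₁) (h₂ : Comp M keep k e₂) :
    CompP M keep k (fun A ρ => e₁ A ρ = e₂ A ρ) :=
  h₁.test h₂ .eq (· = ·) fun r s σ => by simp [Test.eval]

theorem Comp.ltP (h₁ : Comp M keep k e₁) (h₂ : Comp M keep k e₂) :
    CompP M keep k (fun A ρ => e₁ A ρ < e₂ A ρ) :=
  h₁.test h₂ .lt (· < ·) fun r s σ => by simp [Test.eval]

theorem CompP.and (h₁ : CompP M keep k φ) (h₂ : CompP M keep k ψ) :
    CompP M keep k (fun A ρ => φ A ρ ∧ ψ A ρ) := by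
  classical
  -- On the values `0` and `1` this operation is conjunction, computed with comparisons only.
  have := Comp.bin h₁ h₂ (fun x y => if x < y then 0 else if y < x then 0 else y) (fun _ _ => True)
    (by simp) (fun N hN => ⟨.branch (.lt N (N + 1)) (.instr (.const N 0))
      (.branch (.lt (N + 1) N) (.instr (.const N 0)) (.instr (.copy N (N + 1)))), 3,
      fun A σ hσ _ => ?_⟩)
  · unfold CompP
    convert this using 1
    funext A ρ
    by_cases h1 : φ A ρ <;> by_cases h2 : ψ A ρ <;> simp [indic, h1, h2]
  · refine (Within.branch (T := 2) (fun h => (Within.instr ?_).mono one_le_two fun _ h => h) fun h =>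
      Within.branch (T := 1) (fun h' => Within.instr ?_) fun h' => Within.instr ?_).mono
      (by nlinarith [Nat.one_le_pow k _ hσ]) fun _ h => h
    all_goals
      simp only [Test.eval, decide_eq_true_eq, decide_eq_false_iff_not] at h
      try simp only [Test.eval, decide_eq_true_eq, decide_eq_false_iff_not] at h'
      simp only [Instr.exec, State.setReg_reg, if_pos, State.setReg_arr, and_true]
      refine ⟨by split_ifs; omega, fun i hi => by simp [hi.ne]⟩

theorem CompP.not (h : CompP M keep k φ) : CompP M keep k (fun A ρ => ¬ φ A ρ) := by
  refine (Comp.eqP h ((Comp.const h.pos 0).mono (Nat.zero_le k))).congr fun A ρ => ?_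
  by_cases h : φ A ρ <;> simp [indic, h]

theorem CompP.or (h₁ : CompP M keep k φ) (h₂ : CompP M keep k ψ) :
    CompP M keep k (fun A ρ => φ A ρ ∨ ψ A ρ) :=
  (h₁.not.and h₂.not).not.congr fun A ρ => by tauto

theorem CompP.imp (h₁ : CompP M keep k φ) (h₂ : CompP M keep k ψ) :
    CompP M keep k (fun A ρ => φ A ρ → ψ A ρ) :=
  (h₁.and h₂.not).not.congr fun A ρ => by tauto

theorem CompP.true (hM : 0 < M) : CompP M keep k (fun _ _ => True) :=
  ((Comp.eqP (Comp.const hM 0) (Comp.const hM 0)).mono (Nat.zero_le k)).congr fun A ρ => by simp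

theorem CompP.forall_finset (hM : 0 < M) {ι : Type*} (s : Finset ι) {φ : ι → Expr Prop}
    (h : ∀ i ∈ s, CompP M keep k (φ i)) : CompP M keep k (fun A ρ => ∀ i ∈ s, φ i A ρ) := by
  classical
  induction s using Finset.induction_on with
  | empty => exact (CompP.true hM).congr fun A ρ => by simp
  | insert i s hi ih =>
    refine ((h i (by simp)).and (ih fun j hj => h j (by simp [hj]))).congr fun A ρ => ?_
    simp

theorem CompP.exists_finset (hM : 0 < M) {ι : Type*} (s : Finset ι) {φ : ι → Expr Prop}
    (h : ∀ i ∈ s, CompP M keep k (φ i)) : CompP M keep k (fun A ρ => ∃ i ∈ s, φ i A ρ) :=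
  (CompP.forall_finset hM s fun i hi => (h i hi).not).not.congr fun A ρ => by simp

/-- The machine has only the successor, so the sum takes as many rounds as the value of `e₂`. The
bound by `n` and `1 ≤ k` keep this within `O(n ^ k)`. -/
theorem Comp.add (h₁ : Comp M keep k e₁) (h₂ : Comp M keep k e₂) (hk : 1 ≤ k)
    (hb : ∀ A ρ, Valid M ρ → e₂ A ρ ≤ ρ 0) : Comp M keep k (fun A ρ => e₁ A ρ + e₂ A ρ) := by
  refine Comp.bin h₁ h₂ (· + ·) (fun n y => y ≤ n) hb fun N hN =>
    ⟨.seq (.instr (.const (N + 2) 0)) (.loop (.lt (N + 2) (N + 1))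
      (.seq (.instr (.succ N)) (.instr (.succ (N + 2))))), 5, fun A σ hσ hy => ?_⟩
  refine (Within.instr_seq (Within.forLoop (n := σ.reg (N + 1)) (T := 2) (I := fun j τ =>
    τ.reg (N + 2) = j ∧ τ.reg (N + 1) = σ.reg (N + 1) ∧ τ.reg N = σ.reg N + j ∧
      (∀ i < N, τ.reg i = σ.reg i) ∧ τ.arr = σ.arr)
    (fun j τ h => ⟨h.1, h.2.1⟩) (fun j τ hj h => ?_) ?_)).mono ?_ ?_
  · refine Within.instr_seq (Within.instr ?_)
    obtain ⟨h1, h2, h3, h4, h5⟩ := h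
    simp [Instr.exec, h1, h2, h3, h5]
    refine ⟨by omega, fun i hi => ?_⟩
    rw [if_neg (by omega), if_neg (by omega), h4 i hi]
  · simp [Instr.exec]
    omega
  · have : σ.reg 0 ≤ σ.reg 0 ^ k := Nat.le_self_pow (by omega) _
    nlinarith
  · rintro τ ⟨h1, h2, h3, h4, h5⟩
    exact ⟨h3, h4, h5⟩

/-- Quantification over the vertices, by a loop. -/
theorem CompP.exists_lt (h : CompP M keep k φ) {x : ℕ} (hx0 : 0 < x) (hx : x < M) :
    CompP M keep (k + 1) (fun A ρ => ∃ v < ρ 0, φ A (Function.update ρ x v)) := by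
  classical
  have hM := Comp.pos h
  refine ⟨hM, fun A ρ ρ' hρ => ?_, fun N hN => ?_⟩
  · have h1 : ∀ v, φ A (Function.update ρ x v) ↔ φ A (Function.update ρ' x v) := fun v =>
      h.supp fun i hi => by
        by_cases hix : i = x
        · subst hix; simp
        · simp [hix, hρ i hi]
    have h2 : (∃ v < ρ 0, φ A (Function.update ρ x v)) ↔
        ∃ v < ρ' 0, φ A (Function.update ρ' x v) := by simp only [h1, hρ 0 hM]
    by_cases h3 : ∃ v < ρ' 0, φ A (Function.update ρ' x v)
    · exact (if_pos (h2.2 h3)).trans (if_pos h3).symm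
    · exact (if_neg fun h4 => h3 (h2.1 h4)).trans (if_neg h3).symm
  obtain ⟨p, C, hp⟩ := Comp.prog h (N + 4) (by omega)
  -- The variable `x` itself is the loop counter. `N + 1` saves its old value, `N + 2` holds the
  -- verdict so far, `N + 3` the constant `1` for comparison, and `N + 4` receives the value of `φ`.
  refine ⟨.seq (.instr (.copy (N + 1) x)) (.seq (.instr (.const (N + 2) 0))
    (.seq (.instr (.const (N + 3) 1)) (.seq (.instr (.const x 0))
    (.seq (.loop (.lt x 0) (.seq p (.seq
      (.branch (.eq (N + 4) (N + 3)) (.instr (.const (N + 2) 1)) .skip) (.instr (.succ x)))))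
    (.seq (.instr (.copy x (N + 1))) (.instr (.copy N (N + 2)))))))), C + 12, fun A σ hσ => ?_⟩
  refine (Within.instr_seq <| Within.instr_seq <| Within.instr_seq <| Within.instr_seq <|
    Within.seq <| (Within.forLoop (n := σ.reg 0) (T := C * σ.reg 0 ^ k + 3) (I := fun j τ =>
    τ.reg x = j ∧ (∀ i < N, i ≠ x → τ.reg i = σ.reg i) ∧ τ.reg (N + 1) = σ.reg x ∧
      τ.reg (N + 3) = 1 ∧
      τ.reg (N + 2) = (if ∃ v < j, φ A (Function.update σ.reg x v) then 1 else 0) ∧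
      (keep → τ.arr = σ.arr))
    (fun j τ h => ⟨h.1, h.2.1 0 (by omega) (by omega)⟩) (fun j τ hj hI => ?_) ?_).mono le_rfl
    (Q' := fun τ => Within A _ τ 2 _) ?_).mono ?_ fun _ h => h
  · obtain ⟨h1, h2, h3, h4, h5, h6⟩ := hI
    have hn : τ.reg 0 = σ.reg 0 := h2 0 (by omega) (by omega)
    have hτ : Valid M τ.reg := by
      refine ⟨hn ▸ hσ.pos, fun i hi hiM => ?_⟩
      by_cases hix : i = x
      · subst hix; omega
      · rw [h2 i (by omega) hix, hn]; exact hσ.lt i hi hiM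
    have hφ : φ A τ.reg ↔ φ A (Function.update σ.reg x j) := h.supp fun i hi => by
      by_cases hix : i = x
      · subst hix; simp [h1]
      · simp [hix, h2 i (by omega) hix]
    refine Within.seq ((hp A τ hτ).mono (by rw [hn]) ?_)
    rintro υ ⟨hv, hr, ha⟩
    have hv' : υ.reg (N + 4) = if φ A (Function.update σ.reg x j) then 1 else 0 := by
      rw [hv]; simp [indic, hφ]
    have key : (∃ v < j + 1, φ A (Function.update σ.reg x v)) ↔
        (∃ v < j, φ A (Function.update σ.reg x v)) ∨ φ A (Function.update σ.reg x j) := by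
      constructor
      · rintro ⟨v, hv, h⟩
        rcases Nat.lt_succ_iff_lt_or_eq.1 hv with h' | rfl
        · exact Or.inl ⟨v, h', h⟩
        · exact Or.inr h
      · rintro (⟨v, hv, h⟩ | h)
        · exact ⟨v, by omega, h⟩
        · exact ⟨j, by omega, h⟩
    have hυ : υ.reg (N + 3) = 1 := by rw [hr _ (by omega), h4]
    refine Within.seq (S := 2) (T := 1)
      (Within.branch (T := 1) (fun hb => Within.instr <| Within.instr ?_)
        fun hb => Within.skip <| Within.instr ?_)
    · simp only [Test.eval, decide_eq_true_eq, hυ, hv'] at hb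
      have hj : φ A (Function.update σ.reg x j) := by
        by_contra hc
        simp [hc] at hb
      simp only [Instr.exec, State.setReg_reg, State.setReg_arr, key, hj, or_true, if_true]
      refine ⟨?_, fun i hi hix => ?_, ?_, ?_, ?_, fun hk => by rw [ha hk, h6 hk]⟩
      · rw [if_neg (by omega), hr x (by omega), h1]
      · rw [if_neg hix, if_neg (by omega), hr i (by omega), h2 i hi hix]
      · rw [if_neg (by omega), if_neg (by omega), hr _ (by omega), h3]
      · rw [if_neg (by omega), if_neg (by omega), hυ]
      · rw [if_neg (by omega)]
    · simp only [Test.eval, decide_eq_false_iff_not, hυ, hv'] at hb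
      have hj : ¬ φ A (Function.update σ.reg x j) := by
        intro hc
        simp [hc] at hb
      simp only [Instr.exec, State.setReg_reg, State.setReg_arr, key, hj, or_false, if_true]
      refine ⟨by rw [hr x (by omega), h1], fun i hi hix => ?_, ?_, ?_, ?_,
        fun hk => by rw [ha hk, h6 hk]⟩
      · rw [if_neg hix, hr i (by omega), h2 i hi hix]
      · rw [if_neg (by omega), hr _ (by omega), h3]
      · rw [if_neg (by omega), hυ]
      · rw [if_neg (by omega), hr _ (by omega), h5]
  · simp only [Instr.exec, State.setReg_reg, State.setReg_arr]
    refine ⟨by simp, fun i hi hix => ?_, ?_, ?_, ?_, by simp⟩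
    · rw [if_neg hix, if_neg (by omega), if_neg (by omega), if_neg (by omega)]
    · simp; omega
    · simp; omega
    · simp
  · rintro τ ⟨h1, h2, h3, h4, h5, h6⟩
    refine Within.instr_seq (T := 1) (Within.instr ?_)
    simp only [Instr.exec, State.setReg_reg, State.setReg_arr]
    refine ⟨?_, fun i hi => ?_, h6⟩
    · rw [if_pos trivial, if_neg (by omega), h5]
      simp [indic]
    · rw [if_neg (by omega)]
      split_ifs with hix
      · rw [h3, hix]
      · exact h2 i hi hix
  · have : 1 ≤ σ.reg 0 := hσ.pos
    have h1 : 1 ≤ σ.reg 0 ^ k := Nat.one_le_pow k _ hσ.pos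
    have h2 : σ.reg 0 ≤ σ.reg 0 * σ.reg 0 ^ k := Nat.le_mul_of_pos_right _ h1
    rw [pow_succ]
    nlinarith

theorem CompP.forall_lt (h : CompP M keep k φ) {x : ℕ} (hx0 : 0 < x) (hx : x < M) :
    CompP M keep (k + 1) (fun A ρ => ∀ v < ρ 0, φ A (Function.update ρ x v)) :=
  (h.not.exists_lt hx0 hx).not.congr fun A ρ => by simp

/-- Quantification over the values of the registers `1, …, K`. -/
theorem CompP.exists_block (K : ℕ) (hK : K < M) : ∀ {k : ℕ} {φ : Expr Prop}, CompP M keep k φ →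
    CompP M keep (k + K) (fun A ρ => ∃ ρ' : ℕ → ℕ, (∀ i, i = 0 ∨ K < i → ρ' i = ρ i) ∧
      (∀ i, 1 ≤ i → i ≤ K → ρ' i < ρ 0) ∧ φ A ρ') := by
  induction K with
  | zero =>
    intro k φ h
    refine CompP.congr h fun A ρ => ⟨fun h => ⟨ρ, fun _ _ => rfl, by omega, h⟩, ?_⟩
    rintro ⟨ρ', h1, -, h2⟩
    have : ρ' = ρ := funext fun i => h1 i (by omega)
    exact this ▸ h2
  | succ K ih =>
    intro k φ h
    have := ih (by omega) (h.exists_lt (x := K + 1) (by omega) hK)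
    rw [show k + 1 + K = k + (K + 1) by ring] at this
    refine this.congr fun A ρ => ⟨?_, ?_⟩
    · rintro ⟨ρ', h1, h2, v, hv, h3⟩
      refine ⟨_, fun i hi => ?_, fun i hi hi' => ?_, h3⟩
      · rw [Function.update_of_ne (by omega), h1 i (by omega)]
      · by_cases hiK : i = K + 1
        · subst hiK
          rw [Function.update_self, ← h1 0 (Or.inl rfl)]; exact hv
        · rw [Function.update_of_ne hiK]; exact h2 i hi (by omega)
    · rintro ⟨ρ', h1, h2, h3⟩
      refine ⟨Function.update ρ' (K + 1) (ρ (K + 1)), fun i hi => ?_, fun i hi hi' => ?_,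
        ρ' (K + 1), ?_, ?_⟩
      · by_cases hiK : i = K + 1
        · subst hiK; simp
        · rw [Function.update_of_ne hiK]; exact h1 i (by omega)
      · rw [Function.update_of_ne (by omega)]; exact h2 i hi (by omega)
      · rw [Function.update_of_ne (by omega), h1 0 (Or.inl rfl)]
        exact h2 _ (by omega) le_rfl
      · simpa using h3

end Comp

end GraphRAM

namespace GraphRAM

/-! ### Breadth-first search on the machine -/

section Search

variable {M k : ℕ} {φ : Expr Prop}

/-- The level of the vertex in register `v` in the breadth-first search from the vertex in
register `s` among the vertices satisfying `φ`; in `φ`, the vertex is held in register `y`. -/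
noncomputable def levelExpr (s v y : ℕ) (φ : Expr Prop) : Expr ℕ := fun A ρ =>
  level (ρ 0) (fun u w => u < ρ 0 ∧ A u w = 1) (fun z => φ A (Function.update ρ y z)) (ρ s) (ρ v)

/-- Search for a vertex `u` of level `k` adjacent to the vertex in register `y`. Register `N + 3`
holds `k`, register `N + 4` holds `k + 1`, and register `N + 9` holds `1`. -/
def searchProg (y N : ℕ) : Prog :=
  .seq (.instr (.const (N + 6) 0)) (.loop (.lt (N + 6) 0)
    (.seq (.instr (.load (N + 7) 0 (N + 6)))
    (.seq (.branch (.eq (N + 7) (N + 3))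
        (.seq (.instr (.adj (N + 8) (N + 6) y))
          (.branch (.eq (N + 8) (N + 9)) (.instr (.store 0 y (N + 4))) .skip))
        .skip)
      (.instr (.succ (N + 6))))))

open Classical in
theorem within_searchProg {A : ℕ → ℕ → ℕ} {y N n k : ℕ} {σ : State} (hN : 0 < N) (hy : y < N)
    (h0 : σ.reg 0 = n) (h3 : σ.reg (N + 3) = k) (h4 : σ.reg (N + 4) = k + 1)
    (h9 : σ.reg (N + 9) = 1) (hk : k < n) (ha : σ.arr 0 (σ.reg y) = n) :
    Within A (searchProg y N) σ (10 * n + 10) (fun τ =>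
      (∀ i < N + 6, τ.reg i = σ.reg i) ∧ τ.reg (N + 9) = 1 ∧
      (∀ z, z ≠ σ.reg y → τ.arr 0 z = σ.arr 0 z) ∧
      τ.arr 0 (σ.reg y) =
        if ∃ u < n, σ.arr 0 u = k ∧ A u (σ.reg y) = 1 then k + 1 else n) := by
  refine (Within.instr_seq (Within.forLoop (n := n) (T := 6) (I := fun j τ =>
    τ.reg (N + 6) = j ∧ (∀ i < N + 6, τ.reg i = σ.reg i) ∧ τ.reg (N + 9) = 1 ∧
      (∀ z, z ≠ σ.reg y → τ.arr 0 z = σ.arr 0 z) ∧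
      τ.arr 0 (σ.reg y) =
        if ∃ u < j, σ.arr 0 u = k ∧ A u (σ.reg y) = 1 then k + 1 else n)
    (fun j τ h => ⟨h.1, by rw [h.2.1 0 (by omega), h0]⟩) (fun j τ hj hI => ?_) ?_)).mono
    (by omega) fun τ h => ?_
  · obtain ⟨i6, ir, i9, iz, iy⟩ := hI
    have ty : τ.reg y = σ.reg y := ir y (by omega)
    have t3 : τ.reg (N + 3) = k := by rw [ir _ (by omega), h3]
    have t4 : τ.reg (N + 4) = k + 1 := by rw [ir _ (by omega), h4]
    -- The scan writes only to the entry of the vertex in register `y`, changing `n` to `k + 1`.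
    -- Neither value is `k`, so the scan may read the array it is modifying.
    have hjk : τ.arr 0 j = k ↔ σ.arr 0 j = k := by
      by_cases hjy : j = σ.reg y
      · rw [hjy, iy, ha]; split_ifs <;> omega
      · rw [iz j hjy]
    have key : (∃ u ≤ j, σ.arr 0 u = k ∧ A u (σ.reg y) = 1) ↔
        (∃ u < j, σ.arr 0 u = k ∧ A u (σ.reg y) = 1) ∨ (σ.arr 0 j = k ∧ A j (σ.reg y) = 1) := by
      constructor
      · rintro ⟨v, hv, h⟩
        rcases hv.lt_or_eq with h' | rfl
        · exact Or.inl ⟨v, h', h⟩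
        · exact Or.inr h
      · rintro (⟨v, hv, h⟩ | h)
        · exact ⟨v, by omega, h⟩
        · exact ⟨j, by omega, h⟩
    refine (Within.instr_seq (Within.seq (S := 4) (T := 1) (Within.branch (T := 3) (fun hb => ?_)
      fun hb => ?_))).mono le_rfl fun _ h => h
    · simp only [Test.eval, Instr.exec, State.setReg_reg, decide_eq_true_eq, i6, t3, if_true] at hb
      rw [if_neg (by omega), hjk] at hb
      refine Within.instr_seq (T := 2) (Within.branch (T := 1) (fun hb' => Within.instr <|
        Within.instr ?_) fun hb' => Within.skip <| Within.instr ?_)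
      · simp [Test.eval, Instr.exec, i6, i9, ty,
          show y ≠ N + 7 by omega] at hb'
        simp [Instr.exec, i6, i9, ty, t4, show y ≠ N + 8 by omega, show y ≠ N + 7 by omega]
        refine ⟨fun i hi => ?_, fun z hz => ?_, ?_⟩
        · rw [if_neg (by omega), if_neg (by omega), if_neg (by omega), ir i hi]
        · rw [if_neg hz, iz z hz]
        · exact fun hc => absurd hb' (hc j le_rfl hb)
      · simp [Test.eval, Instr.exec, i6, i9, ty,
          show y ≠ N + 7 by omega] at hb'
        simp [Instr.exec, i6, i9]
        refine ⟨fun i hi => ?_, fun z hz => iz z hz, ?_⟩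
        · rw [if_neg (by omega), if_neg (by omega), if_neg (by omega), ir i hi]
        · rw [iy]
          refine if_congr ?_ rfl rfl
          rw [key]
          exact ⟨Or.inl, fun h => h.elim id fun h => absurd h.2 hb'⟩
    · simp only [Test.eval, Instr.exec, State.setReg_reg, decide_eq_false_iff_not, i6, t3,
        if_true] at hb
      rw [if_neg (by omega), hjk] at hb
      refine (Within.skip <| Within.instr ?_).mono (by omega) fun _ h => h
      simp [Instr.exec, i6, i9]
      refine ⟨fun i hi => ?_, fun z hz => iz z hz, ?_⟩
      · rw [if_neg (by omega), if_neg (by omega), ir i hi]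
      · rw [iy]
        refine if_congr ?_ rfl rfl
        rw [key]
        exact ⟨Or.inl, fun h => h.elim id fun h => absurd h.1 hb⟩
  · simp [Instr.exec, h9, ha]
    exact fun i hi h => by omega
  · obtain ⟨i6, ir, i9, iz, iy⟩ := h
    exact ⟨ir, i9, iz, by rw [iy]⟩

/-- One round of the search; `p` decides membership of the vertex in register `y`. -/
def roundProg (y N : ℕ) (p : Prog) : Prog :=
  .seq (.instr (.const y 0)) (.loop (.lt y 0)
    (.seq (.instr (.load (N + 5) 0 y))
    (.seq (.branch (.eq (N + 5) 0)
        (.seq p (.branch (.eq (N + 10) (N + 9)) (searchProg y N) .skip))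
        .skip)
      (.instr (.succ y)))))

open Classical in
theorem within_roundProg {A : ℕ → ℕ → ℕ} {y N n k T : ℕ} {p : Prog} {σ : State} {W : ℕ → Prop}
    (hN : 0 < N) (hy0 : 0 < y) (hy : y < N)
    (hp : ∀ τ, (∀ i < N, i ≠ y → τ.reg i = σ.reg i) → τ.reg y < n →
      Within A p τ T (fun υ => υ.reg (N + 10) = (if W (τ.reg y) then 1 else 0) ∧
        (∀ i < N + 10, υ.reg i = τ.reg i) ∧ υ.arr = τ.arr))
    (h0 : σ.reg 0 = n) (h3 : σ.reg (N + 3) = k) (h4 : σ.reg (N + 4) = k + 1)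
    (h9 : σ.reg (N + 9) = 1) (hk : k < n) :
    Within A (roundProg y N p) σ (n * (T + 10 * n + 15) + 2) (fun τ =>
      (∀ i < N + 5, i ≠ y → τ.reg i = σ.reg i) ∧ τ.reg (N + 9) = 1 ∧
      ∀ z < n, τ.arr 0 z = if σ.arr 0 z = n then
        if W z ∧ ∃ u < n, σ.arr 0 u = k ∧ A u z = 1 then k + 1 else n else σ.arr 0 z) := by
  refine (Within.instr_seq (Within.forLoop (n := n) (T := T + 10 * n + 14) (I := fun j τ =>
    τ.reg y = j ∧ (∀ i < N + 5, i ≠ y → τ.reg i = σ.reg i) ∧ τ.reg (N + 9) = 1 ∧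
      ∀ z < n, τ.arr 0 z = if z < j ∧ σ.arr 0 z = n then
        if W z ∧ ∃ u < n, σ.arr 0 u = k ∧ A u z = 1 then k + 1 else n else σ.arr 0 z)
    (fun j τ h => ⟨h.1, by rw [h.2.1 0 (by omega) (by omega), h0]⟩) (fun j τ hj hI => ?_) ?_)).mono
    ?_ fun τ h => ?_
  · obtain ⟨iy, ir, i9, iz⟩ := hI
    have t0 : τ.reg 0 = n := by rw [ir 0 (by omega) (by omega), h0]
    have hj' : τ.arr 0 j = σ.arr 0 j := by rw [iz j hj, if_neg (by omega)]
    -- Updating in place is harmless: entries written during the round turn from `n` to `k + 1`, so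
    -- the vertices of level exactly `k` remain the same.
    have hu : ∀ u < n, (τ.arr 0 u = k ↔ σ.arr 0 u = k) := by
      intro u hu
      rw [iz u hu]
      split_ifs <;> omega
    have hlt : ∀ z, z ≠ j → (z < j + 1 ∧ σ.arr 0 z = n ↔ z < j ∧ σ.arr 0 z = n) := by omega
    have e1 : ∀ i, i ≠ N + 5 → (Instr.exec A (.load (N + 5) 0 y) τ).reg i = τ.reg i := by
      intro i hi; simp [Instr.exec, hi]
    have e5 : (Instr.exec A (.load (N + 5) 0 y) τ).reg (N + 5) = τ.arr 0 j := by
      simp [Instr.exec, iy]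
    have ea : (Instr.exec A (.load (N + 5) 0 y) τ).arr = τ.arr := rfl
    refine (Within.instr_seq (Within.seq (T := 1) (Within.branch (T := T + 10 * n + 11)
      (fun hb => ?_) fun hb => ?_))).mono (by omega) fun _ h => h
    · simp only [Test.eval, decide_eq_true_eq, e5, e1 0 (by omega), t0] at hb
      generalize Instr.exec A (.load (N + 5) 0 y) τ = τ' at *
      refine (Within.seq (S := T) (T := 10 * n + 11) ((hp τ' (fun i hi hiy => by
        rw [e1 i (by omega), ir i (by omega) hiy]) (by rw [e1 y (by omega), iy]; exact hj)).mono
        le_rfl ?_)).mono (by omega) fun _ h => h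
      rintro υ ⟨hv, hr, har⟩
      rw [e1 y (by omega), iy] at hv
      have u9 : υ.reg (N + 9) = 1 := by rw [hr _ (by omega), e1 _ (by omega), i9]
      have uy : υ.reg y = j := by rw [hr _ (by omega), e1 _ (by omega), iy]
      have ur : ∀ i < N + 5, i ≠ y → υ.reg i = σ.reg i := fun i hi hiy => by
        rw [hr _ (by omega), e1 _ (by omega), ir i hi hiy]
      have ua : ∀ z, υ.arr 0 z = τ.arr 0 z := fun z => by rw [har, ea]
      refine Within.branch (T := 10 * n + 10) (fun hb' => ?_) fun hb' => ?_
      · simp only [Test.eval, decide_eq_true_eq, hv, u9] at hb'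
        have hW : W j := by
          by_contra hc
          simp [hc] at hb'
        refine (within_searchProg (A := A) (σ := υ) hN hy
          (by rw [ur 0 (by omega) (by omega), h0])
          (by rw [ur _ (by omega) (by omega), h3]) (by rw [ur _ (by omega) (by omega), h4]) u9 hk
          (by rw [uy, ua, hb])).mono le_rfl ?_
        rintro ω ⟨wr, w9, wz, wy⟩
        refine Within.instr ?_
        simp only [Instr.exec, State.setReg_reg, State.setReg_arr, if_true]
        refine ⟨by rw [wr y (by omega), uy], fun i hi hiy => ?_, ?_, fun z hz => ?_⟩
        · rw [if_neg hiy, wr i (by omega), ur i hi hiy]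
        · rw [if_neg (by omega), w9]
        · by_cases hzj : z = j
          · subst hzj
            rw [uy] at wy
            rw [wy, if_pos (show z < z + 1 ∧ σ.arr 0 z = n from ⟨by omega, by rw [← hj', hb]⟩)]
            refine if_congr ?_ rfl rfl
            constructor
            · rintro ⟨u, h1, h2, h3⟩
              exact ⟨hW, u, h1, (hu u h1).1 (by rw [← ua, h2]), h3⟩
            · rintro ⟨-, u, h1, h2, h3⟩
              exact ⟨u, h1, by rw [ua, (hu u h1).2 h2], h3⟩
          · rw [wz z (by rw [uy]; exact hzj), ua, iz z hz]
            exact if_congr (hlt z hzj).symm rfl rfl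
      · simp only [Test.eval, decide_eq_false_iff_not, hv, u9] at hb'
        have hW : ¬ W j := by
          intro hc
          simp [hc] at hb'
        refine (Within.skip (Within.instr ?_)).mono (by omega) fun _ h => h
        simp only [Instr.exec, State.setReg_reg, State.setReg_arr, if_true]
        refine ⟨by rw [uy], fun i hi hiy => ?_, ?_, fun z hz => ?_⟩
        · rw [if_neg hiy, ur i hi hiy]
        · rw [if_neg (by omega), u9]
        · by_cases hzj : z = j
          · subst hzj
            rw [ua, hb, if_pos ⟨by omega, by rw [← hj', hb]⟩, if_neg (fun h => hW h.1)]
          · rw [ua, iz z hz]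
            exact if_congr (hlt z hzj).symm rfl rfl
    · simp only [Test.eval, decide_eq_false_iff_not, e5, e1 0 (by omega), t0] at hb
      generalize Instr.exec A (.load (N + 5) 0 y) τ = τ' at *
      refine (Within.skip (Within.instr ?_)).mono (by omega) fun _ h => h
      simp only [Instr.exec, State.setReg_reg, State.setReg_arr, if_true]
      refine ⟨by rw [e1 y (by omega), iy], fun i hi hiy => ?_, ?_, fun z hz => ?_⟩
      · rw [if_neg hiy, e1 i (by omega), ir i hi hiy]
      · rw [if_neg (by omega), e1 _ (by omega), i9]
      · rw [ea]
        by_cases hzj : z = j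
        · subst hzj
          rw [if_neg (fun h => hb (by rw [hj', h.2])), hj']
        · rw [iz z hz]
          exact if_congr (hlt z hzj).symm rfl rfl
  · simp only [Instr.exec, State.setReg_reg, State.setReg_arr, if_true]
    refine ⟨trivial, fun i hi hiy => ?_, ?_, fun z hz => ?_⟩
    · rw [if_neg hiy]
    · rw [if_neg (by omega), h9]
    · rw [if_neg (by omega)]
  · ring_nf; omega
  · obtain ⟨iy, ir, i9, iz⟩ := h
    refine ⟨ir, i9, fun z hz => ?_⟩
    rw [iz z hz]
    exact if_congr (by simp [hz]) rfl rfl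

/-- Breadth-first search. -/
def levelProg (s v y N : ℕ) (p : Prog) : Prog :=
  -- Register `y` serves as loop variable and is saved in `N + 1`. Array `0` is first filled with
  -- `n`, for "not reached".
  .seq (.instr (.copy (N + 1) y)) (.seq (.instr (.const y 0))
  (.seq (.loop (.lt y 0) (.seq (.instr (.store 0 y 0)) (.instr (.succ y))))
  (.seq (.instr (.const (N + 2) 0)) (.seq (.instr (.store 0 s (N + 2)))
  (.seq (.instr (.const (N + 3) 0)) (.seq (.instr (.const (N + 4) 1))
  (.seq (.instr (.const (N + 9) 1))
  (.seq (.loop (.lt (N + 3) 0) (.seq (roundProg y N p)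
    (.seq (.instr (.succ (N + 3))) (.instr (.succ (N + 4))))))
  (.seq (.instr (.load N 0 v)) (.instr (.copy y (N + 1))))))))))))

/-- The membership test `φ` runs while the levels are stored in array `0`, so it must keep the
arrays; the search itself does not. The exponent is `3` because each of `n` rounds scans all
vertices for every vertex, with a test of constant cost. The registers `s` and `v` must differ from
`y`, which is overwritten. -/
theorem Comp.level (h : CompP M True 0 φ) {s v y : ℕ} (hs0 : 0 < s) (hv0 : 0 < v) (hy0 : 0 < y)
    (hs : s < M) (hv : v < M) (hy : y < M) (hsy : s ≠ y) (hvy : v ≠ y) :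
    Comp M False 3 (levelExpr s v y φ) := by
  classical
  have hM := Comp.pos h
  refine ⟨hM, fun A ρ ρ' hρ => ?_, fun N hN => ?_⟩
  · have h1 : ∀ z, φ A (Function.update ρ y z) ↔ φ A (Function.update ρ' y z) := fun v =>
      h.supp fun i hi => by
        by_cases hix : i = y
        · subst hix; simp
        · simp [hix, hρ i hi]
    simp only [levelExpr, h1, hρ 0 hM, hρ s hs, hρ v hv]
  obtain ⟨p, C, hp⟩ := Comp.prog h (N + 10) (by omega)
  refine ⟨levelProg s v y N p, C + 50, fun A σ hσ => ?_⟩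
  obtain ⟨n, h0⟩ : ∃ n, σ.reg 0 = n := ⟨_, rfl⟩
  have hn : 0 < n := h0 ▸ hσ.pos
  have hsn : σ.reg s < n := h0 ▸ hσ.lt s hs0 hs
  have hvn : σ.reg v < n := h0 ▸ hσ.lt v hv0 hv
  set r : ℕ → ℕ → Prop := fun u w => u < n ∧ A u w = 1 with hr
  set W : ℕ → Prop := fun z => φ A (Function.update σ.reg y z) with hW
  refine (Within.instr_seq <| Within.instr_seq <| Within.seq (S := n * (2 + 1) + 1)
    (T := n * (n * (C + 10 * n + 15) + 4 + 1) + 8) <|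
    (Within.forLoop (n := n) (T := 2) (I := fun j τ =>
    τ.reg y = j ∧ (∀ i < N, i ≠ y → τ.reg i = σ.reg i) ∧ τ.reg (N + 1) = σ.reg y ∧
      ∀ z < j, τ.arr 0 z = n)
    (fun j τ h => ⟨h.1, by rw [h.2.1 0 (by omega) (by omega), h0]⟩) (fun j τ hj hI => ?_) ?_).mono
    le_rfl (fun τ hI => ?_)).mono (T := (C + 50) * σ.reg 0 ^ 3) ?_ fun _ h => h
  · obtain ⟨iy, ir, i1, iz⟩ := hI
    have t0 : τ.reg 0 = n := by rw [ir 0 (by omega) (by omega), h0]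
    refine Within.instr_seq <| Within.instr ?_
    simp only [Instr.exec, State.setReg_reg, State.setReg_arr, State.setArr_reg, if_true,
      State.setArr_arr, true_and, iy]
    refine ⟨fun i hi hiy => ?_, ?_, fun z hz => ?_⟩
    · rw [if_neg hiy, ir i hi hiy]
    · rw [if_neg (by omega), i1]
    · split_ifs with hzj
      · exact t0
      · exact iz z (by omega)
  · simp only [Instr.exec, State.setReg_reg, State.setReg_arr, if_true]
    refine ⟨trivial, fun i hi hiy => ?_, ?_, fun z hz => ?_⟩
    · rw [if_neg hiy, if_neg (by omega)]
    · rw [if_neg (by omega)]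
    · omega
  · obtain ⟨iy, ir, i1, iz⟩ := hI
    refine (Within.instr_seq <| Within.instr_seq <| Within.instr_seq <| Within.instr_seq <|
      Within.instr_seq <| Within.seq (T := 2) <|
      (Within.forLoop (n := n) (T := n * (C + 10 * n + 15) + 4) (I := fun j τ =>
        τ.reg (N + 3) = j ∧ τ.reg (N + 4) = j + 1 ∧ τ.reg (N + 9) = 1 ∧
        (∀ i < N, i ≠ y → τ.reg i = σ.reg i) ∧ τ.reg (N + 1) = σ.reg y ∧
        ∀ z < n, τ.arr 0 z = if _root_.level n r W (σ.reg s) z ≤ j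
          then _root_.level n r W (σ.reg s) z else n)
      (fun j τ h => ⟨h.1, by rw [h.2.2.2.1 0 (by omega) (by omega), h0]⟩)
      (fun j τ' hj hI => ?_) ?_).mono le_rfl (fun τ' hI => ?_)).mono (by omega) fun _ h => h
    · obtain ⟨j3, j4, j9, jr, j1, jz⟩ := hI
      have t0 : τ'.reg 0 = n := by rw [jr 0 (by omega) (by omega), h0]
      refine (Within.seq (T := 2) <| (within_roundProg (A := A) (W := W) (T := C) (n := n) (k := j)
        (by omega) hy0 (by omega) (fun υ hυ hυy => ?_) t0 j3 j4 j9 hj).mono le_rfl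
        fun υ hυ => ?_).mono (by omega) fun _ h => h
      · have hυr : ∀ i < N, i ≠ y → υ.reg i = σ.reg i := fun i hi hiy => by
          rw [hυ i hi hiy, jr i hi hiy]
        have hυn : υ.reg 0 = n := by rw [hυr 0 (by omega) (by omega), h0]
        have hV : Valid M υ.reg := by
          refine ⟨hυn ▸ hn, fun i hi hiM => ?_⟩
          by_cases hix : i = y
          · subst hix; omega
          · rw [hυr i (by omega) hix, hυn, ← h0]; exact hσ.lt i hi hiM
        refine (hp A υ hV).mono (by simp) ?_
        rintro ω ⟨w1, w2, w3⟩
        refine ⟨?_, w2, w3 trivial⟩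
        rw [w1, indic]
        have : φ A υ.reg ↔ W (υ.reg y) := by
          refine h.supp fun i hi => ?_
          by_cases hix : i = y
          · subst hix; simp
          · simp [hix, hυr i (by omega) hix]
        by_cases hw : W (υ.reg y)
        · rw [if_pos hw, if_pos (this.2 hw)]
        · rw [if_neg hw, if_neg (fun h => hw (this.1 h))]
      · obtain ⟨u1, u9, uz⟩ := hυ
        refine Within.instr_seq <| Within.instr ?_
        simp only [Instr.exec, State.setReg_reg, State.setReg_arr, if_true]
        refine ⟨?_, ?_, ?_, fun i hi hiy => ?_, ?_, fun z hz => ?_⟩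
        · rw [if_neg (by omega), u1 _ (by omega) (by omega), j3]
        · rw [if_neg (by omega), u1 _ (by omega) (by omega), j4]
        · rw [if_neg (by omega), if_neg (by omega), u9]
        · rw [if_neg (by omega), if_neg (by omega), u1 _ (by omega) hiy, jr i hi hiy]
        · rw [if_neg (by omega), if_neg (by omega), u1 _ (by omega) (by omega), j1]
        · rw [level_round hj, uz z hz, jz z hz]
          have hle : (if _root_.level n r W (σ.reg s) z ≤ j then _root_.level n r W (σ.reg s) z
              else n) = n ↔ ¬ _root_.level n r W (σ.reg s) z ≤ j := by
            split_ifs with h1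
            · simp only [h1, not_true, iff_false]; omega
            · simp [h1]
          by_cases h1 : _root_.level n r W (σ.reg s) z ≤ j
          · rw [if_neg (fun h => hle.1 h h1), if_pos h1, if_pos h1]
          · rw [if_pos (hle.2 h1), if_neg h1]
            refine if_congr (and_congr_right fun _ => ?_) rfl rfl
            constructor
            · rintro ⟨u, hu, h2, h3⟩
              exact ⟨u, by rw [← jz u hu, h2], hu, h3⟩
            · rintro ⟨u, h2, hu, h3⟩
              exact ⟨u, hu, by rw [jz u hu, h2], h3⟩
    · simp only [Instr.exec, State.setReg_reg, State.setReg_arr, if_true, State.setArr_reg,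
        State.setArr_arr, true_and]
      refine ⟨?_, ?_, fun i hi hiy => ?_, ?_, fun z hz => ?_⟩
      · simp
      · simp
      · rw [if_neg (by omega), if_neg (by omega), if_neg (by omega), if_neg (by omega), ir i hi hiy]
      · rw [if_neg (by omega), if_neg (by omega), if_neg (by omega), if_neg (by omega), i1]
      · rw [if_neg (by omega : ¬ s = N + 2), ir s (by omega) hsy]
        by_cases hzs : z = σ.reg s
        · rw [if_pos hzs, if_pos ((level_self hn).2 hzs).le, (level_self hn).2 hzs]
        · rw [if_neg hzs, iz z hz, if_neg]
          intro hc
          exact hzs ((level_self hn).1 (Nat.le_zero.1 hc))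
    · obtain ⟨j3, j4, j9, jr, j1, jz⟩ := hI
      refine Within.instr_seq <| Within.instr ?_
      simp only [Instr.exec, State.setReg_reg, State.setReg_arr, if_true]
      refine ⟨?_, fun i hi => ?_, False.elim⟩
      -- After `n` rounds the cut-off in the invariant is vacuous, since levels are at most `n`.
      · rw [if_neg (by omega), jr v (by omega) hvy, jz _ hvn, if_pos level_le, levelExpr]
        simp only [h0, hr, hW]
      · rw [if_neg (by omega : ¬ N + 1 = N)]
        split_ifs with h1 h2
        · rw [j1, h1]
        · omega
        · exact jr i hi h1
  · rw [h0]
    have h1 : n ≤ n ^ 3 := Nat.le_self_pow (by omega) n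
    have h2 : n ^ 2 ≤ n ^ 3 := Nat.pow_le_pow_right hn (by omega)
    have h3 : C * n ^ 2 ≤ C * n ^ 3 := Nat.mul_le_mul_left C h2
    ring_nf
    ring_nf at h3
    nlinarith

end Search

end GraphRAM

/-! ## Shortest walks -/

section Walks

variable {V : Type*} {r : V → V → Prop} {W W' : V → Prop} {j k : ℕ} {u v w : V}

theorem WalkIn.trans (h : WalkIn r W j u v) : ∀ {k w}, WalkIn r W k v w → WalkIn r W (j + k) u w
  | 0, _, h' => by cases h'; exact h
  | _ + 1, _, ⟨x, h', hx⟩ => ⟨x, h.trans h', hx⟩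

theorem WalkIn.mono (hW : ∀ v, W v → W' v) : ∀ {k w}, WalkIn r W k u w → WalkIn r W' k u w
  | 0, _, h => h
  | _ + 1, _, ⟨x, h, hx, hw⟩ => ⟨x, h.mono hW, hx, hW _ hw⟩

theorem WalkIn.single (h : r u v) (hv : W v) : WalkIn r W 1 u v := ⟨u, rfl, h, hv⟩

theorem WalkIn.of_seq (q : ℕ → V) (i : ℕ) : ∀ k,
    (∀ j, i ≤ j → j < i + k → r (q j) (q (j + 1)) ∧ W (q (j + 1))) →
      WalkIn r W k (q i) (q (i + k))
  | 0, _ => rfl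
  | k + 1, h => ⟨q (i + k), WalkIn.of_seq q i k fun j hj hj' => h j hj (by omega),
      h (i + k) (by omega) (by omega)⟩

theorem WalkIn.exists_seq : ∀ {k v}, WalkIn r W k u v →
    ∃ q : ℕ → V, q 0 = u ∧ q k = v ∧ ∀ j < k, r (q j) (q (j + 1)) ∧ W (q (j + 1))
  | 0, v, h => ⟨fun _ => u, rfl, h, by omega⟩
  | k + 1, v, ⟨x, h, hx⟩ => by
    obtain ⟨q, h0, hk, hq⟩ := h.exists_seq
    refine ⟨fun j => if j ≤ k then q j else v, by simp [h0], by simp, fun j hj => ?_⟩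
    rcases Nat.lt_succ_iff_lt_or_eq.1 hj with h' | rfl
    · simpa [h'.le, Nat.succ_le_of_lt h'] using hq j h'
    · simpa [hk] using hx

/-- Only the first vertex of a walk is exempt from `W`. In the reversed walk `u` is no longer the
first, whence `hu`. -/
theorem WalkIn.reverse (hr : ∀ x y, r x y → r y x) (hu : W u) (h : WalkIn r W k u v) :
    WalkIn r W k v u := by
  obtain ⟨q, h0, hk, hq⟩ := h.exists_seq
  have := WalkIn.of_seq (r := r) (W := W) (fun j => q (k - j)) 0 k fun j _ hj => by
    obtain ⟨i, hi⟩ : ∃ i, k = j + 1 + i := ⟨k - (j + 1), by omega⟩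
    have h1 : k - j = i + 1 := by omega
    have h2 : k - (j + 1) = i := by omega
    refine ⟨?_, ?_⟩
    · simp only [h1, h2]
      exact hr _ _ (hq i (by omega)).1
    · simp only [h2]
      cases i with
      | zero => rw [h0]; exact hu
      | succ i => exact (hq i (by omega)).2
  simpa [h0, hk] using this

/-- A shortest walk is injective and has no shortcuts. -/
theorem WalkIn.shortest {q : ℕ → V} (hq : ∀ j < k, r (q j) (q (j + 1)) ∧ W (q (j + 1)))
    (hmin : ∀ j, WalkIn r W j (q 0) (q k) → k ≤ j) {s t : ℕ} (hst : s < t) (ht : t ≤ k) :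
    q s ≠ q t ∧ (r (q s) (q t) → t = s + 1) := by
  have h1 : WalkIn r W s (q 0) (q s) := by
    simpa using WalkIn.of_seq (r := r) (W := W) q 0 s fun j _ hj => hq j (by omega)
  have h2 : WalkIn r W (k - t) (q t) (q k) := by
    have := WalkIn.of_seq (r := r) (W := W) q t (k - t) fun j _ hj => hq j (by omega)
    rwa [Nat.add_sub_cancel' ht] at this
  refine ⟨fun h => ?_, fun h => ?_⟩
  -- A repetition or a chord allows the part between `s` and `t` to be left out or replaced by one
  -- step.
  · have := hmin _ (h1.trans (h ▸ h2))
    omega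
  · have hW : W (q t) := by
      obtain ⟨t, rfl⟩ : ∃ t', t = t' + 1 := ⟨t - 1, by omega⟩
      exact (hq t (by omega)).2
    have := hmin _ ((h1.trans (WalkIn.single h hW)).trans h2)
    omega

theorem WalkIn.exists_shortest (h : ∃ k, WalkIn r W k u v) :
    ∃ (q : ℕ → V) (k : ℕ), q 0 = u ∧ q k = v ∧ (∀ j < k, r (q j) (q (j + 1)) ∧ W (q (j + 1))) ∧
      ∀ j, WalkIn r W j u v → k ≤ j := by
  classical
  obtain ⟨q, h0, hk, hq⟩ := (Nat.find_spec h).exists_seq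
  exact ⟨q, Nat.find h, h0, hk, hq, fun j hj => Nat.find_min' h hj⟩

end Walks

/-! ## Pyramids of vertex sets

It is convenient to replace the paths of a pyramid by connected sets. -/

section SetPyramid

variable {V : Type*} {G : SimpleGraph V} {ℓ : ℕ}

/-- The distance from `a` to `b` in `X ∪ {a}` is at least `ℓ`, as witnessed by a potential. -/
def SimpleGraph.Far (G : SimpleGraph V) (ℓ : ℕ) (X : Finset V) (a b : V) : Prop :=
  ∃ f : V → ℕ, f a = 0 ∧ ℓ ≤ f b ∧
    ∀ x y, x = a ∨ x ∈ X → y = a ∨ y ∈ X → G.Adj x y → f y ≤ f x + 1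

/-- `X` and `Y` are disjoint, and the only edge between them is the one joining `b` and `c`. -/
def SimpleGraph.OnlyEdge (G : SimpleGraph V) (X : Finset V) (b : V) (Y : Finset V) (c : V) :
    Prop :=
  ∀ x ∈ X, ∀ y ∈ Y, x ≠ y ∧ (G.Adj x y ↔ x = b ∧ y = c)

/-- No chordlessness is demanded: all conditions except `mem` and `reach` pass to subsets, so
shortest paths inside the sets are automatically legs of a pyramid. This makes competitors for a
minimum pyramid easy to exhibit. -/
structure SetPyramid (G : SimpleGraph V) (ℓ : ℕ) (a : V) (b : Fin 3 → V) (X : Fin 3 → Finset V) :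
    Prop where
  apex : ∀ i, a ∉ X i
  mem : ∀ i, b i ∈ X i
  reach : ∀ i, ∃ k, WalkIn G.Adj (· ∈ X i) k a (b i)
  sep : ∀ i j, i ≠ j → G.OnlyEdge (X i) (b i) (X j) (b j)
  far : ∃ i j, i ≠ j ∧ G.Far ℓ (X i) a (b i) ∧ G.Far ℓ (X j) a (b j)

theorem SimpleGraph.OnlyEdge.symm {X Y : Finset V} {b c : V} (h : G.OnlyEdge X b Y c) :
    G.OnlyEdge Y c X b := fun y hy x hx =>
  ⟨(h x hx y hy).1.symm, by rw [G.adj_comm, (h x hx y hy).2, and_comm]⟩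

theorem SimpleGraph.Far.subset {X Y : Finset V} {a b : V} (h : G.Far ℓ X a b) (hY : Y ⊆ X) :
    G.Far ℓ Y a b := by
  obtain ⟨f, h0, hb, hf⟩ := h
  exact ⟨f, h0, hb, fun x y hx hy => hf x y (hx.imp_right (@hY x)) (hy.imp_right (@hY y))⟩

/-- The potential starts at `0` and rises by at most one with each edge of the walk. -/
theorem SimpleGraph.Far.le_length {X : Finset V} {a b : V} (h : G.Far ℓ X a b) {k : ℕ}
    (hk : WalkIn G.Adj (· ∈ X) k a b) : ℓ ≤ k := by
  obtain ⟨f, h0, hb, hf⟩ := h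
  refine hb.trans ?_
  suffices H : ∀ k v, WalkIn G.Adj (· ∈ X) k a v → f v ≤ k ∧ (v = a ∨ v ∈ X) from (H k b hk).1
  intro k
  induction k with
  | zero => rintro v rfl; simp [h0]
  | succ k ih =>
    rintro v ⟨w, hw, hr, hv⟩
    obtain ⟨h1, h2⟩ := ih w hw
    have := hf w v h2 (Or.inr hv) hr
    exact ⟨by omega, Or.inr hv⟩

/-- To see that `b` is far from `w 0` it suffices to look at an initial segment `w`. -/
theorem SimpleGraph.Far.of_initial {w : ℕ → V} {X : Finset V} {b : V} (hb : ∀ s < ℓ, b ≠ w s)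
    (h : ∀ v ∈ X, ∀ s, s + 1 < ℓ → G.Adj (w s) v → ∃ t ≤ s + 1, v = w t) :
    G.Far ℓ X (w 0) b := by
  have hle : ∀ v s, v = w s → sInf ({s | v = w s} ∪ {ℓ}) ≤ s := fun v s hs =>
    Nat.sInf_le (Or.inl hs)
  have hmem : ∀ v, sInf ({s | v = w s} ∪ {ℓ}) ∈ ({s | v = w s} ∪ {ℓ} : Set ℕ) := fun v =>
    Nat.sInf_mem ⟨ℓ, Or.inr rfl⟩
  have hℓ : ∀ v, sInf ({s | v = w s} ∪ {ℓ}) ≤ ℓ := fun v => Nat.sInf_le (Or.inr rfl)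
  -- The potential of `v` is its first position on `w`, cut off at `ℓ`; vertices off `w` get `ℓ`. It
  -- can only jump at an edge leaving an early vertex of `w`, which `h` controls.
  refine ⟨fun v => sInf ({s | v = w s} ∪ {ℓ}), Nat.le_zero.1 (hle _ 0 rfl), ?_, ?_⟩
  · by_contra! hlt
    rcases hmem b with h' | h'
    · exact hb _ hlt h'
    · exact hlt.ne h'
  · intro x y hx hy hxy
    dsimp only
    by_cases hlt : sInf ({s | x = w s} ∪ {ℓ}) + 1 < ℓ
    · rcases hmem x with h' | h'
      · rcases hy with rfl | hy
        · rw [Nat.le_zero.1 (hle _ 0 rfl)]; omega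
        · have h'' : x = w (sInf ({s | x = w s} ∪ {ℓ})) := h'
          obtain ⟨t, ht, hyt⟩ := h y hy _ hlt (h'' ▸ hxy)
          exact (hle y t hyt).trans ht
      · have : sInf ({s | x = w s} ∪ {ℓ}) = ℓ := h'
        omega
    · have := hℓ y
      omega

theorem SetPyramid.of_three {a b₁ b₂ b₃ : V} {X₁ X₂ X₃ : Finset V}
    (a₁ : a ∉ X₁) (a₂ : a ∉ X₂) (a₃ : a ∉ X₃) (m₁ : b₁ ∈ X₁) (m₂ : b₂ ∈ X₂) (m₃ : b₃ ∈ X₃)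
    (r₁ : ∃ k, WalkIn G.Adj (· ∈ X₁) k a b₁) (r₂ : ∃ k, WalkIn G.Adj (· ∈ X₂) k a b₂)
    (r₃ : ∃ k, WalkIn G.Adj (· ∈ X₃) k a b₃) (s₁₂ : G.OnlyEdge X₁ b₁ X₂ b₂)
    (s₁₃ : G.OnlyEdge X₁ b₁ X₃ b₃) (s₂₃ : G.OnlyEdge X₂ b₂ X₃ b₃)
    (f₂ : G.Far ℓ X₂ a b₂) (f₃ : G.Far ℓ X₃ a b₃) :
    SetPyramid G ℓ a ![b₁, b₂, b₃] ![X₁, X₂, X₃] where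
  apex i := by fin_cases i <;> assumption
  mem i := by fin_cases i <;> assumption
  reach i := by fin_cases i <;> assumption
  sep i j hij := by
    fin_cases i <;> fin_cases j <;> first | exact absurd rfl hij | skip
    · exact s₁₂
    · exact s₁₃
    · exact s₁₂.symm
    · exact s₂₃
    · exact s₁₃.symm
    · exact s₂₃.symm
  far := ⟨1, 2, by decide, f₂, f₃⟩

theorem SetPyramid.subset {a : V} {b : Fin 3 → V} {X Y : Fin 3 → Finset V}
    (h : SetPyramid G ℓ a b X) (hY : ∀ i, Y i ⊆ X i) (hm : ∀ i, b i ∈ Y i)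
    (hr : ∀ i, ∃ k, WalkIn G.Adj (· ∈ Y i) k a (b i)) : SetPyramid G ℓ a b Y where
  apex i hi := h.apex i (hY i hi)
  mem := hm
  reach := hr
  sep i j hij x hx y hy := h.sep i j hij x (hY i hx) y (hY j hy)
  far := by
    obtain ⟨i, j, hij, hi, hj⟩ := h.far
    exact ⟨i, j, hij, hi.subset (hY i), hj.subset (hY j)⟩

open Classical in
/-- The vertices `p s, …, p t` of a sequence. -/
noncomputable def seg (p : ℕ → V) (s t : ℕ) : Finset V := (Finset.Icc s t).image p

theorem mem_seg {p : ℕ → V} {s t : ℕ} {x : V} : x ∈ seg p s t ↔ ∃ j, s ≤ j ∧ j ≤ t ∧ p j = x := by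
  simp [seg, and_assoc]

theorem card_seg_le {p : ℕ → V} {s t : ℕ} : (seg p s t).card ≤ t + 1 - s := by
  classical
  exact Finset.card_image_le.trans (by simp)

/-- A long pyramid given by its three paths, with the fewest vertices. -/
structure MinPyramid (G : SimpleGraph V) (ℓ : ℕ) (p : Fin 3 → ℕ → V) (L : Fin 3 → ℕ) : Prop where
  apex : ∀ i j, p i 0 = p j 0
  pos : ∀ i, 1 ≤ L i
  adj : ∀ i s, s < L i → G.Adj (p i s) (p i (s + 1))
  inj : ∀ i s t, s ≤ L i → t ≤ L i → p i s = p i t → s = t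
  ind : ∀ i s t, s ≤ L i → t ≤ L i → G.Adj (p i s) (p i t) → t = s + 1 ∨ s = t + 1
  sep : ∀ i j, i ≠ j → ∀ s t, 1 ≤ s → s ≤ L i → 1 ≤ t → t ≤ L j →
    p i s ≠ p j t ∧ (G.Adj (p i s) (p j t) ↔ s = L i ∧ t = L j)
  far : ∃ i j, i ≠ j ∧ ℓ ≤ L i ∧ ℓ ≤ L j
  -- The left side counts the vertices other than the apex. Comparing with all set pyramids, not
  -- just with triples of paths, strengthens the minimality.
  opt : ∀ a b X, SetPyramid G ℓ a b X → L 0 + L 1 + L 2 ≤ (X 0).card + (X 1).card + (X 2).card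

/-- Shortest walks inside the sets `X i` span a set pyramid with at most as many vertices as their
total length. By `opt` they cannot be shorter than the given walks, so the given walks are
themselves shortest, hence injective and chordless. -/
theorem MinPyramid.of_setPyramid {a : V} {b : Fin 3 → V} {X : Fin 3 → Finset V}
    (h : SetPyramid G ℓ a b X) {p : Fin 3 → ℕ → V} {L : Fin 3 → ℕ} (h0 : ∀ i, p i 0 = a)
    (hL : ∀ i, p i (L i) = b i)
    (hp : ∀ i, ∀ s < L i, G.Adj (p i s) (p i (s + 1)) ∧ p i (s + 1) ∈ X i)
    (opt : ∀ a b X, SetPyramid G ℓ a b X →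
      L 0 + L 1 + L 2 ≤ (X 0).card + (X 1).card + (X 2).card) : MinPyramid G ℓ p L := by
  have hwalk : ∀ i, WalkIn G.Adj (· ∈ X i) (L i) a (b i) := fun i => by
    have := WalkIn.of_seq (r := G.Adj) (W := (· ∈ X i)) (p i) 0 (L i) fun j _ hj =>
      hp i j (by omega)
    rwa [h0, Nat.zero_add, hL] at this
  have hba : ∀ i, b i ≠ a := fun i hi => h.apex i (hi ▸ h.mem i)
  have hpos : ∀ i, 1 ≤ L i := fun i => by
    by_contra hc
    have h1 : L i = 0 := by omega
    exact hba i (by rw [← hL, h1, h0])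
  choose q k q0 qk hq hmin using fun i => WalkIn.exists_shortest (h.reach i)
  have hk : ∀ i, 1 ≤ k i := fun i => by
    by_contra hc
    have h1 : k i = 0 := by omega
    exact hba i (by rw [← qk, h1, q0])
  have hS : SetPyramid G ℓ a b (fun i => seg (q i) 1 (k i)) := by
    refine h.subset (fun i x hx => ?_) (fun i => ?_) (fun i => ?_)
    · obtain ⟨j, hj, hj', rfl⟩ := mem_seg.1 hx
      obtain ⟨j, rfl⟩ : ∃ j', j = j' + 1 := ⟨j - 1, by omega⟩
      exact (hq i j (by omega)).2
    · exact mem_seg.2 ⟨k i, hk i, le_rfl, qk i⟩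
    · have := WalkIn.of_seq (r := G.Adj) (W := (· ∈ seg (q i) 1 (k i))) (q i) 0 (k i)
        fun j _ hj => ⟨(hq i j (by omega)).1, mem_seg.2 ⟨j + 1, by omega, by omega, rfl⟩⟩
      rw [q0, Nat.zero_add, qk] at this
      exact ⟨_, this⟩
  have hle : ∀ i, k i ≤ L i := fun i => hmin i _ (hwalk i)
  have hcard : ∀ i, (seg (q i) 1 (k i)).card ≤ k i := fun i => card_seg_le.trans (by omega)
  have heq : ∀ i, k i = L i := by
    have h1 := opt _ _ _ hS
    have h2 := hcard 0
    have h3 := hcard 1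
    have h4 := hcard 2
    have h5 := hle 0
    have h6 := hle 1
    have h7 := hle 2
    intro i
    fin_cases i <;> simp at * <;> omega
  have hshort : ∀ i s t, s < t → t ≤ L i → p i s ≠ p i t ∧ (G.Adj (p i s) (p i t) → t = s + 1) :=
    fun i s t hst ht => WalkIn.shortest (hp i)
      (fun j hj => by rw [← heq]; rw [h0, hL] at hj; exact hmin i j hj) hst ht
  have hinj : ∀ i s t, s ≤ L i → t ≤ L i → p i s = p i t → s = t := fun i s t hs ht hst => by
    rcases lt_trichotomy s t with h' | h' | h'
    · exact absurd hst (hshort i s t h' ht).1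
    · exact h'
    · exact absurd hst.symm (hshort i t s h' hs).1
  have hX : ∀ i s, 1 ≤ s → s ≤ L i → p i s ∈ X i := fun i s hs hs' => by
    obtain ⟨s, rfl⟩ : ∃ s', s = s' + 1 := ⟨s - 1, by omega⟩
    exact (hp i s (by omega)).2
  refine ⟨fun i j => by rw [h0, h0], hpos, fun i s hs => (hp i s hs).1, hinj,
    fun i s t hs ht hst => ?_, fun i j hij s t hs hs' ht ht' => ?_, ?_, opt⟩
  · rcases lt_trichotomy s t with h' | h' | h'
    · exact Or.inl ((hshort i s t h' ht).2 hst)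
    · exact absurd hst (h' ▸ G.irrefl)
    · exact Or.inr ((hshort i t s h' hs).2 hst.symm)
  · obtain ⟨h1, h2⟩ := h.sep i j hij _ (hX i s hs hs') _ (hX j t ht ht')
    refine ⟨h1, h2.trans (and_congr ?_ ?_)⟩
    · rw [← hL]
      exact ⟨hinj i _ _ hs' le_rfl, fun h => by rw [h]⟩
    · rw [← hL]
      exact ⟨hinj j _ _ ht' le_rfl, fun h => by rw [h]⟩
  · obtain ⟨i, j, hij, hi, hj⟩ := h.far
    exact ⟨i, j, hij, hi.le_length (hwalk i), hj.le_length (hwalk j)⟩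

/-- Take a set pyramid of least total size and shortest walks in its sets. Being injective, these
are no longer than the sets are large, so optimality carries over to their lengths. -/
theorem SetPyramid.exists_minPyramid {a : V} {b : Fin 3 → V} {X : Fin 3 → Finset V}
    (h : SetPyramid G ℓ a b X) : ∃ p L, MinPyramid G ℓ p L := by
  classical
  have hex : ∃ m a b X, SetPyramid G ℓ a b X ∧ m = (X 0).card + (X 1).card + (X 2).card :=
    ⟨_, a, b, X, h, rfl⟩
  obtain ⟨a', b', X', h', hm⟩ := Nat.find_spec hex
  choose q k q0 qk hq hmin using fun i => WalkIn.exists_shortest (h'.reach i)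
  refine ⟨q, k, MinPyramid.of_setPyramid h' q0 qk hq fun a b X hX => ?_⟩
  have h1 := Nat.find_min' hex ⟨a, b, X, hX, rfl⟩
  have h2 : ∀ i, k i ≤ (X' i).card := fun i => by
    have hsub : seg (q i) 1 (k i) ⊆ X' i := fun x hx => by
      obtain ⟨j, hj, hj', rfl⟩ := mem_seg.1 hx
      obtain ⟨j, rfl⟩ : ∃ j', j = j' + 1 := ⟨j - 1, by omega⟩
      exact (hq i j (by omega)).2
    refine le_trans ?_ (Finset.card_le_card hsub)
    rw [seg, Finset.card_image_of_injOn]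
    · simp
    · intro s hs t ht hst
      simp only [Finset.coe_Icc, Set.mem_Icc] at hs ht
      have hs1 : ∀ s t, s < t → t ≤ k i → q i s ≠ q i t := fun s t hst ht =>
        (WalkIn.shortest (hq i) (fun j hj => by rw [q0, qk] at hj; exact hmin i j hj) hst ht).1
      rcases lt_trichotomy s t with h' | h' | h'
      · exact absurd hst (hs1 s t h' ht.2)
      · exact h'
      · exact absurd hst.symm (hs1 t s h' hs.2)
  have h3 := h2 0
  have h4 := h2 1
  have h5 := h2 2
  omega

theorem sum_three {i j k : Fin 3} (hij : i ≠ j) (hik : i ≠ k) (hjk : j ≠ k) (f : Fin 3 → ℕ) :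
    f 0 + f 1 + f 2 = f i + f j + f k := by
  fin_cases i <;> fin_cases j <;> fin_cases k <;> simp at * <;> omega

/-- A minimum pyramid has no two consecutive vertices of a path as a triangle with a vertex to
which there is a shorter third path. -/
theorem MinPyramid.not_triangle {p : Fin 3 → ℕ → V} {L : Fin 3 → ℕ} (hc : MinPyramid G ℓ p L)
    {i j k : Fin 3} (hij : i ≠ j) (hik : i ≠ k) (hjk : j ≠ k) {X : Finset V} {z : V} {s : ℕ}
    (hs0 : 1 ≤ s) (hs : ℓ ≤ s) (hsL : s + 1 + ℓ ≤ L j) (hz : z ∈ X) (haX : p i 0 ∉ X)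
    (hr : ∃ k, WalkIn G.Adj (· ∈ X) k (p i 0) z)
    (hXj : ∀ x ∈ X, ∀ t, 1 ≤ t → t ≤ L j →
      x ≠ p j t ∧ (G.Adj x (p j t) → x = z ∧ (t = s ∨ t = s + 1)))
    (hXk : ∀ x ∈ X, ∀ t, 1 ≤ t → t ≤ L k → x ≠ p k t ∧ ¬ G.Adj x (p k t))
    (hzs : G.Adj z (p j s)) (hzs' : G.Adj z (p j (s + 1))) (hX : X.card < L i) : False := by
  classical
  have hk := hc.pos k
  have aj : p i 0 = p j 0 := hc.apex i j
  have ak : p i 0 = p k 0 := hc.apex i k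
  have inj := fun s t hs ht => (⟨hc.inj j s t hs ht, fun h => by rw [h]⟩ : p j s = p j t ↔ s = t)
  -- The apex stays and the triangle becomes the base. One leg is in `X`, one is leg `j` up to `s`,
  -- and the third runs along leg `k` to the old base and back on leg `j` down to `s + 1`.
  have key : SetPyramid G ℓ (p i 0) ![z, p j s, p j (s + 1)]
      ![X, seg (p j) 1 s, seg (p k) 1 (L k) ∪ seg (p j) (s + 1) (L j)] := by
    refine SetPyramid.of_three haX ?_ ?_ hz ?_ ?_ hr ?_ ?_ ?_ ?_ ?_ ?_ ?_
    · intro h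
      obtain ⟨t, h1, h2, h3⟩ := mem_seg.1 h
      rw [aj, inj t 0 (by omega) (by omega)] at h3
      omega
    · intro h
      rcases Finset.mem_union.1 h with h | h
      · obtain ⟨t, h1, h2, h3⟩ := mem_seg.1 h
        rw [ak] at h3
        have := hc.inj k t 0 h2 (by omega) h3
        omega
      · obtain ⟨t, h1, h2, h3⟩ := mem_seg.1 h
        rw [aj, inj t 0 (by omega) (by omega)] at h3
        omega
    · exact mem_seg.2 ⟨s, hs0, le_rfl, rfl⟩
    · exact Finset.mem_union_right _ (mem_seg.2 ⟨s + 1, le_rfl, by omega, rfl⟩)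
    · refine ⟨s, ?_⟩
      have := WalkIn.of_seq (r := G.Adj) (W := (· ∈ seg (p j) 1 s)) (p j) 0 s fun t _ ht =>
        ⟨hc.adj j t (by omega), mem_seg.2 ⟨t + 1, by omega, by omega, rfl⟩⟩
      rwa [Nat.zero_add, ← aj] at this
    · set Y := seg (p k) 1 (L k) ∪ seg (p j) (s + 1) (L j) with hY
      have w1 := WalkIn.of_seq (r := G.Adj) (W := (· ∈ Y)) (p k) 0 (L k) fun t _ ht =>
        ⟨hc.adj k t (by omega), Finset.mem_union_left _
          (mem_seg.2 ⟨t + 1, by omega, by omega, rfl⟩)⟩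
      have w2 : WalkIn G.Adj (· ∈ Y) 1 (p k (L k)) (p j (L j)) :=
        WalkIn.single ((hc.sep k j hjk.symm _ _ hk le_rfl (hc.pos j) le_rfl).2.2 ⟨rfl, rfl⟩)
          (Finset.mem_union_right _ (mem_seg.2 ⟨L j, by omega, le_rfl, rfl⟩))
      have w3 := WalkIn.of_seq (r := G.Adj) (W := (· ∈ Y)) (p j) (s + 1) (L j - (s + 1))
        fun t ht ht' => ⟨hc.adj j t (by omega), Finset.mem_union_right _
          (mem_seg.2 ⟨t + 1, by omega, by omega, rfl⟩)⟩
      rw [Nat.add_sub_cancel' (by omega)] at w3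
      rw [Nat.zero_add, ← ak] at w1
      exact ⟨_, (w1.trans w2).trans (w3.reverse (fun _ _ h => h.symm)
        (Finset.mem_union_right _ (mem_seg.2 ⟨s + 1, le_rfl, by omega, rfl⟩)))⟩
    · intro x hx y hy
      obtain ⟨t, h1, h2, rfl⟩ := mem_seg.1 hy
      obtain ⟨h3, h4⟩ := hXj x hx t h1 (by omega)
      refine ⟨h3, fun h => ⟨(h4 h).1, ?_⟩, ?_⟩
      · rcases (h4 h).2 with rfl | rfl
        · rfl
        · omega
      · rintro ⟨rfl, h⟩
        rw [h]; exact hzs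
    · intro x hx y hy
      rcases Finset.mem_union.1 hy with hy | hy
      · obtain ⟨t, h1, h2, rfl⟩ := mem_seg.1 hy
        obtain ⟨h3, h4⟩ := hXk x hx t h1 (by omega)
        refine ⟨h3, fun h => absurd h h4, ?_⟩
        rintro ⟨rfl, h⟩
        exact absurd h.symm (hc.sep j k hjk (s + 1) t (by omega) (by omega) h1 h2).1
      · obtain ⟨t, h1, h2, rfl⟩ := mem_seg.1 hy
        obtain ⟨h3, h4⟩ := hXj x hx t (by omega) (by omega)
        refine ⟨h3, fun h => ⟨(h4 h).1, ?_⟩, ?_⟩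
        · rcases (h4 h).2 with rfl | rfl
          · omega
          · rfl
        · rintro ⟨rfl, h⟩
          rw [h]; exact hzs'
    · intro x hx y hy
      obtain ⟨t, h1, h2, rfl⟩ := mem_seg.1 hx
      rcases Finset.mem_union.1 hy with hy | hy
      · obtain ⟨t', h3, h4, rfl⟩ := mem_seg.1 hy
        obtain ⟨h5, h6⟩ := hc.sep j k hjk t t' h1 (by omega) h3 h4
        refine ⟨h5, fun h => absurd (h6.1 h).1 (by omega), ?_⟩
        rintro ⟨-, h⟩
        exact absurd h.symm (hc.sep j k hjk (s + 1) t' (by omega) (by omega) h3 h4).1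
      · obtain ⟨t', h3, h4, rfl⟩ := mem_seg.1 hy
        rw [inj t s (by omega) (by omega), inj t' (s + 1) (by omega) (by omega), Ne,
          inj t t' (by omega) (by omega)]
        refine ⟨by omega, fun h => ?_, ?_⟩
        · have := hc.ind j t t' (by omega) (by omega) h
          omega
        · rintro ⟨rfl, rfl⟩
          exact hc.adj j t (by omega)
    · rw [aj]
      refine SimpleGraph.Far.of_initial (fun t ht => ?_) fun v hv t ht hadj => ?_
      · rw [Ne, inj s t (by omega) (by omega)]; omega
      · obtain ⟨t', h3, h4, rfl⟩ := mem_seg.1 hv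
        have := hc.ind j t t' (by omega) (by omega) hadj
        exact ⟨t', by omega, rfl⟩
    -- Leg `k` may be short, so the potential is measured at the far end: it is `L j + 1 - u` at `p
    -- j u` and `0` off leg `j` and at the apex. The third path enters leg `j` only through the base
    -- edge, at value `1`, and has value `L j - s` at its end.
    · refine ⟨fun v => sInf ({t | v = p j (L j + 1 - t) ∧ 1 ≤ t ∧ t ≤ L j} ∪
        {t | t = 0 ∧ ∀ u, 1 ≤ u → u ≤ L j → v ≠ p j u}), ?_, ?_, ?_⟩
      · refine Nat.le_zero.1 (Nat.sInf_le (Or.inr ⟨rfl, fun u hu hu' h => ?_⟩))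
        rw [aj, inj 0 u (by omega) (by omega)] at h
        omega
      · refine le_csInf ⟨L j - s, Or.inl ⟨?_, by omega, by omega⟩⟩ ?_
        · rw [inj _ _ (by omega) (by omega)]; omega
        · rintro t (⟨h1, h2, h3⟩ | ⟨-, h⟩)
          · rw [inj _ _ (by omega) (by omega)] at h1
            omega
          · exact absurd rfl (h (s + 1) (by omega) (by omega))
      · intro x y hx hy hxy
        dsimp only
        by_cases hyj : ∃ u, 1 ≤ u ∧ u ≤ L j ∧ y = p j u
        · obtain ⟨u, hu, hu', rfl⟩ := hyj
          have hsu : s + 1 ≤ u := by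
            rcases hy with h | h
            · rw [aj, inj u 0 (by omega) (by omega)] at h; omega
            · rcases Finset.mem_union.1 h with h | h
              · obtain ⟨t', h3, h4, h5⟩ := mem_seg.1 h
                exact absurd h5.symm (hc.sep j k hjk u t' hu hu' h3 h4).1
              · obtain ⟨t', h3, h4, h5⟩ := mem_seg.1 h
                rw [inj _ _ (by omega) (by omega)] at h5
                omega
          have h1 : sInf ({t | p j u = p j (L j + 1 - t) ∧ 1 ≤ t ∧ t ≤ L j} ∪
              {t | t = 0 ∧ ∀ u', 1 ≤ u' → u' ≤ L j → p j u ≠ p j u'}) ≤ L j + 1 - u :=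
            Nat.sInf_le (Or.inl ⟨by rw [inj _ _ (by omega) (by omega)]; omega, by omega, by omega⟩)
          refine h1.trans ?_
          have hx' : p i 0 = x ∨ (∃ t, 1 ≤ t ∧ t ≤ L k ∧ p k t = x) ∨
              ∃ t, s + 1 ≤ t ∧ t ≤ L j ∧ p j t = x := by
            rcases hx with h | h
            · exact Or.inl h.symm
            · rcases Finset.mem_union.1 h with h | h
              · exact Or.inr (Or.inl (mem_seg.1 h))
              · exact Or.inr (Or.inr (mem_seg.1 h))
          rcases hx' with rfl | ⟨t, h3, h4, rfl⟩ | ⟨t, h3, h4, rfl⟩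
          · rw [aj] at hxy
            have := hc.ind j 0 u (by omega) (by omega) hxy
            omega
          · have := (hc.sep k j hjk.symm t u h3 h4 hu hu').2.1 hxy
            omega
          · have h5 := hc.ind j t u (by omega) (by omega) hxy
            have h6 : L j + 1 - t ≤ sInf ({t' | p j t = p j (L j + 1 - t') ∧ 1 ≤ t' ∧ t' ≤ L j} ∪
                {t' | t' = 0 ∧ ∀ u', 1 ≤ u' → u' ≤ L j → p j t ≠ p j u'}) := by
              refine le_csInf ⟨L j + 1 - t, Or.inl ⟨?_, by omega, by omega⟩⟩ ?_
              · rw [inj _ _ (by omega) (by omega)]; omega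
              · rintro t' (⟨h1, h2, h3⟩ | ⟨-, h⟩)
                · rw [inj _ _ (by omega) (by omega)] at h1
                  omega
                · exact absurd rfl (h t (by omega) (by omega))
            omega
        · have : sInf ({t | y = p j (L j + 1 - t) ∧ 1 ≤ t ∧ t ≤ L j} ∪
              {t | t = 0 ∧ ∀ u, 1 ≤ u → u ≤ L j → y ≠ p j u}) ≤ 0 :=
            Nat.sInf_le (Or.inr ⟨rfl, fun u hu hu' h => hyj ⟨u, hu, hu', h⟩⟩)
          omega
  -- The last two sets together have at most `L j + L k` vertices and `X` has fewer than `L i`,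
  -- against optimality.
  have h1 := hc.opt _ _ _ key
  rw [sum_three hij hik hjk L] at h1
  have h2 : (seg (p j) 1 s).card ≤ s + 1 - 1 := card_seg_le
  have h3 : (seg (p k) 1 (L k)).card ≤ L k + 1 - 1 := card_seg_le
  have h4 : (seg (p j) (s + 1) (L j)).card ≤ L j + 1 - (s + 1) := card_seg_le
  have h5 := Finset.card_union_le (seg (p k) 1 (L k)) (seg (p j) (s + 1) (L j))
  simp only [Matrix.cons_val_zero, Matrix.cons_val_one, Matrix.cons_val] at h1
  omega

end SetPyramid

/-! ### Short walks leaving the interior of a leg of a minimum pyramid -/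

section Detour

variable {V : Type*} {G : SimpleGraph V} {ℓ : ℕ} {p : Fin 3 → ℕ → V} {L : Fin 3 → ℕ}

/-- The path from the end of leg `j` through the apex to the end of leg `k`. -/
def rim (p : Fin 3 → ℕ → V) (L : Fin 3 → ℕ) (j k : Fin 3) (τ : ℕ) : V :=
  if τ ≤ L j then p j (L j - τ) else p k (τ - L j)

theorem rim_left {j k : Fin 3} {τ : ℕ} (h : τ ≤ L j) : rim p L j k τ = p j (L j - τ) := if_pos h

theorem MinPyramid.rim_right (hc : MinPyramid G ℓ p L) {j k : Fin 3} {τ : ℕ} (h : L j ≤ τ) :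
    rim p L j k τ = p k (τ - L j) := by
  unfold rim
  split_ifs with h'
  · have : τ = L j := by omega
    subst this
    simpa using hc.apex j k
  · rfl

theorem MinPyramid.rim_ne (hc : MinPyramid G ℓ p L) {j k : Fin 3} (hjk : j ≠ k) {σ τ : ℕ}
    (hστ : σ < τ) (hτ : τ ≤ L j + L k) : rim p L j k σ ≠ rim p L j k τ := by
  intro h
  rcases le_or_gt τ (L j) with h1 | h1
  · rw [rim_left h1, rim_left (by omega)] at h
    have := hc.inj j _ _ (by omega) (by omega) h
    omega
  · rw [hc.rim_right h1.le] at h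
    rcases le_or_gt (L j) σ with h2 | h2
    · rw [hc.rim_right h2] at h
      have := hc.inj k _ _ (by omega) (by omega) h
      omega
    · rw [rim_left h2.le] at h
      exact (hc.sep j k hjk _ _ (by omega) (by omega) (by omega) (by omega)).1 h

/-- The exceptional pair is the base edge, which closes the rim to an induced cycle. -/
theorem MinPyramid.rim_adj (hc : MinPyramid G ℓ p L) {j k : Fin 3} (hjk : j ≠ k) {σ τ : ℕ}
    (hστ : σ < τ) (hτ : τ ≤ L j + L k) :
    G.Adj (rim p L j k σ) (rim p L j k τ) ↔ τ = σ + 1 ∨ (σ = 0 ∧ τ = L j + L k) := by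
  have hk := hc.pos k
  have hj := hc.pos j
  rcases le_or_gt τ (L j) with h1 | h1
  · rw [rim_left h1, rim_left (by omega)]
    constructor
    · intro h
      have := hc.ind j _ _ (by omega) (by omega) h
      omega
    · rintro (rfl | h)
      · have := hc.adj j (L j - (σ + 1)) (by omega)
        rw [show L j - (σ + 1) + 1 = L j - σ by omega] at this
        exact this.symm
      · omega
  · rw [hc.rim_right h1.le]
    rcases le_or_gt (L j) σ with h2 | h2
    · rw [hc.rim_right h2]
      constructor
      · intro h
        have := hc.ind k _ _ (by omega) (by omega) h
        omega
      · rintro (rfl | h)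
        · have := hc.adj k (σ - L j) (by omega)
          rwa [show σ - L j + 1 = σ + 1 - L j by omega] at this
        · omega
    · rw [rim_left h2.le, (hc.sep j k hjk _ _ (by omega) (by omega) (by omega) (by omega)).2]
      omega

/-- In a minimum pyramid there is no third path that is shorter than leg `i` and whose end has
two neighbours on the rim (or is itself a vertex of the rim) such that the remainder of the rim
consists of two nonadjacent paths. -/
theorem MinPyramid.not_shorter (hc : MinPyramid G ℓ p L) {i j k : Fin 3} (hij : i ≠ j)
    (hik : i ≠ k) (hjk : j ≠ k) {z : V} {s t : ℕ} {X : Finset V} (hst : s + 2 ≤ t)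
    (ht : t ≤ L j + L k) (hs : ℓ ≤ s + 1) (ht' : ℓ + t ≤ L j + L k + 1) (hzX : z ∉ X)
    (hz : ∀ τ ≤ L j + L k, z = rim p L j k τ → s < τ ∧ τ < t)
    (hadj : ∀ τ ≤ L j + L k, τ ≤ s ∨ t ≤ τ → (G.Adj z (rim p L j k τ) ↔ τ = s ∨ τ = t))
    (hr : ∃ k, WalkIn G.Adj (· ∈ X) k z (p i (L i))) (hm : p i (L i) ∈ X)
    (hX : ∀ x ∈ X, ∀ τ ≤ L j + L k, τ ≤ s ∨ t ≤ τ → x ≠ rim p L j k τ ∧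
      (G.Adj x (rim p L j k τ) ↔ x = p i (L i) ∧ (τ = 0 ∨ τ = L j + L k)))
    (hcard : X.card < L i) : False := by
  set c := rim p L j k with hcdef
  set M := L j + L k with hM
  have inj : ∀ {σ τ}, σ ≤ M → τ ≤ M → (c σ = c τ ↔ σ = τ) := fun {σ τ} hσ hτ => by
    refine ⟨fun h => ?_, fun h => by rw [h]⟩
    rcases lt_trichotomy σ τ with h' | h' | h'
    · exact absurd h (hc.rim_ne hjk h' hτ)
    · exact h'
    · exact absurd h.symm (hc.rim_ne hjk h' hσ)
  -- The old base is kept and `z` is the new apex, joined to the base by `X` and by the two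
  -- remaining parts of the rim. These parts have `s + 1` and `M + 1 - t` vertices, at least `ℓ`
  -- each and at most `M` in total, because `s + 2 ≤ t`.
  have key : SetPyramid G ℓ z ![p i (L i), c 0, c M] ![X, seg c 0 s, seg c t M] := by
    refine SetPyramid.of_three hzX ?_ ?_ hm (mem_seg.2 ⟨0, by omega, by omega, rfl⟩)
      (mem_seg.2 ⟨M, by omega, by omega, rfl⟩) hr ?_ ?_ ?_ ?_ ?_ ?_ ?_
    · intro h
      obtain ⟨τ, h1, h2, h3⟩ := mem_seg.1 h
      have := hz τ (by omega) h3.symm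
      omega
    · intro h
      obtain ⟨τ, h1, h2, h3⟩ := mem_seg.1 h
      have := hz τ (by omega) h3.symm
      omega
    · have w1 : WalkIn G.Adj (· ∈ seg c 0 s) 1 z (c s) :=
        WalkIn.single ((hadj s (by omega) (Or.inl le_rfl)).2 (Or.inl rfl))
          (mem_seg.2 ⟨s, by omega, le_rfl, rfl⟩)
      have w2 := WalkIn.of_seq (r := G.Adj) (W := (· ∈ seg c 0 s)) c 0 s fun τ _ hτ =>
        ⟨(hc.rim_adj hjk (Nat.lt_succ_self τ) (by omega)).2 (Or.inl rfl),
          mem_seg.2 ⟨τ + 1, by omega, by omega, rfl⟩⟩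
      rw [Nat.zero_add] at w2
      exact ⟨_, w1.trans (w2.reverse (fun _ _ h => h.symm) (mem_seg.2 ⟨0, le_rfl, by omega, rfl⟩))⟩
    · have w1 : WalkIn G.Adj (· ∈ seg c t M) 1 z (c t) :=
        WalkIn.single ((hadj t (by omega) (Or.inr le_rfl)).2 (Or.inr rfl))
          (mem_seg.2 ⟨t, le_rfl, by omega, rfl⟩)
      have w2 := WalkIn.of_seq (r := G.Adj) (W := (· ∈ seg c t M)) c t (M - t) fun τ hτ hτ' =>
        ⟨(hc.rim_adj hjk (Nat.lt_succ_self τ) (by omega)).2 (Or.inl rfl),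
          mem_seg.2 ⟨τ + 1, by omega, by omega, rfl⟩⟩
      rw [Nat.add_sub_cancel' ht] at w2
      exact ⟨_, w1.trans w2⟩
    · intro x hx y hy
      obtain ⟨τ, h1, h2, rfl⟩ := mem_seg.1 hy
      obtain ⟨h3, h4⟩ := hX x hx τ (by omega) (Or.inl h2)
      refine ⟨h3, h4.trans (and_congr_right fun _ => ?_)⟩
      rw [inj (by omega) (by omega)]
      omega
    · intro x hx y hy
      obtain ⟨τ, h1, h2, rfl⟩ := mem_seg.1 hy
      obtain ⟨h3, h4⟩ := hX x hx τ h2 (Or.inr h1)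
      refine ⟨h3, h4.trans (and_congr_right fun _ => ?_)⟩
      rw [inj (by omega) (by omega)]
      omega
    · intro x hx y hy
      obtain ⟨σ, h1, h2, rfl⟩ := mem_seg.1 hx
      obtain ⟨τ, h3, h4, rfl⟩ := mem_seg.1 hy
      refine ⟨hc.rim_ne hjk (by omega) h4, ?_⟩
      rw [hcdef, hc.rim_adj hjk (by omega) h4, ← hcdef, inj (by omega) (by omega),
        inj (by omega) (by omega)]
      omega
    · refine SimpleGraph.Far.of_initial (w := fun n => if n = 0 then z else c (s + 1 - n))
        (fun n hn h => ?_) fun v hv n hn h => ?_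
      · split_ifs at h with h0
        · have := hz 0 (by omega) h.symm
          omega
        · rw [inj (by omega) (by omega)] at h
          omega
      · obtain ⟨τ, h1, h2, rfl⟩ := mem_seg.1 hv
        split_ifs at h with h0
        · refine ⟨1, by omega, ?_⟩
          have := (hadj τ (by omega) (Or.inl h2)).1 h
          simp only [one_ne_zero, if_false]
          rw [inj (by omega) (by omega)]
          omega
        · refine ⟨s + 1 - τ, ?_, ?_⟩
          · rcases lt_trichotomy (s + 1 - n) τ with h3 | h3 | h3
            · omega
            · omega
            · have := (hc.rim_adj hjk h3 (by omega)).1 h.symm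
              omega
          · rw [if_neg (by omega), inj (by omega) (by omega)]
            omega
    · refine SimpleGraph.Far.of_initial (w := fun n => if n = 0 then z else c (t - 1 + n))
        (fun n hn h => ?_) fun v hv n hn h => ?_
      · split_ifs at h with h0
        · have := hz M (by omega) h.symm
          omega
        · rw [inj (by omega) (by omega)] at h
          omega
      · obtain ⟨τ, h1, h2, rfl⟩ := mem_seg.1 hv
        split_ifs at h with h0
        · refine ⟨1, by omega, ?_⟩
          have := (hadj τ (by omega) (Or.inr h1)).1 h
          simp only [one_ne_zero, if_false]
          rw [inj (by omega) (by omega)]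
          omega
        · refine ⟨τ + 1 - t, ?_, ?_⟩
          · rcases lt_trichotomy (t - 1 + n) τ with h3 | h3 | h3
            · have := (hc.rim_adj hjk h3 (by omega)).1 h
              omega
            · omega
            · omega
          · rw [if_neg (by omega), inj (by omega) (by omega)]
            omega
  have h1 := hc.opt _ _ _ key
  rw [sum_three hij hik hjk L] at h1
  have h2 : (seg c 0 s).card ≤ s + 1 - 0 := card_seg_le
  have h3 : (seg c t M).card ≤ M + 1 - t := card_seg_le
  simp only [Matrix.cons_val_zero, Matrix.cons_val_one, Matrix.cons_val] at h1
  omega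

/-- A short walk from an inner vertex of leg `i`, none of whose vertices has a neighbour near the
ends of the other two legs, has no neighbours on the other two legs. -/
theorem MinPyramid.not_adj_walk (hc : MinPyramid G ℓ p L) (hℓ : 2 ≤ ℓ) {i j k : Fin 3}
    (hij : i ≠ j) (hik : i ≠ k) (hjk : j ≠ k) {h K : ℕ} {q : ℕ → V} (hq0 : q 0 = p i h)
    (hq : ∀ r < K, G.Adj (q r) (q (r + 1))) (hK : K + 2 ≤ h) (hK' : K + h < L i)
    (hfar : ∀ r ≤ K, ∀ j', j' ≠ i → ∀ s ≤ L j', G.Adj (q r) (p j' s) → ℓ ≤ s ∧ s + ℓ ≤ L j') :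
    ∀ r ≤ K, ∀ j', j' ≠ i → ∀ s ≤ L j', ¬ G.Adj (q r) (p j' s) := by
  classical
  intro r
  -- By strong induction, `q r` may be taken as the first vertex of the walk with a neighbour on the
  -- other legs.
  induction r using Nat.strong_induction_on with
  | _ r ih =>
  intro hrK j₀ hj₀ s₀ hs₀ hadj₀
  have hr : 1 ≤ r := by
    by_contra hr0
    have hr0 : r = 0 := by omega
    subst hr0
    rw [hq0] at hadj₀
    have h1 := hfar 0 (by omega) j₀ hj₀ s₀ hs₀ (hq0 ▸ hadj₀)
    have h2 := (hc.sep i j₀ hj₀.symm h s₀ (by omega) (by omega) (by omega) hs₀).2.1 hadj₀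
    omega
  -- If `q r'` were on another leg, its predecessor would already have a neighbour there.
  have hne : ∀ r', 1 ≤ r' → r' ≤ r → ∀ j', j' ≠ i → ∀ s ≤ L j', q r' ≠ p j' s := by
    intro r' h1 h2 j' hj' s hs heq
    refine ih (r' - 1) (by omega) (by omega) j' hj' s hs ?_
    rw [← heq]
    have := hq (r' - 1) (by omega)
    rwa [Nat.sub_add_cancel h1] at this
  set c := rim p L j k with hcdef
  set M := L j + L k with hM
  have hcases : ∀ τ ≤ M, ∃ j', j' ≠ i ∧ ∃ s ≤ L j', c τ = p j' s ∧
      ((j' = j ∧ τ ≤ L j ∧ s = L j - τ) ∨ (j' = k ∧ L j ≤ τ ∧ s = τ - L j)) := by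
    intro τ hτ
    rcases le_or_gt τ (L j) with h1 | h1
    · exact ⟨j, hij.symm, L j - τ, by omega, rim_left h1, Or.inl ⟨rfl, h1, rfl⟩⟩
    · exact ⟨k, hik.symm, τ - L j, by omega, hc.rim_right h1.le, Or.inr ⟨rfl, h1.le, rfl⟩⟩
  have hnec : ∀ r', 1 ≤ r' → r' ≤ r → ∀ τ ≤ M, q r' ≠ c τ := by
    intro r' h1 h2 τ hτ
    obtain ⟨j', hj', s, hs, h3, -⟩ := hcases τ hτ
    rw [h3]
    exact hne r' h1 h2 j' hj' s hs
  have hnadj : ∀ r' < r, ∀ τ ≤ M, ¬ G.Adj (q r') (c τ) := by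
    intro r' h2 τ hτ
    obtain ⟨j', hj', s, hs, h3, -⟩ := hcases τ hτ
    rw [h3]
    exact ih r' h2 (by omega) j' hj' s hs
  -- In terms of the rim, the neighbours of `q r` are at distance at least `ℓ` from both ends and
  -- from the apex. This makes the new legs long.
  have hpos : ∀ τ ≤ M, G.Adj (q r) (c τ) → ℓ ≤ τ ∧ τ + ℓ ≤ M ∧
      (τ ≤ L j → τ + ℓ ≤ L j) ∧ (L j ≤ τ → L j + ℓ ≤ τ) := by
    intro τ hτ hadj
    rcases le_or_gt τ (L j) with h1 | h1
    · rw [hcdef, rim_left h1] at hadj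
      have := hfar r hrK j hij.symm _ (by omega) hadj
      omega
    · rw [hcdef, hc.rim_right h1.le] at hadj
      have := hfar r hrK k hik.symm _ (by omega) hadj
      omega
  -- the part of leg `i` from its vertex `h` to the base, against the rim
  have htail : ∀ t, h ≤ t → t ≤ L i → ∀ τ ≤ M, p i t ≠ c τ ∧
      (G.Adj (p i t) (c τ) ↔ p i t = p i (L i) ∧ (τ = 0 ∨ τ = M)) := by
    intro t ht ht' τ hτ
    have e : p i t = p i (L i) ↔ t = L i := ⟨hc.inj i _ _ ht' le_rfl, fun h => by rw [h]⟩
    rw [e]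
    have pj := hc.pos j
    have pk := hc.pos k
    obtain ⟨j', hj', s, hs, h3, h4⟩ := hcases τ hτ
    rw [h3]
    rcases Nat.eq_zero_or_pos s with rfl | hs0
    · rw [hc.apex j' i]
      refine ⟨fun h5 => ?_, fun h5 => ?_, fun h5 => ?_⟩
      · have := hc.inj i _ _ ht' (by omega) h5
        omega
      · have := hc.ind i _ _ ht' (by omega) h5
        omega
      · omega
    · obtain ⟨h5, h6⟩ := hc.sep i j' hj'.symm t s (by omega) ht' hs0 hs
      refine ⟨h5, h6.trans (and_congr_right fun _ => ?_)⟩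
      rcases h4 with ⟨rfl, h7, rfl⟩ | ⟨rfl, h7, rfl⟩ <;> omega
  have hτ₀ : ∃ τ, τ ≤ M ∧ G.Adj (q r) (c τ) := by
    have : j₀ = j ∨ j₀ = k := by omega
    rcases this with rfl | rfl
    · refine ⟨L j₀ - s₀, by omega, ?_⟩
      rw [hcdef, rim_left (by omega), show L j₀ - (L j₀ - s₀) = s₀ by omega]
      exact hadj₀
    · refine ⟨L j + s₀, by omega, ?_⟩
      rw [hcdef, hc.rim_right (by omega), show L j + s₀ - L j = s₀ by omega]
      exact hadj₀
  -- Let `s` and `t` be the first and the last position on the rim of a neighbour of `q r`; the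
  -- cases below are `t = s`, `t = s + 1` and `t ≥ s + 2`.
  obtain ⟨s, hsM, hsadj, hsmin⟩ : ∃ s ≤ M, G.Adj (q r) (c s) ∧
      ∀ τ ≤ M, G.Adj (q r) (c τ) → s ≤ τ :=
    ⟨Nat.find hτ₀, (Nat.find_spec hτ₀).1, (Nat.find_spec hτ₀).2,
      fun τ hτ hadj => Nat.find_min' hτ₀ ⟨hτ, hadj⟩⟩
  obtain ⟨t, htM, htadj, htmax⟩ : ∃ t ≤ M, G.Adj (q r) (c t) ∧
      ∀ τ ≤ M, G.Adj (q r) (c τ) → τ ≤ t :=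
    ⟨_, Nat.findGreatest_le M, Nat.findGreatest_spec (P := fun τ => G.Adj (q r) (c τ)) hsM hsadj,
      fun τ hτ hadj => Nat.le_findGreatest hτ hadj⟩
  have hmin : ∀ τ ≤ M, G.Adj (q r) (c τ) → s ≤ τ ∧ τ ≤ t := fun τ hτ hadj =>
    ⟨hsmin τ hτ hadj, htmax τ hτ hadj⟩
  have hst := (hmin t htM htadj).1
  have ps := hpos s hsM hsadj
  have pt := hpos t htM htadj
  have hwalk : ∀ (X : Finset V), (∀ r' < r, q r' ∈ X) → (∀ t, h ≤ t → t ≤ L i → p i t ∈ X) →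
      WalkIn G.Adj (· ∈ X) (r + (L i - h)) (q r) (p i (L i)) := by
    intro X h1 h2
    have w1' : WalkIn G.Adj (· ∈ X) r (q r) (q 0) := by
      have := WalkIn.of_seq (r := G.Adj) (W := (· ∈ X)) (fun t => q (r - t)) 0 r fun t _ ht =>
        ⟨by
          have := hq (r - (t + 1)) (by omega)
          rw [show r - (t + 1) + 1 = r - t by omega] at this
          exact this.symm, h1 _ (by omega)⟩
      simpa using this
    have w2 := WalkIn.of_seq (r := G.Adj) (W := (· ∈ X)) (p i) h (L i - h) fun t ht ht' =>
      ⟨hc.adj i t (by omega), h2 _ (by omega) (by omega)⟩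
    rw [show h + (L i - h) = L i by omega] at w2
    rw [hq0] at w1'
    exact w1'.trans w2
  have cardq : ∀ r', (seg q 1 r').card ≤ r' := fun r' => card_seg_le.trans (by omega)
  have cardp : (seg (p i) h (L i)).card ≤ L i + 1 - h := card_seg_le
  rcases Nat.lt_or_ge t (s + 2) with hlt | hge
  · rcases Nat.lt_or_ge t (s + 1) with hlt' | hge'
    · -- a single neighbour
      have hst' : t = s := by omega
      have hunique : ∀ τ ≤ M, G.Adj (q r) (c τ) ↔ τ = s := fun τ hτ =>
        ⟨fun h => by have := hmin τ hτ h; omega, fun h => h ▸ hsadj⟩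
      have cinj : ∀ τ ≤ M, c s = c τ → s = τ := fun τ hτ heq => by
        rcases lt_trichotomy s τ with h' | h' | h'
        · exact absurd heq (hc.rim_ne hjk h' hτ)
        · exact h'
        · exact absurd heq.symm (hc.rim_ne hjk h' hsM)
      -- The rim vertex `c s` is the new apex. The third leg goes back along the walk and then down
      -- leg `i` to the base; it is shorter than leg `i` since `K + 2 ≤ h`.
      refine hc.not_shorter hij hik hjk (z := c s) (s := s - 1) (t := s + 1)
        (X := seg q 1 r ∪ seg (p i) h (L i)) (by omega) (by omega) (by omega) (by omega) ?_ ?_ ?_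
        ?_ ?_ ?_ ?_
      · intro hmem
        rcases Finset.mem_union.1 hmem with h1 | h1
        · obtain ⟨r', h2, h3, h4⟩ := mem_seg.1 h1
          exact hnec r' h2 h3 s hsM h4
        · obtain ⟨t', h2, h3, h4⟩ := mem_seg.1 h1
          exact (htail t' h2 h3 s hsM).1 h4
      · intro τ hτ heq
        have := cinj τ hτ heq
        omega
      · intro τ hτ hτ'
        rcases hτ' with h1 | h1
        · rw [G.adj_comm, hc.rim_adj hjk (by omega) hsM]
          omega
        · rw [hcdef, hc.rim_adj hjk (by omega) hτ]
          omega
      · refine ⟨1 + (r + (L i - h)), WalkIn.trans (WalkIn.single hsadj.symm ?_)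
          (hwalk _ (fun r' hr' => ?_) fun t' h1 h2 => ?_)⟩
        · exact Finset.mem_union_left _ (mem_seg.2 ⟨r, hr, le_rfl, rfl⟩)
        · rcases Nat.eq_zero_or_pos r' with rfl | h1
          · rw [hq0]
            exact Finset.mem_union_right _ (mem_seg.2 ⟨h, le_rfl, by omega, rfl⟩)
          · exact Finset.mem_union_left _ (mem_seg.2 ⟨r', h1, by omega, rfl⟩)
        · exact Finset.mem_union_right _ (mem_seg.2 ⟨t', h1, h2, rfl⟩)
      · exact Finset.mem_union_right _ (mem_seg.2 ⟨L i, by omega, le_rfl, rfl⟩)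
      · intro x hx τ hτ hτ'
        rcases Finset.mem_union.1 hx with h1 | h1
        · obtain ⟨r', h2, h3, rfl⟩ := mem_seg.1 h1
          refine ⟨hnec r' h2 h3 τ hτ, fun h4 => ?_, fun h4 => ?_⟩
          · rcases h3.lt_or_eq with h5 | rfl
            · exact absurd h4 (hnadj r' h5 τ hτ)
            · have := (hunique τ hτ).1 h4
              omega
          · exfalso
            have h5 := (htail (L i) (by omega) le_rfl τ hτ).2.2 ⟨rfl, h4.2⟩
            rw [← h4.1] at h5
            rcases h3.lt_or_eq with h6 | rfl
            · exact hnadj r' h6 τ hτ h5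
            · have := (hunique τ hτ).1 h5
              omega
        · obtain ⟨t', h2, h3, rfl⟩ := mem_seg.1 h1
          exact htail t' h2 h3 τ hτ
      · refine (Finset.card_union_le _ _).trans_lt ?_
        have := cardq r
        omega
    · -- two consecutive neighbours
      have hst' : t = s + 1 := by omega
      rw [hst'] at htadj pt hmin
      have hX0 : p i 0 ∉ seg (p i) 1 h ∪ seg q 1 r := by
        intro hmem
        rcases Finset.mem_union.1 hmem with h1 | h1
        · obtain ⟨t', h2, h3, h4⟩ := mem_seg.1 h1
          have := hc.inj i _ _ (by omega) (by omega) h4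
          omega
        · obtain ⟨r', h2, h3, h4⟩ := mem_seg.1 h1
          exact hne r' h2 h3 j hij.symm 0 (by omega) (by rw [h4, hc.apex i j])
      have hwalk' : ∃ k, WalkIn G.Adj (· ∈ seg (p i) 1 h ∪ seg q 1 r) k (p i 0) (q r) := by
        have w1 := WalkIn.of_seq (r := G.Adj) (W := (· ∈ seg (p i) 1 h ∪ seg q 1 r)) (p i) 0 h
          fun t' _ ht' => ⟨hc.adj i t' (by omega),
            Finset.mem_union_left _ (mem_seg.2 ⟨t' + 1, by omega, by omega, rfl⟩)⟩
        have w2 := WalkIn.of_seq (r := G.Adj) (W := (· ∈ seg (p i) 1 h ∪ seg q 1 r)) q 0 r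
          fun t' _ ht' => ⟨hq t' (by omega),
            Finset.mem_union_right _ (mem_seg.2 ⟨t' + 1, by omega, by omega, rfl⟩)⟩
        rw [Nat.zero_add] at w1 w2
        rw [hq0] at w2
        exact ⟨_, w1.trans w2⟩
      have hz : q r ∈ seg (p i) 1 h ∪ seg q 1 r :=
        Finset.mem_union_right _ (mem_seg.2 ⟨r, hr, le_rfl, rfl⟩)
      -- Here the new leg follows leg `i` from the apex to its vertex `h` and then the walk, so the
      -- bound `K + h < L i` is the relevant one.
      have hcard : (seg (p i) 1 h ∪ seg q 1 r).card < L i := by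
        refine (Finset.card_union_le _ _).trans_lt ?_
        have h1 := cardq r
        have h2 : (seg (p i) 1 h).card ≤ h + 1 - 1 := card_seg_le
        omega
      have hXne : ∀ x ∈ seg (p i) 1 h ∪ seg q 1 r, ∀ j', j' ≠ i → ∀ u, 1 ≤ u → u ≤ L j' →
          x ≠ p j' u ∧ (G.Adj x (p j' u) → x = q r) := by
        intro x hx j' hj' u hu hu'
        rcases Finset.mem_union.1 hx with h1 | h1
        · obtain ⟨t', h2, h3, rfl⟩ := mem_seg.1 h1
          obtain ⟨h4, h5⟩ := hc.sep i j' hj'.symm t' u h2 (by omega) hu hu'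
          refine ⟨h4, fun h6 => ?_⟩
          have := h5.1 h6
          omega
        · obtain ⟨r', h2, h3, rfl⟩ := mem_seg.1 h1
          refine ⟨hne r' h2 h3 j' hj' u hu', fun h6 => ?_⟩
          rcases h3.lt_or_eq with h7 | rfl
          · exact absurd h6 (ih r' h7 (by omega) j' hj' u hu')
          · rfl
      have hadjj : ∀ u ≤ L j, G.Adj (q r) (p j u) → L j - u = s ∨ L j - u = s + 1 := by
        intro u hu hadj
        have := hmin (L j - u) (by omega) (by
          rw [hcdef, rim_left (by omega), show L j - (L j - u) = u by omega]; exact hadj)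
        omega
      have hadjk : ∀ u ≤ L k, G.Adj (q r) (p k u) → L j + u = s ∨ L j + u = s + 1 := by
        intro u hu hadj
        have := hmin (L j + u) (by omega) (by
          rw [hcdef, hc.rim_right (by omega), show L j + u - L j = u by omega]; exact hadj)
        omega
      rcases le_or_gt s (L j) with hsj | hsj
      -- Both neighbours are on the same leg, because neither is near the apex.
      · have hs2 : s + 1 ≤ L j := by omega
        rw [hcdef, rim_left (by omega)] at hsadj
        rw [hcdef, rim_left hs2] at htadj
        -- The rim is numbered from the base of leg `j`, so `c (s + 1)` is nearer to the apex than
        -- `c s`.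
        refine hc.not_triangle hij hik hjk (z := q r) (s := L j - (s + 1)) (by omega) (by omega)
          (by omega) hz hX0 hwalk' (fun x hx u hu hu' => ?_) (fun x hx u hu hu' => ?_) htadj ?_
          hcard
        · obtain ⟨h1, h2⟩ := hXne x hx j hij.symm u hu hu'
          refine ⟨h1, fun h3 => ⟨h2 h3, ?_⟩⟩
          rw [h2 h3] at h3
          have := hadjj u hu' h3
          omega
        · obtain ⟨h1, h2⟩ := hXne x hx k hik.symm u hu hu'
          refine ⟨h1, fun h3 => ?_⟩
          have h4 := h2 h3
          rw [h4] at h3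
          have := hadjk u hu' h3
          omega
        · rwa [show L j - (s + 1) + 1 = L j - s by omega]
      · rw [hcdef, hc.rim_right (by omega)] at hsadj
        rw [hcdef, hc.rim_right (by omega)] at htadj
        refine hc.not_triangle hik hij hjk.symm (z := q r) (s := s - L j) (by omega) (by omega)
          (by omega) hz hX0 hwalk' (fun x hx u hu hu' => ?_) (fun x hx u hu hu' => ?_) hsadj ?_
          hcard
        · obtain ⟨h1, h2⟩ := hXne x hx k hik.symm u hu hu'
          refine ⟨h1, fun h3 => ⟨h2 h3, ?_⟩⟩
          rw [h2 h3] at h3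
          have := hadjk u hu' h3
          omega
        · obtain ⟨h1, h2⟩ := hXne x hx j hij.symm u hu hu'
          refine ⟨h1, fun h3 => ?_⟩
          have h4 := h2 h3
          rw [h4] at h3
          have := hadjj u hu' h3
          omega
        · rwa [show s - L j + 1 = s + 1 - L j by omega]
  · -- two neighbours at distance at least two
    have hqrX : q r ∉ seg q 1 (r - 1) ∪ seg (p i) h (L i) := by
      intro hmem
      rcases Finset.mem_union.1 hmem with h1 | h1
      · obtain ⟨r', h2, h3, h4⟩ := mem_seg.1 h1
        exact hnadj r' (by omega) s hsM (h4 ▸ hsadj)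
      · obtain ⟨t', h2, h3, h4⟩ := mem_seg.1 h1
        have := ((htail t' h2 h3 s hsM).2.1 (h4 ▸ hsadj)).2
        omega
    -- Now `q r` itself is the apex; any neighbours strictly between `s` and `t` disappear with that
    -- part of the rim.
    refine hc.not_shorter hij hik hjk (z := q r) (s := s) (t := t)
      (X := seg q 1 (r - 1) ∪ seg (p i) h (L i)) hge htM (by omega) (by omega) hqrX ?_ ?_
      ⟨_, hwalk _ (fun r' hr' => ?_) fun t' h1 h2 => ?_⟩ ?_ ?_ ?_
    · intro τ hτ heq
      exact absurd heq (hnec r hr le_rfl τ hτ)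
    · intro τ hτ hτ'
      constructor
      · intro h1
        have := hmin τ hτ h1
        omega
      · rintro (rfl | rfl)
        · exact hsadj
        · exact htadj
    · rcases Nat.eq_zero_or_pos r' with rfl | h1
      · rw [hq0]
        exact Finset.mem_union_right _ (mem_seg.2 ⟨h, le_rfl, by omega, rfl⟩)
      · exact Finset.mem_union_left _ (mem_seg.2 ⟨r', h1, by omega, rfl⟩)
    · exact Finset.mem_union_right _ (mem_seg.2 ⟨t', h1, h2, rfl⟩)
    · exact Finset.mem_union_right _ (mem_seg.2 ⟨L i, by omega, le_rfl, rfl⟩)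
    · intro x hx τ hτ hτ'
      rcases Finset.mem_union.1 hx with h1 | h1
      · obtain ⟨r', h2, h3, rfl⟩ := mem_seg.1 h1
        have h4 := hnadj r' (by omega) τ hτ
        refine ⟨hnec r' h2 (by omega) τ hτ, fun h5 => absurd h5 h4, fun h5 => ?_⟩
        have h6 := (htail (L i) (by omega) le_rfl τ hτ).2.2 ⟨rfl, h5.2⟩
        rw [← h5.1] at h6
        exact absurd h6 h4
      · obtain ⟨t', h2, h3, rfl⟩ := mem_seg.1 h1
        exact htail t' h2 h3 τ hτ
    · refine (Finset.card_union_le _ _).trans_lt ?_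
      have := cardq (r - 1)
      omega

end Detour

/-! ### Frames, and rerouting a leg across its gaps -/

section Frame

variable {V : Type*} {G : SimpleGraph V} {ℓ : ℕ} {p : Fin 3 → ℕ → V} {L : Fin 3 → ℕ}

/-- The positions on a path of length `m` of the `2 * ℓ + 1` vertices that are guessed: all of
them if there are so few, and otherwise the first `ℓ`, the middle one and the last `ℓ`. -/
def framePos (ℓ m t : ℕ) : ℕ :=
  if m ≤ 2 * ℓ then min t m else if t < ℓ then t else if t = ℓ then m / 2 else m - (2 * ℓ - t)

def frame (ℓ : ℕ) (p : Fin 3 → ℕ → V) (L : Fin 3 → ℕ) (i : Fin 3) (t : ℕ) : V :=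
  p i (framePos ℓ (L i) t)

/-- The vertices through which leg `i` may be completed. -/
def Avoids (r : V → V → Prop) (ℓ : ℕ) (w : Fin 3 → ℕ → V) (i : Fin 3) (v : V) : Prop :=
  ∀ j, ∀ t ≤ 2 * ℓ, v ≠ w j t ∧
    (r v (w j t) → w j t = w i (ℓ - 1) ∨ w j t = w i ℓ ∨ w j t = w i (ℓ + 1))

/-- The ends of a gap are frame vertices and do not satisfy `Avoids`, so they are readmitted by
hand. -/
def Zone (r : V → V → Prop) (ℓ : ℕ) (w : Fin 3 → ℕ → V) (i : Fin 3) (s t v : V) : Prop :=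
  v = s ∨ v = t ∨ Avoids r ℓ w i v

/-- `v` is on a shortest path between `s` and `t`. -/
def Between (n : ℕ) (r : V → V → Prop) (ℓ : ℕ) (w : Fin 3 → ℕ → V) (i : Fin 3) (s t v : V) :
    Prop :=
  level n r (Zone r ℓ w i s t) s v + level n r (Zone r ℓ w i s t) t v =
    level n r (Zone r ℓ w i s t) s t

def InLeg (n : ℕ) (r : V → V → Prop) (ℓ : ℕ) (w : Fin 3 → ℕ → V) (i : Fin 3) (v : V) : Prop :=
  (∃ t ∈ Finset.Icc 1 (2 * ℓ), v = w i t) ∨ Between n r ℓ w i (w i (ℓ - 1)) (w i ℓ) v ∨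
    Between n r ℓ w i (w i ℓ) (w i (ℓ + 1)) v

theorem framePos_le {m t : ℕ} (ht : t ≤ 2 * ℓ) : framePos ℓ m t ≤ m := by
  unfold framePos; split_ifs <;> omega

theorem framePos_pos {m t : ℕ} (hm : 1 ≤ m) (ht : 1 ≤ t) : 1 ≤ framePos ℓ m t := by
  unfold framePos; split_ifs <;> omega

theorem framePos_zero {m : ℕ} (hℓ : 0 < ℓ) : framePos ℓ m 0 = 0 := by
  unfold framePos; split_ifs <;> omega

theorem framePos_last {m : ℕ} (hℓ : 0 < ℓ) : framePos ℓ m (2 * ℓ) = m := by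
  unfold framePos; split_ifs <;> omega

theorem framePos_of_lt {m t : ℕ} (hm : ℓ ≤ m) (ht : t < ℓ) : framePos ℓ m t = t := by
  unfold framePos; split_ifs <;> omega

theorem framePos_mid {m : ℕ} (hm : 2 * ℓ < m) : framePos ℓ m ℓ = m / 2 := by
  unfold framePos; split_ifs <;> omega

theorem framePos_mid_succ {m : ℕ} (hℓ : 0 < ℓ) (hm : 2 * ℓ < m) : framePos ℓ m (ℓ + 1) = m + 1 - ℓ := by
  unfold framePos; split_ifs <;> omega

theorem exists_framePos {m s : ℕ} (hs : s ≤ m) (h : s < ℓ ∨ m < s + ℓ) :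
    ∃ t ≤ 2 * ℓ, framePos ℓ m t = s := by
  by_cases hm : m ≤ 2 * ℓ
  · exact ⟨s, by omega, by unfold framePos; split_ifs; omega⟩
  · by_cases hs : s < ℓ
    · exact ⟨s, by omega, framePos_of_lt (by omega) hs⟩
    · exact ⟨s + 2 * ℓ - m, by omega, by unfold framePos; split_ifs <;> omega⟩

theorem framePos_long {m t : ℕ} (hℓ : 0 < ℓ) (hm : 2 * ℓ < m) :
    framePos ℓ m t < ℓ ∨ framePos ℓ m t = m / 2 ∨ m + 1 - ℓ ≤ framePos ℓ m t := by
  unfold framePos; split_ifs <;> omega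

/-- From position `2` on a vertex is not adjacent to the apex, which belongs to every leg, and
before `L i` it is not in the base. -/
theorem MinPyramid.inner_not_adj (hc : MinPyramid G ℓ p L) {i j : Fin 3} (hij : i ≠ j) {s t : ℕ}
    (hs : 2 ≤ s) (hs' : s < L i) (ht : t ≤ L j) : p i s ≠ p j t ∧ ¬ G.Adj (p i s) (p j t) := by
  rcases Nat.eq_zero_or_pos t with rfl | ht0
  · rw [hc.apex j i]
    refine ⟨fun h => ?_, fun h => ?_⟩
    · have := hc.inj i _ _ (by omega) (by omega) h
      omega
    · have := hc.ind i _ _ (by omega) (by omega) h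
      omega
  · obtain ⟨h1, h2⟩ := hc.sep i j hij s t (by omega) (by omega) ht0 ht
    refine ⟨h1, fun h => ?_⟩
    have := h2.1 h
    omega

/-- The gaps of the leg itself are admissible, which bounds the distance across a gap by the length
of the segment. Frame neighbours of such a vertex can only be the three that end the gaps. -/
theorem MinPyramid.avoids_self (hc : MinPyramid G ℓ p L) (hℓ : 2 ≤ ℓ) {i : Fin 3}
    (hL : 2 * ℓ < L i) {s : ℕ} (hs : ℓ ≤ s) (hs' : s + ℓ ≤ L i) (hmid : s ≠ L i / 2) :
    Avoids G.Adj ℓ (frame ℓ p L) i (p i s) := by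
  intro j t ht
  have hle := framePos_le (m := L j) ht
  by_cases hij : i = j
  · subst hij
    have h1 := framePos_long (t := t) (by omega) hL
    refine ⟨fun h => ?_, fun h => ?_⟩
    · have := hc.inj i _ _ (by omega) hle h
      omega
    · have := hc.ind i _ _ (by omega) hle h
      have h2 : framePos ℓ (L i) t = framePos ℓ (L i) (ℓ - 1) ∨
          framePos ℓ (L i) t = framePos ℓ (L i) ℓ ∨
          framePos ℓ (L i) t = framePos ℓ (L i) (ℓ + 1) := by
        rw [framePos_of_lt (t := ℓ - 1) (by omega) (by omega), framePos_mid hL,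
          framePos_mid_succ (by omega) hL]
        omega
      unfold frame
      rcases h2 with h2 | h2 | h2 <;> simp [h2]
  · obtain ⟨h1, h2⟩ := hc.inner_not_adj hij (s := s) (by omega) (by omega) hle
    exact ⟨h1, fun h => absurd h h2⟩

theorem exists_other_legs : ∀ i : Fin 3, ∃ j k : Fin 3, i ≠ j ∧ i ≠ k ∧ j ≠ k := by decide

/-- In leg `i` of a minimum pyramid, a segment starting or ending in the middle can be replaced
with any path that is not longer, and then it is not shorter either. -/
theorem MinPyramid.reroute (hc : MinPyramid G ℓ p L) (hℓ : 5 ≤ ℓ) {i : Fin 3} (hL : 2 * ℓ < L i)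
    {α β : ℕ} (hαβ : (α = ℓ - 1 ∧ β = L i / 2) ∨ (α = L i / 2 ∧ β = L i + 1 - ℓ)) {d : ℕ}
    {q : ℕ → V} (hd : 1 ≤ d) (hd' : d ≤ β - α) (q0 : q 0 = p i α) (qd : q d = p i β)
    (hq : ∀ r < d, G.Adj (q r) (q (r + 1)))
    (hz : ∀ r, 0 < r → r < d → Avoids G.Adj ℓ (frame ℓ p L) i (q r)) :
    d = β - α ∧ MinPyramid G ℓ
      (Function.update p i fun s => if α < s ∧ s < β then q (s - α) else p i s) L := by
  classical
  obtain ⟨j, k, hij, hik, hjk⟩ := exists_other_legs i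
  have hposi : ∀ t ∈ ({ℓ - 1, ℓ, ℓ + 1} : Finset ℕ), 2 ≤ framePos ℓ (L i) t ∧
      framePos ℓ (L i) t < L i := by
    intro t ht
    simp only [Finset.mem_insert, Finset.mem_singleton] at ht
    rcases ht with rfl | rfl | rfl
    · rw [framePos_of_lt (by omega) (by omega)]; omega
    · rw [framePos_mid hL]; omega
    · rw [framePos_mid_succ (by omega) hL]; omega
  -- The vertices near the ends of the other legs are frame vertices, and none of them is one of the
  -- three exempt ones on leg `i`.
  have havoid : ∀ r, 0 < r → r < d → ∀ j' ≠ i, ∀ s ≤ L j', G.Adj (q r) (p j' s) →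
      ℓ ≤ s ∧ s + ℓ ≤ L j' := by
    intro r hr hr' j' hj' s hs hadj
    by_contra hcon
    obtain ⟨t, ht, rfl⟩ := exists_framePos (ℓ := ℓ) hs (by omega)
    rcases (hz r hr hr' j' t ht).2 hadj with h | h | h
    · exact (hc.inner_not_adj hj'.symm (hposi (ℓ - 1) (by simp)).1 (hposi (ℓ - 1) (by simp)).2
        hs).1 h.symm
    · exact (hc.inner_not_adj hj'.symm (hposi ℓ (by simp)).1 (hposi ℓ (by simp)).2 hs).1 h.symm
    · exact (hc.inner_not_adj hj'.symm (hposi (ℓ + 1) (by simp)).1 (hposi (ℓ + 1) (by simp)).2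
        hs).1 h.symm
  have hfar : ∀ r ≤ d, ∀ j' ≠ i, ∀ s ≤ L j', G.Adj (q r) (p j' s) → ℓ ≤ s ∧ s + ℓ ≤ L j' := by
    intro r hr j' hj' s hs hadj
    rcases Nat.eq_zero_or_pos r with rfl | hr0
    · rw [q0] at hadj
      exact absurd hadj (hc.inner_not_adj hj'.symm (by omega) (by omega) hs).2
    · rcases hr.lt_or_eq with hr' | rfl
      · exact havoid r hr0 hr' j' hj' s hs hadj
      · rw [qd] at hadj
        exact absurd hadj (hc.inner_not_adj hj'.symm (by omega) (by omega) hs).2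
  have hnadj : ∀ r ≤ d, ∀ j' ≠ i, ∀ s ≤ L j', ¬ G.Adj (q r) (p j' s) := by
    -- The walk is always followed from the middle of the leg, so in the first gap it is reversed.
    -- Starting there makes it short compared with both halves of the leg.
    rcases hαβ with h | h
    · have := hc.not_adj_walk (by omega) hij hik hjk (h := β) (K := d) (q := fun r => q (d - r))
        (by simpa using qd) (fun r hr => by
          have := hq (d - (r + 1)) (by omega)
          rw [show d - (r + 1) + 1 = d - r by omega] at this
          exact this.symm) (by omega) (by omega) (fun r hr => hfar (d - r) (by omega))
      intro r hr j' hj' s hs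
      have h1 := this (d - r) (by omega) j' hj' s hs
      rwa [show d - (d - r) = r by omega] at h1
    · exact hc.not_adj_walk (by omega) hij hik hjk q0 hq (by omega) (by omega) hfar
  have hne : ∀ r, 0 < r → r ≤ d → ∀ j' ≠ i, ∀ s ≤ L j', q r ≠ p j' s := by
    intro r hr hr' j' hj' s hs h
    have h1 := hq (r - 1) (by omega)
    rw [Nat.sub_add_cancel hr, h] at h1
    exact hnadj (r - 1) (by omega) j' hj' s hs h1
  set Y : Finset V := seg (p i) 1 α ∪ seg q 1 (d - 1) ∪ seg (p i) β (L i) with hY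
  set X : Fin 3 → Finset V := fun j' => if j' = i then Y else seg (p j') 1 (L j') with hX
  have hXi : X i = Y := if_pos rfl
  have hXj : ∀ j' ≠ i, X j' = seg (p j') 1 (L j') := fun j' hj' => if_neg hj'
  have hYmem : ∀ x ∈ Y, (∃ s, 1 ≤ s ∧ s ≤ L i ∧ x = p i s) ∨ ∃ r, 0 < r ∧ r < d ∧ x = q r := by
    intro x hx
    rw [hY, Finset.mem_union, Finset.mem_union] at hx
    rcases hx with (hx | hx) | hx
    · obtain ⟨s, h1, h2, rfl⟩ := mem_seg.1 hx
      exact Or.inl ⟨s, by omega, by omega, rfl⟩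
    · obtain ⟨s, h1, h2, rfl⟩ := mem_seg.1 hx
      exact Or.inr ⟨s, by omega, by omega, rfl⟩
    · obtain ⟨s, h1, h2, rfl⟩ := mem_seg.1 hx
      exact Or.inl ⟨s, by omega, by omega, rfl⟩
  have hY1 : ∀ s, 1 ≤ s → s ≤ α → p i s ∈ Y := fun s h1 h2 =>
    Finset.mem_union_left _ (Finset.mem_union_left _ (mem_seg.2 ⟨s, h1, h2, rfl⟩))
  have hY2 : ∀ s, β ≤ s → s ≤ L i → p i s ∈ Y := fun s h1 h2 =>
    Finset.mem_union_right _ (mem_seg.2 ⟨s, h1, h2, rfl⟩)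
  have hYq : ∀ r, 0 < r → r ≤ d → q r ∈ Y := by
    intro r h1 h2
    rcases h2.lt_or_eq with h3 | rfl
    · exact Finset.mem_union_left _ (Finset.mem_union_right _
        (mem_seg.2 ⟨r, by omega, by omega, rfl⟩))
    · rw [qd]; exact hY2 β le_rfl (by omega)
  have hsepY : ∀ j' ≠ i, G.OnlyEdge Y (p i (L i)) (seg (p j') 1 (L j')) (p j' (L j')) := by
    intro j' hj' x hx y hy
    obtain ⟨t, h1, h2, rfl⟩ := mem_seg.1 hy
    have ht : p j' t = p j' (L j') ↔ t = L j' :=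
      ⟨hc.inj j' _ _ h2 le_rfl, fun h => by rw [h]⟩
    rcases hYmem x hx with ⟨s, h3, h4, rfl⟩ | ⟨r, h3, h4, rfl⟩
    · obtain ⟨h5, h6⟩ := hc.sep i j' hj'.symm s t h3 h4 h1 h2
      refine ⟨h5, h6.trans ?_⟩
      rw [ht]
      exact and_congr_left fun _ => ⟨fun h => by rw [h], hc.inj i _ _ h4 le_rfl⟩
    · have h5 := hnadj r h4.le j' hj' t h2
      refine ⟨hne r h3 h4.le j' hj' t h2, fun h => absurd h h5, ?_⟩
      rintro ⟨h6, h7⟩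
      have := hc.pos i
      have h8 := (hc.sep i j' hj'.symm (L i) (L j') this le_rfl (by omega) le_rfl).2.2 ⟨rfl, rfl⟩
      rw [← h6, ← h7] at h8
      exact absurd h8 h5
  have hreach : ∀ j', ∃ k, WalkIn G.Adj (· ∈ X j') k (p i 0) (p j' (L j')) := by
    intro j'
    by_cases hj' : j' = i
    · subst hj'
      rw [hXi]
      have w1 := WalkIn.of_seq (r := G.Adj) (W := (· ∈ Y)) (p j') 0 α fun t _ ht =>
        ⟨hc.adj j' t (by omega), hY1 _ (by omega) (by omega)⟩
      have w2 := WalkIn.of_seq (r := G.Adj) (W := (· ∈ Y)) q 0 d fun t _ ht =>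
        ⟨hq t (by omega), hYq _ (by omega) (by omega)⟩
      have w3 := WalkIn.of_seq (r := G.Adj) (W := (· ∈ Y)) (p j') β (L j' - β) fun t ht ht' =>
        ⟨hc.adj j' t (by omega), hY2 _ (by omega) (by omega)⟩
      rw [Nat.zero_add] at w1 w2
      rw [Nat.add_sub_cancel' (by omega)] at w3
      rw [q0, qd] at w2
      exact ⟨_, (w1.trans w2).trans w3⟩
    · rw [hXj j' hj', hc.apex i j']
      have w1 := WalkIn.of_seq (r := G.Adj) (W := (· ∈ seg (p j') 1 (L j'))) (p j') 0 (L j')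
        fun t _ ht => ⟨hc.adj j' t (by omega), mem_seg.2 ⟨t + 1, by omega, by omega, rfl⟩⟩
      rw [Nat.zero_add] at w1
      exact ⟨_, w1⟩
  have hfarX : ∀ j', ℓ ≤ L j' → G.Far ℓ (X j') (p i 0) (p j' (L j')) := by
    intro j' hlong
    rw [hc.apex i j']
    refine SimpleGraph.Far.of_initial (fun s hs h => ?_) fun v hv s hs hadj => ?_
    · have := hc.inj j' _ _ le_rfl (by omega) h
      omega
    · by_cases hj' : j' = i
      · subst hj'
        rw [hXi] at hv
        rcases hYmem v hv with ⟨t, h3, h4, rfl⟩ | ⟨r, h3, h4, rfl⟩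
        · have := hc.ind j' _ _ (by omega) h4 hadj
          exact ⟨t, by omega, rfl⟩
        · exfalso
          have h5 := (hz r h3 h4 j' s (by omega)).2
          unfold frame at h5
          rw [framePos_of_lt hlong (by omega : s < ℓ),
            framePos_of_lt hlong (by omega : ℓ - 1 < ℓ), framePos_mid hL,
            framePos_mid_succ (by omega) hL] at h5
          -- A new vertex may be adjacent to leg `i` at position `ℓ - 1` but not earlier, as all
          -- earlier vertices are in the frame and not exempt. Hence the leg remains long.
          rcases h5 hadj.symm with h6 | h6 | h6
          all_goals
            have := hc.inj j' _ _ (by omega) (by omega) h6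
            omega
      · rw [hXj j' hj'] at hv
        obtain ⟨t, h3, h4, rfl⟩ := mem_seg.1 hv
        have := hc.ind j' _ _ (by omega) h4 hadj
        exact ⟨t, by omega, rfl⟩
  have hS : SetPyramid G ℓ (p i 0) (fun j' => p j' (L j')) X := by
    refine ⟨fun j' hmem => ?_, fun j' => ?_, hreach, fun j₁ j₂ h12 => ?_, ?_⟩
    · by_cases hj' : j' = i
      · subst hj'
        rw [hXi] at hmem
        rcases hYmem _ hmem with ⟨s, h3, h4, h5⟩ | ⟨r, h3, h4, h5⟩
        · have := hc.inj j' _ _ (by omega) h4 h5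
          omega
        · have := (hz r h3 h4 j' 0 (by omega)).1
          unfold frame at this
          rw [framePos_zero (by omega)] at this
          exact this h5.symm
      · rw [hXj j' hj', hc.apex i j'] at hmem
        obtain ⟨t, h3, h4, h5⟩ := mem_seg.1 hmem
        have := hc.inj j' _ _ h4 (by omega) h5
        omega
    · by_cases hj' : j' = i
      · subst hj'
        rw [hXi]
        exact hY2 _ (by omega) le_rfl
      · rw [hXj j' hj']
        exact mem_seg.2 ⟨L j', hc.pos j', le_rfl, rfl⟩
    · by_cases h1 : j₁ = i
      · subst h1
        rw [hXi, hXj j₂ h12.symm]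
        exact hsepY j₂ h12.symm
      · by_cases h2 : j₂ = i
        · subst h2
          rw [hXi, hXj j₁ h1]
          exact (hsepY j₁ h1).symm
        · rw [hXj j₁ h1, hXj j₂ h2]
          intro x hx y hy
          obtain ⟨s, h3, h4, rfl⟩ := mem_seg.1 hx
          obtain ⟨t, h5, h6, rfl⟩ := mem_seg.1 hy
          obtain ⟨h7, h8⟩ := hc.sep j₁ j₂ h12 s t h3 h4 h5 h6
          exact ⟨h7, h8.trans (and_congr ⟨fun h => by rw [h], hc.inj j₁ _ _ h4 le_rfl⟩
            ⟨fun h => by rw [h], hc.inj j₂ _ _ h6 le_rfl⟩)⟩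
    · obtain ⟨j₁, j₂, h12, h1, h2⟩ := hc.far
      exact ⟨j₁, j₂, h12, hfarX j₁ h1, hfarX j₂ h2⟩
  have hlen : d = β - α := by
    have h1 := hc.opt _ _ _ hS
    rw [sum_three hij hik hjk L, sum_three hij hik hjk fun j' => (X j').card, hXi,
      hXj j hij.symm, hXj k hik.symm] at h1
    have h2 : (seg (p j) 1 (L j)).card ≤ L j + 1 - 1 := card_seg_le
    have h3 : (seg (p k) 1 (L k)).card ≤ L k + 1 - 1 := card_seg_le
    have h4 : (seg (p i) 1 α).card ≤ α + 1 - 1 := card_seg_le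
    have h5 : (seg q 1 (d - 1)).card ≤ d - 1 + 1 - 1 := card_seg_le
    have h6 : (seg (p i) β (L i)).card ≤ L i + 1 - β := card_seg_le
    have h7 := Finset.card_union_le (seg (p i) 1 α ∪ seg q 1 (d - 1)) (seg (p i) β (L i))
    have h8 := Finset.card_union_le (seg (p i) 1 α) (seg q 1 (d - 1))
    rw [← hY] at h7
    omega
  -- Chords between the new segment and the rest of leg `i` need not be excluded by hand: the
  -- lengths are unchanged and still optimal, so the new leg is a shortest walk.
  refine ⟨hlen, MinPyramid.of_setPyramid hS (fun j' => ?_) (fun j' => ?_) (fun j' s hs => ?_)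
    hc.opt⟩
  · by_cases hj' : j' = i
    · subst hj'
      rw [Function.update_self, if_neg (by omega)]
    · rw [Function.update_of_ne hj', hc.apex j' i]
  · by_cases hj' : j' = i
    · subst hj'
      rw [Function.update_self, if_neg (by omega)]
    · rw [Function.update_of_ne hj']
  · by_cases hj' : j' = i
    · subst hj'
      have e1 : ∀ s, s ≤ α ∨ β ≤ s → (if α < s ∧ s < β then q (s - α) else p j' s) = p j' s :=
        fun s hs => if_neg (by omega)
      have e2 : ∀ s, α ≤ s → s ≤ β → (if α < s ∧ s < β then q (s - α) else p j' s) =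
          q (s - α) := by
        intro s h1 h2
        split_ifs with h3
        · rfl
        · rcases h1.lt_or_eq with h4 | rfl
          · have : s = β := by omega
            rw [this, ← hlen, qd]
          · simp [q0]
      rw [hXi]
      simp only [Function.update_self]
      rcases Nat.lt_or_ge s α with h1 | h1
      · rw [e1 s (by omega), e1 (s + 1) (by omega)]
        exact ⟨hc.adj j' s hs, hY1 _ (by omega) (by omega)⟩
      · rcases Nat.lt_or_ge s β with h2 | h2
        · rw [e2 s h1 h2.le, e2 (s + 1) (by omega) (by omega),
            show s + 1 - α = s - α + 1 by omega]
          exact ⟨hq _ (by omega), hYq _ (by omega) (by omega)⟩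
        · rw [e1 s (by omega), e1 (s + 1) (by omega)]
          exact ⟨hc.adj j' s hs, hY2 _ (by omega) (by omega)⟩
    · rw [Function.update_of_ne hj', hXj j' hj']
      exact ⟨hc.adj j' s hs, mem_seg.2 ⟨s + 1, by omega, by omega, rfl⟩⟩

variable {n : ℕ}

theorem MinPyramid.level_segment (hc : MinPyramid G ℓ p L) (hℓ : 5 ≤ ℓ) {i : Fin 3}
    (hL : 2 * ℓ < L i) {α β : ℕ}
    (hαβ : (α = ℓ - 1 ∧ β = L i / 2) ∨ (α = L i / 2 ∧ β = L i + 1 - ℓ)) :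
    level n G.Adj (Zone G.Adj ℓ (frame ℓ p L) i (p i α) (p i β)) (p i α) (p i β) ≤ β - α := by
  have := WalkIn.of_seq (r := G.Adj) (W := Zone G.Adj ℓ (frame ℓ p L) i (p i α) (p i β)) (p i) α
    (β - α) fun s h1 h2 => ⟨hc.adj i s (by omega), by
      by_cases h3 : s + 1 = β
      · exact Or.inr (Or.inl (by rw [h3]))
      · exact Or.inr (Or.inr (hc.avoids_self (by omega) hL (by omega) (by omega) (by omega)))⟩
  rw [Nat.add_sub_cancel' (by omega)] at this
  exact level_le_of_walkIn this

/-- Shortest walks from the ends of the gap to `v` join to a shortest walk across the gap, to which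
`MinPyramid.reroute` applies. The frame survives because no frame position is strictly inside a gap.
Since `L i < n`, the levels involved are true distances. -/
theorem MinPyramid.exists_through_segment (hc : MinPyramid G ℓ p L) (hℓ : 5 ≤ ℓ) {i : Fin 3}
    (hn : L i < n) (hL : 2 * ℓ < L i) {α β : ℕ}
    (hαβ : (α = ℓ - 1 ∧ β = L i / 2) ∨ (α = L i / 2 ∧ β = L i + 1 - ℓ)) {v : V}
    (hv : Between n G.Adj ℓ (frame ℓ p L) i (p i α) (p i β) v) :
    ∃ p', MinPyramid G ℓ p' L ∧ frame ℓ p' L = frame ℓ p L ∧ (∀ j ≠ i, p' j = p j) ∧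
      ∃ s, 1 ≤ s ∧ s ≤ L i ∧ v = p' i s := by
  have hlev := hc.level_segment (n := n) hℓ hL hαβ
  unfold Between at hv
  set W := Zone G.Adj ℓ (frame ℓ p L) i (p i α) (p i β) with hW
  set d := level n G.Adj W (p i α) (p i β) with hd
  have w1 := walkIn_level (n := n) (r := G.Adj) (W := W) (s := p i α) (v := v) (by omega)
  have w2' := walkIn_level (n := n) (r := G.Adj) (W := W) (s := p i β) (v := v) (by omega)
  have w2 := w2'.reverse (fun _ _ h => h.symm) (show W (p i β) from Or.inr (Or.inl rfl))
  set d₁ := level n G.Adj W (p i α) v with hd₁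
  set d₂ := level n G.Adj W (p i β) v with hd₂
  obtain ⟨q₁, a0, a1, aq⟩ := w1.exists_seq
  obtain ⟨q₂, b0, b1, bq⟩ := w2.exists_seq
  set q : ℕ → V := fun r => if r ≤ d₁ then q₁ r else q₂ (r - d₁) with hqdef
  have qle : ∀ r, r ≤ d₁ → q r = q₁ r := fun r hr => if_pos hr
  have qge : ∀ r, d₁ ≤ r → q r = q₂ (r - d₁) := by
    intro r hr
    rw [hqdef]
    dsimp only
    split_ifs with h
    · have : r = d₁ := by omega
      rw [this, a1, Nat.sub_self, b0]
    · rfl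
  have q0 : q 0 = p i α := by rw [qle 0 (by omega), a0]
  have qd : q d = p i β := by rw [qge d (by omega), ← b1]; congr 1; omega
  have hq : ∀ r < d, G.Adj (q r) (q (r + 1)) ∧ W (q (r + 1)) := by
    intro r hr
    rcases Nat.lt_or_ge r d₁ with h1 | h1
    · rw [qle r h1.le, qle (r + 1) h1]
      exact aq r h1
    · rw [qge r h1, qge (r + 1) (by omega), show r + 1 - d₁ = r - d₁ + 1 by omega]
      exact bq _ (by omega)
  have hne : p i α ≠ p i β := fun h => by
    have := hc.inj i _ _ (by omega) (by omega) h
    omega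
  have hd1 : 1 ≤ d := by
    by_contra h
    have : d = 0 := by omega
    rw [this] at qd
    exact hne (q0.symm.trans qd)
  have hshort := fun {s t} => WalkIn.shortest (s := s) (t := t) hq fun j hj => by
    rw [q0, qd] at hj
    exact level_le_of_walkIn hj
  obtain ⟨hlen, hc'⟩ := hc.reroute hℓ hL hαβ hd1 hlev q0 qd (fun r hr => (hq r hr).1)
    fun r hr hr' => by
      have h1 := (hq (r - 1) (by omega)).2
      rw [Nat.sub_add_cancel hr] at h1
      -- A shortest walk does not return to its ends, so its inner vertices are in the zone by
      -- virtue of `Avoids`.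
      rcases h1 with h1 | h1 | h1
      · exact absurd (q0.trans h1.symm) (hshort hr hr'.le).1
      · exact absurd (h1.trans qd.symm) (hshort hr' le_rfl).1
      · exact h1
  refine ⟨_, hc', ?_, fun j hj => Function.update_of_ne hj _ _, α + d₁, by omega, by omega, ?_⟩
  · funext j t
    unfold frame
    by_cases hj : j = i
    · subst hj
      rw [Function.update_self, if_neg]
      have := framePos_long (t := t) (by omega) hL
      omega
    · rw [Function.update_of_ne hj]
  · rw [Function.update_self]
    split_ifs with h
    · rw [Nat.add_sub_cancel_left, qle _ le_rfl, a1]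
    · have : d₁ = 0 ∨ d₁ = d := by omega
      rcases this with h1 | h1
      · rw [h1] at a1 ⊢
        rw [← a1, a0, add_zero]
      · have : d₂ = 0 := by omega
        rw [this] at b1
        rw [← b0, b1]
        congr 1
        omega

/-- A short leg is entirely in the frame, with its last vertex repeated. Consecutive frame vertices
are then equal or adjacent, and `Between` adds nothing new. -/
theorem MinPyramid.level_short (hc : MinPyramid G ℓ p L) {i : Fin 3} (hL : L i ≤ 2 * ℓ) (t : ℕ) :
    level n G.Adj (Zone G.Adj ℓ (frame ℓ p L) i (frame ℓ p L i t) (frame ℓ p L i (t + 1)))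
      (frame ℓ p L i t) (frame ℓ p L i (t + 1)) ≤ 1 := by
  by_cases h : t < L i
  · refine level_le_of_walkIn (WalkIn.single ?_ (Or.inr (Or.inl rfl)))
    unfold frame framePos
    rw [if_pos hL, if_pos hL, min_eq_left h.le, min_eq_left (by omega)]
    exact hc.adj i t h
  · have : frame ℓ p L i (t + 1) = frame ℓ p L i t := by
      unfold frame framePos
      rw [if_pos hL, if_pos hL, min_eq_right (by omega), min_eq_right (by omega)]
    rw [this]
    exact (level_le_of_walkIn (k := 0) rfl).trans zero_le_one

theorem MinPyramid.exists_through (hc : MinPyramid G ℓ p L) (hℓ : 5 ≤ ℓ) {i : Fin 3}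
    (hn : L i < n) {v : V} (hv : InLeg n G.Adj ℓ (frame ℓ p L) i v) :
    ∃ p', MinPyramid G ℓ p' L ∧ frame ℓ p' L = frame ℓ p L ∧ (∀ j ≠ i, p' j = p j) ∧
      ∃ s, 1 ≤ s ∧ s ≤ L i ∧ v = p' i s := by
  have hframe : ∀ t, 1 ≤ t → t ≤ 2 * ℓ → v = frame ℓ p L i t →
      ∃ p', MinPyramid G ℓ p' L ∧ frame ℓ p' L = frame ℓ p L ∧ (∀ j ≠ i, p' j = p j) ∧
      ∃ s, 1 ≤ s ∧ s ≤ L i ∧ v = p' i s := fun t h1 h2 h3 =>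
    ⟨p, hc, rfl, fun _ _ => rfl, _, framePos_pos (hc.pos i) h1, framePos_le h2, h3⟩
  rcases hv with ⟨t, ht, hv⟩ | hv
  · rw [Finset.mem_Icc] at ht
    exact hframe t ht.1 ht.2 hv
  rcases Nat.lt_or_ge (2 * ℓ) (L i) with hL | hL
  · have e0 : frame ℓ p L i (ℓ - 1) = p i (ℓ - 1) := by
      unfold frame; rw [framePos_of_lt (by omega) (by omega)]
    have e1 : frame ℓ p L i ℓ = p i (L i / 2) := by unfold frame; rw [framePos_mid hL]
    have e2 : frame ℓ p L i (ℓ + 1) = p i (L i + 1 - ℓ) := by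
      unfold frame; rw [framePos_mid_succ (by omega) hL]
    rw [e0, e1, e2] at hv
    rcases hv with hv | hv
    · exact hc.exists_through_segment hℓ hn hL (Or.inl ⟨rfl, rfl⟩) hv
    · exact hc.exists_through_segment hℓ hn hL (Or.inr ⟨rfl, rfl⟩) hv
  · have key : ∀ t, 1 ≤ t → t + 1 ≤ 2 * ℓ →
        Between n G.Adj ℓ (frame ℓ p L) i (frame ℓ p L i t) (frame ℓ p L i (t + 1)) v →
        v = frame ℓ p L i t ∨ v = frame ℓ p L i (t + 1) := by
      intro t h1 h2 hv
      have h3 := hc.level_short (n := n) hL t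
      unfold Between at hv
      by_cases h4 : level n G.Adj (Zone G.Adj ℓ (frame ℓ p L) i (frame ℓ p L i t)
        (frame ℓ p L i (t + 1))) (frame ℓ p L i t) v = 0
      · exact Or.inl ((level_self (by omega)).1 h4)
      · have h5 : level n G.Adj (Zone G.Adj ℓ (frame ℓ p L) i (frame ℓ p L i t)
            (frame ℓ p L i (t + 1))) (frame ℓ p L i (t + 1)) v = 0 := by omega
        exact Or.inr ((level_self (by omega)).1 h5)
    rcases hv with hv | hv
    · rw [show ℓ = ℓ - 1 + 1 by omega, Nat.add_sub_cancel] at hv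
      rw [show ℓ - 1 + 1 = ℓ by omega] at hv
      have := key (ℓ - 1) (by omega) (by omega)
      rw [show ℓ - 1 + 1 = ℓ by omega] at this
      rcases this hv with h | h
      · exact hframe _ (by omega) (by omega) h
      · exact hframe _ (by omega) (by omega) h
    · rcases key ℓ (by omega) (by omega) hv with h | h
      · exact hframe _ (by omega) (by omega) h
      · exact hframe _ (by omega) (by omega) h

end Frame

/-! ### From pyramids to set pyramids and back, and along embeddings of graphs -/

section Conversion

variable {V : Type*} {G : SimpleGraph V} {ℓ : ℕ}

theorem SimpleGraph.Walk.exists_of_seq {q : ℕ → V} {u : V} (h0 : q 0 = u) :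
    ∀ {k : ℕ} {v : V}, q k = v → (∀ j < k, G.Adj (q j) (q (j + 1))) →
      ∃ P : G.Walk u v, P.length = k ∧ P.support = (List.range (k + 1)).map q ∧
        ∀ j < k, s(q j, q (j + 1)) ∈ P.edges
  | 0, v, hk, _ => by
    obtain rfl : u = v := h0.symm.trans hk
    exact ⟨.nil, rfl, by simp [h0], by omega⟩
  | k + 1, v, hk, hq => by
    obtain ⟨P, h1, h2, h3⟩ :=
      SimpleGraph.Walk.exists_of_seq h0 (rfl : q k = q k) fun j hj => hq j (by omega)
    have hadj : G.Adj (q k) v := hk ▸ hq k (by omega)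
    refine ⟨P.concat hadj, by simp [h1], ?_, fun j hj => ?_⟩
    · rw [support_concat, h2, List.range_succ (n := k + 1), List.map_append]
      simp [hk]
    · rw [edges_concat]
      rcases Nat.lt_succ_iff_lt_or_eq.1 hj with h | rfl
      · simp [h3 j h]
      · simp [hk]

theorem MinPyramid.hasLongPyramid {p : Fin 3 → ℕ → V} {L : Fin 3 → ℕ} (hc : MinPyramid G ℓ p L) :
    HasLongPyramid G ℓ := by
  choose P hlen hsupp hedges using fun i =>
    SimpleGraph.Walk.exists_of_seq (G := G) (hc.apex i 0) (rfl : p i (L i) = p i (L i)) (hc.adj i)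
  have hmem : ∀ i x, x ∈ (P i).support → ∃ s ≤ L i, p i s = x := fun i x hx => by
    rw [hsupp, List.mem_map] at hx
    obtain ⟨s, hs, rfl⟩ := hx
    rw [List.mem_range] at hs
    exact ⟨s, by omega, rfl⟩
  refine ⟨p 0 0, fun i => p i (L i), P, fun i => ?_, fun i => ?_, fun i j hij x hx hy => ?_,
    fun i h => ?_, ?_, fun i j hij => ?_, fun i j hij x hx y hy hx0 hy0 hadj => ?_⟩
  · rw [SimpleGraph.Walk.isPath_def, hsupp]
    refine List.Nodup.map_on (fun s hs t ht hst => ?_) List.nodup_range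
    rw [List.mem_range] at hs ht
    exact hc.inj i s t (by omega) (by omega) hst
  · rw [SimpleGraph.Walk.isChordless_iff_forall_mem_edges]
    intro x y hx hy hadj
    obtain ⟨s, hs, rfl⟩ := hmem i x hx
    obtain ⟨t, ht, rfl⟩ := hmem i y hy
    rcases hc.ind i s t hs ht hadj with rfl | rfl
    · exact hedges i s (by omega)
    · rw [Sym2.eq_swap]
      exact hedges i t (by omega)
  · obtain ⟨s, hs, rfl⟩ := hmem i x hx
    obtain ⟨t, ht, hst⟩ := hmem j _ hy
    rcases Nat.eq_zero_or_pos s with rfl | h1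
    · exact hc.apex i 0
    · rcases Nat.eq_zero_or_pos t with rfl | h2
      · rw [← hst]; exact hc.apex j 0
      · exact absurd hst.symm (hc.sep i j hij s t h1 hs h2 ht).1
  · rw [hc.apex 0 i] at h
    have h1 := hc.inj i _ _ le_rfl (by omega) h
    have := hc.pos i
    omega
  · obtain ⟨i, j, hij, hi, hj⟩ := hc.far
    exact ⟨i, j, hij, by rw [hlen]; exact hi, by rw [hlen]; exact hj⟩
  · exact (hc.sep i j hij _ _ (hc.pos i) le_rfl (hc.pos j) le_rfl).2.2 ⟨rfl, rfl⟩
  · obtain ⟨s, hs, rfl⟩ := hmem i x hx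
    obtain ⟨t, ht, rfl⟩ := hmem j y hy
    have h1 : 1 ≤ s := by
      by_contra h
      have : s = 0 := by omega
      exact hx0 (by rw [this, hc.apex i 0])
    have h2 : 1 ≤ t := by
      by_contra h
      have : t = 0 := by omega
      exact hy0 (by rw [this, hc.apex j 0])
    obtain ⟨rfl, rfl⟩ := (hc.sep i j hij s t h1 hs h2 ht).2.1 hadj
    exact ⟨rfl, rfl⟩

theorem FormsLongPyramid.exists_setPyramid {v₀ : V} {v : Fin 3 → V} {P : ∀ i, G.Walk v₀ (v i)}
    (h : FormsLongPyramid G ℓ v₀ v P) : ∃ X, SetPyramid G ℓ v₀ v X := by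
  classical
  have hmem : ∀ i x, x ∈ (P i).support.toFinset.erase v₀ ↔ x ≠ v₀ ∧ x ∈ (P i).support := by simp
  have hfar : ∀ i, ℓ ≤ (P i).length → G.Far ℓ ((P i).support.toFinset.erase v₀) v₀ (v i) := by
    intro i hi
    have hinj := (h.isPath i).getVert_injOn
    have := SimpleGraph.Far.of_initial (G := G) (ℓ := ℓ) (w := (P i).getVert)
      (X := (P i).support.toFinset.erase v₀) (b := v i) (fun s hs heq => ?_)
      fun x hx s hs hadj => ?_
    · rwa [SimpleGraph.Walk.getVert_zero] at this
    · have := hinj (show (P i).length ≤ (P i).length from le_rfl)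
        (show s ≤ (P i).length by omega) ((P i).getVert_length.trans heq)
      omega
    · obtain ⟨t, rfl, ht⟩ := SimpleGraph.Walk.mem_support_iff_exists_getVert.1 ((hmem i x).1 hx).2
      have hedge := (h.induced i).mem_edges ((P i).getVert_mem_support s)
        ((P i).getVert_mem_support t) hadj
      rw [← SimpleGraph.Walk.mem_edges_toSubgraph, SimpleGraph.Subgraph.mem_edgeSet,
        SimpleGraph.Walk.toSubgraph_adj_iff] at hedge
      obtain ⟨m, hm, hml⟩ := hedge
      rcases Sym2.eq_iff.1 hm with ⟨h1, h2⟩ | ⟨h1, h2⟩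
      · have h3 := hinj (show m ≤ (P i).length by omega) (show s ≤ (P i).length by omega) h1
        have h4 := hinj (show m + 1 ≤ (P i).length by omega) (show t ≤ (P i).length from ht) h2
        exact ⟨t, by omega, rfl⟩
      · have h3 := hinj (show m ≤ (P i).length by omega) (show t ≤ (P i).length from ht) h1
        have h4 := hinj (show m + 1 ≤ (P i).length by omega) (show s ≤ (P i).length by omega) h2
        exact ⟨t, by omega, rfl⟩
  refine ⟨fun i => (P i).support.toFinset.erase v₀, fun i => by simp, fun i => ?_, fun i => ?_,
    fun i j hij x hx y hy => ?_, ?_⟩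
  · exact (hmem i _).2 ⟨h.ne_apex i, (P i).end_mem_support⟩
  · have hinj := (h.isPath i).getVert_injOn
    have := WalkIn.of_seq (r := G.Adj) (W := (· ∈ (P i).support.toFinset.erase v₀))
      (P i).getVert 0 (P i).length fun s _ hs =>
      ⟨(P i).adj_getVert_succ (by omega), (hmem i _).2 ⟨fun h0 => by
        have := hinj (show s + 1 ≤ (P i).length by omega) (show 0 ≤ (P i).length by omega)
          ((congrArg _ (by omega)).trans (h0.trans (P i).getVert_zero.symm))
        omega, (P i).getVert_mem_support _⟩⟩
    rw [Nat.zero_add, SimpleGraph.Walk.getVert_zero, SimpleGraph.Walk.getVert_length] at this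
    exact ⟨_, this⟩
  · obtain ⟨hx0, hx⟩ := (hmem i x).1 hx
    obtain ⟨hy0, hy⟩ := (hmem j y).1 hy
    refine ⟨fun hxy => hx0 (h.disjoint i j hij x hx (hxy ▸ hy)),
      fun hadj => h.only_edge i j hij x hx y hy hx0 hy0 hadj, ?_⟩
    rintro ⟨rfl, rfl⟩
    exact h.base_adj i j hij
  · obtain ⟨i, j, hij, hi, hj⟩ := h.two_long
    exact ⟨i, j, hij, hfar i hi, hfar j hj⟩

theorem hasLongPyramid_iff : HasLongPyramid G ℓ ↔ ∃ a b X, SetPyramid G ℓ a b X := by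
  constructor
  · rintro ⟨v₀, v, P, h⟩
    obtain ⟨X, hX⟩ := h.exists_setPyramid
    exact ⟨v₀, v, X, hX⟩
  · rintro ⟨a, b, X, h⟩
    obtain ⟨p, L, hc⟩ := h.exists_minPyramid
    exact hc.hasLongPyramid

variable {V' : Type*} {f : V ↪ V'}

theorem WalkIn.map_adj {W : V' → Prop} {u : V} : ∀ {k : ℕ} {v : V},
    WalkIn G.Adj (fun x => W (f x)) k u v → WalkIn (G.map f).Adj W k (f u) (f v)
  | 0, _, h => congrArg f h
  | _ + 1, _, ⟨x, h, hx, hv⟩ => ⟨f x, h.map_adj, (SimpleGraph.map_adj_apply).2 hx, hv⟩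

theorem WalkIn.of_map_adj {W : V' → Prop} {u : V} : ∀ {k : ℕ} {v : V'},
    WalkIn (G.map f).Adj W k (f u) v → ∃ x, f x = v ∧ WalkIn G.Adj (fun x => W (f x)) k u x
  | 0, _, h => ⟨u, h, rfl⟩
  | _ + 1, _, ⟨x, h, hx, hv⟩ => by
    obtain ⟨y, rfl, hy⟩ := h.of_map_adj
    obtain ⟨-, y', z, hyz, h1, rfl⟩ := hx
    obtain rfl := f.injective h1
    exact ⟨z, rfl, y', hy, hyz, hv⟩

theorem SetPyramid.map {a : V} {b : Fin 3 → V} {X : Fin 3 → Finset V} (h : SetPyramid G ℓ a b X)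
    (f : V ↪ V') : SetPyramid (G.map f) ℓ (f a) (fun i => f (b i)) (fun i => (X i).map f) where
  apex i hi := h.apex i (by simpa using hi)
  mem i := by simpa using h.mem i
  reach i := by
    obtain ⟨k, hk⟩ := h.reach i
    exact ⟨k, WalkIn.map_adj (by simpa using hk)⟩
  sep i j hij x hx y hy := by
    obtain ⟨x', hx', rfl⟩ := Finset.mem_map.1 hx
    obtain ⟨y', hy', rfl⟩ := Finset.mem_map.1 hy
    simpa using h.sep i j hij x' hx' y' hy'
  far := by
    have H : ∀ i, G.Far ℓ (X i) a (b i) → (G.map f).Far ℓ ((X i).map f) (f a) (f (b i)) := by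
      rintro i ⟨g, g0, gb, hg⟩
      -- The value off the image does not matter, because all edges of the mapped graph are inside
      -- the image.
      refine ⟨Function.extend f g 0, by rw [f.injective.extend_apply, g0],
        by rwa [f.injective.extend_apply], ?_⟩
      rintro _ _ hx hy ⟨-, x, y, hxy, rfl, rfl⟩
      rw [f.injective.extend_apply, f.injective.extend_apply]
      exact hg x y (by simpa using hx) (by simpa using hy) hxy
    obtain ⟨i, j, hij, hi, hj⟩ := h.far
    exact ⟨i, j, hij, H i hi, H j hj⟩

theorem SetPyramid.of_map {a : V'} {b : Fin 3 → V'} {X : Fin 3 → Finset V'}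
    (h : SetPyramid (G.map f) ℓ a b X) : ∃ a b X, SetPyramid G ℓ a b X := by
  classical
  -- The apex has a neighbour, so it is not one of the isolated vertices outside the image.
  obtain ⟨a, rfl⟩ : ∃ x, f x = a := by
    obtain ⟨k, hk⟩ := h.reach 0
    obtain ⟨q, h0, h1, hq⟩ := hk.exists_seq
    have hk0 : 0 < k := by
      by_contra hc
      have : k = 0 := by omega
      subst this
      exact h.apex 0 (by rw [← h0, h1]; exact h.mem 0)
    obtain ⟨-, x, y, -, hx, -⟩ := (hq 0 hk0).1
    exact ⟨x, hx.trans h0⟩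
  choose k hk using h.reach
  choose b' hb hw using fun i => (hk i).of_map_adj
  have hX : ∀ i x, x ∈ (X i).preimage f f.injective.injOn ↔ f x ∈ X i := by simp
  refine ⟨a, b', fun i => (X i).preimage f f.injective.injOn, fun i hi => h.apex i ((hX i a).1 hi),
    fun i => (hX i _).2 (by rw [hb]; exact h.mem i), fun i => ⟨k i, by simpa [hX] using hw i⟩,
    fun i j hij x hx y hy => ?_, ?_⟩
  · have := h.sep i j hij _ ((hX i x).1 hx) _ ((hX j y).1 hy)
    rw [← hb, ← hb] at this
    simpa using this
  · have H : ∀ i, (G.map f).Far ℓ (X i) (f a) (b i) →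
        G.Far ℓ ((X i).preimage f f.injective.injOn) a (b' i) := by
      rintro i ⟨g, g0, gb, hg⟩
      refine ⟨g ∘ f, g0, by simpa [hb] using gb, fun x y hx hy hxy => ?_⟩
      exact hg _ _ (hx.imp (fun h => by rw [h]) (hX i x).1) (hy.imp (fun h => by rw [h]) (hX i y).1)
        (SimpleGraph.map_adj_apply.2 hxy)
    obtain ⟨i, j, hij, hi, hj⟩ := h.far
    exact ⟨i, j, hij, H i hi, H j hj⟩

end Conversion

/-! ### The condition checked on a frame: soundness and completeness -/

section Certificate

variable {G : SimpleGraph ℕ} {ℓ n : ℕ}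

/-- Leg `i` is recognized as long. -/
def LongLeg (n : ℕ) (r : ℕ → ℕ → Prop) (ℓ : ℕ) (w : Fin 3 → ℕ → ℕ) (i : Fin 3) : Prop :=
  (∀ s ∈ Finset.range ℓ, w i (2 * ℓ) ≠ w i s) ∧
    ∀ v < n, InLeg n r ℓ w i v → ∀ s ∈ Finset.range (ℓ - 1), r (w i s) v →
      ∃ t ∈ Finset.range (s + 2), v = w i t

/-- The condition on a frame that the algorithm checks. -/
structure Certificate (n : ℕ) (r : ℕ → ℕ → Prop) (ℓ : ℕ) (w : Fin 3 → ℕ → ℕ) : Prop where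
  step : ∀ i, ∀ t ∈ (Finset.range (2 * ℓ)) \ {ℓ - 1, ℓ},
    w i t = w i (t + 1) ∨ r (w i t) (w i (t + 1))
  linked : ∀ i, ∀ t ∈ ({ℓ - 1, ℓ} : Finset ℕ),
    level n r (Zone r ℓ w i (w i t) (w i (t + 1))) (w i t) (w i (t + 1)) < n
  apex : ∀ i, ∀ v < n, InLeg n r ℓ w i v → v ≠ w i 0
  sep : ∀ i j, i ≠ j → ∀ u < n, ∀ v < n, InLeg n r ℓ w i u → InLeg n r ℓ w j v →
    u ≠ v ∧ (r u v ↔ u = w i (2 * ℓ) ∧ v = w j (2 * ℓ))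
  long : ∃ i j, i ≠ j ∧ LongLeg n r ℓ w i ∧ LongLeg n r ℓ w j

/-- On a shortest walk each vertex splits the length into its distances from the two ends; the
triangle inequality gives the other direction. -/
theorem exists_walkIn_between (hG : ∀ u v, G.Adj u v → u < n) {w : Fin 3 → ℕ → ℕ} {i : Fin 3}
    {s t : ℕ} (h : level n G.Adj (Zone G.Adj ℓ w i s t) s t < n) :
    ∃ k, WalkIn G.Adj (fun v => v < n ∧ Between n G.Adj ℓ w i s t v) k s t := by
  obtain ⟨q, q0, qd, hq⟩ := (walkIn_level h).exists_seq
  unfold Between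
  set W := Zone G.Adj ℓ w i s t with hW
  set d := level n G.Adj W s t with hd
  have hsymm : ∀ x y, G.Adj x y → G.Adj y x := fun _ _ h => h.symm
  have := WalkIn.of_seq (r := G.Adj)
    (W := fun v => v < n ∧ level n G.Adj W s v + level n G.Adj W t v = d) q 0 d fun r _ hr => ?_
  · rw [q0, Nat.zero_add, qd] at this
    exact ⟨_, this⟩
  obtain ⟨hadj, hWr⟩ := hq r (by omega)
  refine ⟨hadj, hG _ _ hadj.symm, ?_⟩
  have w1 := WalkIn.of_seq (r := G.Adj) (W := W) q 0 (r + 1) fun j _ hj => hq j (by omega)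
  have w2 := WalkIn.of_seq (r := G.Adj) (W := W) q (r + 1) (d - (r + 1)) fun j _ hj =>
    hq j (by omega)
  rw [q0, Nat.zero_add] at w1
  rw [Nat.add_sub_cancel' (by omega), qd] at w2
  have l1 := level_le_of_walkIn (n := n) w1
  have l2 := level_le_of_walkIn (n := n) (w2.reverse hsymm hWr)
  have w3 := walkIn_level (n := n) (r := G.Adj) (W := W) (s := s) (v := q (r + 1)) (by omega)
  have w4 := walkIn_level (n := n) (r := G.Adj) (W := W) (s := t) (v := q (r + 1)) (by omega)
  have l3 := level_le_of_walkIn (n := n)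
    (w3.trans (w4.reverse hsymm (show W t from Or.inr (Or.inl rfl))))
  omega

/-- Soundness, for an arbitrary frame: the sets of all vertices recognized by `InLeg` form a set
pyramid. -/
theorem Certificate.setPyramid (hG : ∀ u v, G.Adj u v → u < n) (hℓ : 2 ≤ ℓ) {w : Fin 3 → ℕ → ℕ}
    (hw : ∀ i, ∀ t ≤ 2 * ℓ, w i t < n) (ha : ∀ i j, w i 0 = w j 0) (h : Certificate n G.Adj ℓ w) :
    ∃ a b X, SetPyramid G ℓ a b X := by
  classical
  set X : Fin 3 → Finset ℕ := fun i => (Finset.range n).filter (InLeg n G.Adj ℓ w i) with hX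
  have hmem : ∀ i v, v ∈ X i ↔ v < n ∧ InLeg n G.Adj ℓ w i v := by simp [hX]
  have hwX : ∀ i t, 1 ≤ t → t ≤ 2 * ℓ → w i t ∈ X i := fun i t h1 h2 =>
    (hmem i _).2 ⟨hw i t h2, Or.inl ⟨t, Finset.mem_Icc.2 ⟨h1, h2⟩, rfl⟩⟩
  have hstep : ∀ i t, t < 2 * ℓ → ∃ k, WalkIn G.Adj (· ∈ X i) k (w i t) (w i (t + 1)) := by
    intro i t ht
    by_cases hc : t ∈ ({ℓ - 1, ℓ} : Finset ℕ)
    · obtain ⟨k, hk⟩ := exists_walkIn_between hG (h.linked i t hc)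
      refine ⟨k, hk.mono fun v hv => (hmem i v).2 ⟨hv.1, ?_⟩⟩
      simp only [Finset.mem_insert, Finset.mem_singleton] at hc
      rcases hc with rfl | rfl
      · rw [show ℓ - 1 + 1 = ℓ by omega] at hv
        exact Or.inr (Or.inl hv.2)
      · exact Or.inr (Or.inr hv.2)
    · rcases h.step i t (by simp only [Finset.mem_sdiff, Finset.mem_range]; exact ⟨ht, hc⟩)
        with h1 | h1
      · exact ⟨0, h1⟩
      · exact ⟨1, WalkIn.single h1 (hwX i _ (by omega) (by omega))⟩
  have hreach : ∀ i t, t ≤ 2 * ℓ → ∃ k, WalkIn G.Adj (· ∈ X i) k (w i 0) (w i t) := by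
    intro i t
    induction t with
    | zero => exact fun _ => ⟨0, rfl⟩
    | succ t ih =>
      intro ht
      obtain ⟨k, hk⟩ := ih (by omega)
      obtain ⟨k', hk'⟩ := hstep i t (by omega)
      exact ⟨_, hk.trans hk'⟩
  have hfar : ∀ i, LongLeg n G.Adj ℓ w i → G.Far ℓ (X i) (w 0 0) (w i (2 * ℓ)) := by
    rintro i ⟨h1, h2⟩
    rw [ha 0 i]
    refine SimpleGraph.Far.of_initial (fun s hs => h1 s (by simpa using hs)) fun v hv s hs hadj => ?_
    obtain ⟨t, ht, hvt⟩ := h2 v ((hmem i v).1 hv).1 ((hmem i v).1 hv).2 s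
      (by rw [Finset.mem_range]; omega) hadj
    rw [Finset.mem_range] at ht
    exact ⟨t, by omega, hvt⟩
  refine ⟨w 0 0, fun i => w i (2 * ℓ), X, fun i hi => ?_, fun i => hwX i _ (by omega) le_rfl,
    fun i => ?_, fun i j hij x hx y hy => ?_, ?_⟩
  · exact h.apex i _ ((hmem i _).1 hi).1 ((hmem i _).1 hi).2 (ha 0 i)
  · rw [ha 0 i]
    exact hreach i _ le_rfl
  · exact h.sep i j hij x ((hmem i _).1 hx).1 y ((hmem j _).1 hy).1 ((hmem i _).1 hx).2
      ((hmem j _).1 hy).2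
  · obtain ⟨i, j, hij, hi, hj⟩ := h.long
    exact ⟨i, j, hij, hfar i hi, hfar j hj⟩

theorem MinPyramid.lt_of_adj_lt (hG : ∀ u v, G.Adj u v → u < n) {p : Fin 3 → ℕ → ℕ}
    {L : Fin 3 → ℕ} (hc : MinPyramid G ℓ p L) (i : Fin 3) :
    (∀ s ≤ L i, p i s < n) ∧ L i < n := by
  have h1 : ∀ s ≤ L i, p i s < n := by
    intro s hs
    rcases hs.lt_or_eq with h | rfl
    · exact hG _ _ (hc.adj i s h)
    · have h1 := hc.pos i
      have := hc.adj i (L i - 1) (by omega)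
      rw [Nat.sub_add_cancel h1] at this
      exact hG _ _ this.symm
  refine ⟨h1, ?_⟩
  have h2 := Finset.card_le_card_of_injOn (s := Finset.range (L i + 1)) (t := Finset.range n) (p i)
    (fun s hs => by
      simp only [Finset.coe_range, Set.mem_Iio] at hs ⊢
      exact h1 s (by omega))
    (fun s hs t ht hst => by
      simp only [Finset.coe_range, Set.mem_Iio] at hs ht
      exact hc.inj i s t (by omega) (by omega) hst)
  simp at h2
  omega

/-- Completeness: each condition concerns one or two vertices recognized by `InLeg`, and these lie
on the legs of some minimum pyramid with the same frame, where the condition is evident. -/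
theorem MinPyramid.certificate (hG : ∀ u v, G.Adj u v → u < n) (hℓ : 5 ≤ ℓ)
    {p : Fin 3 → ℕ → ℕ} {L : Fin 3 → ℕ} (hc : MinPyramid G ℓ p L) :
    Certificate n G.Adj ℓ (frame ℓ p L) := by
  have hn := fun i => (hc.lt_of_adj_lt hG i).2
  have f0 : ∀ p i, frame (V := ℕ) ℓ p L i 0 = p i 0 := fun p i => by
    unfold frame; rw [framePos_zero (by omega)]
  have fl : ∀ p i, frame (V := ℕ) ℓ p L i (2 * ℓ) = p i (L i) := fun p i => by
    unfold frame; rw [framePos_last (by omega)]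
  refine ⟨fun i t ht => ?_, fun i t ht => ?_, fun i v _ hv => ?_,
    fun i j hij u _ v _ hu hv => ?_, ?_⟩
  · simp only [Finset.mem_sdiff, Finset.mem_range, Finset.mem_insert, Finset.mem_singleton,
      not_or] at ht
    unfold frame
    have : framePos ℓ (L i) t = framePos ℓ (L i) (t + 1) ∨
        (framePos ℓ (L i) (t + 1) = framePos ℓ (L i) t + 1 ∧ framePos ℓ (L i) t < L i) := by
      unfold framePos; split_ifs <;> omega
    rcases this with h | ⟨h, h'⟩
    · exact Or.inl (by rw [h])
    · rw [h]
      exact Or.inr (hc.adj i _ h')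
  · have hi := hn i
    have hp := hc.pos i
    rcases Nat.lt_or_ge (2 * ℓ) (L i) with hL | hL
    · simp only [Finset.mem_insert, Finset.mem_singleton] at ht
      rcases ht with rfl | rfl
      · rw [show ℓ - 1 + 1 = ℓ by omega]
        unfold frame
        rw [framePos_of_lt (by omega) (by omega : ℓ - 1 < ℓ), framePos_mid hL]
        have := hc.level_segment (n := n) hℓ hL (Or.inl ⟨rfl, rfl⟩)
        unfold frame at this
        omega
      · have := hc.level_segment (n := n) hℓ hL (Or.inr ⟨rfl, rfl⟩)
        unfold frame at this ⊢
        rw [framePos_mid hL, framePos_mid_succ (by omega) hL]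
        omega
    · have := hc.level_short (n := n) hL t
      omega
  · obtain ⟨p', hc', hf, -, s, h1, h2, rfl⟩ := hc.exists_through hℓ (hn i) hv
    rw [← hf, f0]
    intro h
    have := hc'.inj i _ _ h2 (by omega) h
    omega
  · obtain ⟨p', hc', hf, -, s, h1, h2, rfl⟩ := hc.exists_through hℓ (hn i) hu
    rw [← hf] at hv
    -- The second rerouting is done in the pyramid obtained by the first. It leaves leg `i` alone,
    -- so `u` is still on it.
    obtain ⟨p'', hc'', hf', heq, t, h3, h4, rfl⟩ := hc'.exists_through hℓ (hn j) hv
    rw [← heq i hij]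
    obtain ⟨h5, h6⟩ := hc''.sep i j hij s t h1 h2 h3 h4
    refine ⟨h5, h6.trans ?_⟩
    rw [← hf, ← hf', fl, fl]
    exact and_congr ⟨fun h => by rw [h], hc''.inj i _ _ h2 le_rfl⟩
      ⟨fun h => by rw [h], hc''.inj j _ _ h4 le_rfl⟩
  · have H : ∀ i, ℓ ≤ L i → LongLeg n G.Adj ℓ (frame ℓ p L) i := by
      intro i hi
      have hfr : ∀ p, ∀ s < ℓ, frame (V := ℕ) ℓ p L i s = p i s := fun p s hs => by
        unfold frame; rw [framePos_of_lt hi hs]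
      refine ⟨fun s hs h => ?_, fun v _ hv s hs hadj => ?_⟩
      · rw [Finset.mem_range] at hs
        rw [fl, hfr p s hs] at h
        have := hc.inj i _ _ le_rfl (by omega) h
        omega
      · rw [Finset.mem_range] at hs
        obtain ⟨p', hc', hf, -, t, h1, h2, rfl⟩ := hc.exists_through hℓ (hn i) hv
        rw [← hf, hfr p' s (by omega)] at hadj
        have := hc'.ind i s t (by omega) h2 hadj
        refine ⟨t, by rw [Finset.mem_range]; omega, ?_⟩
        rw [← hf, hfr p' t (by omega)]
    obtain ⟨i, j, hij, hi, hj⟩ := hc.far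
    exact ⟨i, j, hij, H i hi, H j hj⟩

/-- The frames with apex in register `1` and the other vertices in the registers
`2, …, 6 * ℓ + 1`. -/
def frameReg (ℓ : ℕ) (i : Fin 3) (t : ℕ) : ℕ := if t = 0 then 1 else 1 + i * (2 * ℓ) + min t (2 * ℓ)

theorem frameReg_mem (hℓ : 0 < ℓ) (i : Fin 3) (t : ℕ) :
    1 ≤ frameReg ℓ i t ∧ frameReg ℓ i t ≤ 6 * ℓ + 1 := by
  have : (i : ℕ) * (2 * ℓ) ≤ 2 * (2 * ℓ) := Nat.mul_le_mul_right _ (by omega)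
  unfold frameReg
  split_ifs <;> omega

theorem exists_setPyramid_iff (hG : ∀ u v, G.Adj u v → u < n) (hℓ : 5 ≤ ℓ) :
    (∃ a b X, SetPyramid G ℓ a b X) ↔ ∃ ρ : ℕ → ℕ, (∀ i, 1 ≤ i → i ≤ 6 * ℓ + 1 → ρ i < n) ∧
      Certificate n G.Adj ℓ (fun i t => ρ (frameReg ℓ i t)) := by
  constructor
  · rintro ⟨a, b, X, h⟩
    obtain ⟨p, L, hc⟩ := h.exists_minPyramid
    have hn := hc.lt_of_adj_lt hG
    -- Division with remainder by `2 * ℓ` recovers the leg and the position from a register number,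
    -- inverting `frameReg`.
    set ρ : ℕ → ℕ := fun r => if r ≤ 1 then p 0 0 else
      frame ℓ p L (Fin.ofNat 3 ((r - 2) / (2 * ℓ))) ((r - 2) % (2 * ℓ) + 1) with hρ
    have heq : (fun i t => ρ (frameReg ℓ i t)) = frame ℓ p L := by
      funext i t
      by_cases ht : t = 0
      · simp only [hρ, frameReg, ht, frame, if_true, le_refl]
        rw [framePos_zero (by omega), hc.apex i 0]
      · have h1 : 1 + i * (2 * ℓ) + min t (2 * ℓ) - 2 = (min t (2 * ℓ) - 1) + 2 * ℓ * i := by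
          rw [mul_comm (2 * ℓ)]; omega
        simp only [hρ, frameReg, if_neg ht]
        rw [if_neg (by omega), h1, Nat.add_mul_div_left _ _ (by omega), Nat.add_mul_mod_self_left,
          Nat.div_eq_of_lt (by omega), Nat.mod_eq_of_lt (by omega), Nat.zero_add,
          Fin.ofNat_val_eq_self]
        unfold frame framePos
        congr 1
        split_ifs <;> omega
    refine ⟨ρ, fun r _ _ => ?_, heq ▸ hc.certificate hG hℓ⟩
    by_cases hr : r ≤ 1
    · simp only [hρ, if_pos hr]
      exact (hn 0).1 0 (Nat.zero_le _)
    · simp only [hρ, if_neg hr, frame]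
      exact (hn _).1 _ (framePos_le (Nat.mod_lt _ (by omega)))
  · rintro ⟨ρ, hρ, h⟩
    refine Certificate.setPyramid hG (by omega) (fun i t _ => ?_) (fun i j => ?_) h
    · obtain ⟨h1, h2⟩ := frameReg_mem (ℓ := ℓ) (by omega) i t
      exact hρ _ h1 h2
    · simp [frameReg]

end Certificate

namespace GraphRAM

/-! ## The algorithm -/

section Program

/-- Arcs of the graph with vertices below `n` and adjacency matrix `A`. -/
def Arc (n : ℕ) (A : ℕ → ℕ → ℕ) (u v : ℕ) : Prop := u < n ∧ A u v = 1

/-- The frame held in the registers. -/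
def regFrame (ℓ : ℕ) (ρ : ℕ → ℕ) (i : Fin 3) (t : ℕ) : ℕ := ρ (frameReg ℓ i t)

theorem regFrame_update {ℓ : ℕ} (hℓ : 0 < ℓ) {x : ℕ} (hx : 6 * ℓ + 1 < x) (ρ : ℕ → ℕ) (v : ℕ) :
    regFrame ℓ (Function.update ρ x v) = regFrame ℓ ρ := by
  funext i t
  have := (frameReg_mem hℓ i t).2
  exact Function.update_of_ne (by omega) _ _

variable {ℓ M : ℕ} {keep : Prop}

theorem CompP.arc {x y : ℕ} (hM : 0 < M) (hx : x < M) (hy : y < M) :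
    CompP M keep 0 (fun A ρ => Arc (ρ 0) A (ρ x) (ρ y)) :=
  ((Comp.var hM hx).ltP (Comp.var hM hM)).and ((Comp.adj hM hx hy).eqP (Comp.const hM 1))

theorem CompP.zone (hℓ : 0 < ℓ) (hM : 6 * ℓ + 1 < M) (i : Fin 3) {s t x : ℕ} (hs : s < M)
    (ht : t < M) (hx : x < M) : CompP M keep 0 (fun A ρ =>
      Zone (Arc (ρ 0) A) ℓ (regFrame ℓ ρ) i (ρ s) (ρ t) (ρ x)) := by
  have hM0 : 0 < M := by omega
  have hr : ∀ i t, frameReg ℓ i t < M := fun i t => (frameReg_mem hℓ i t).2.trans_lt hM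
  have var : ∀ {x}, x < M → Comp M keep 0 (fun _ ρ => ρ x) := fun h => Comp.var hM0 h
  refine ((var hx).eqP (var hs)).or (((var hx).eqP (var ht)).or ?_)
  refine (CompP.forall_finset hM0 Finset.univ (φ := fun j A ρ => ∀ t ∈ Finset.range (2 * ℓ + 1),
    ρ x ≠ regFrame ℓ ρ j t ∧ (Arc (ρ 0) A (ρ x) (regFrame ℓ ρ j t) →
      regFrame ℓ ρ j t = regFrame ℓ ρ i (ℓ - 1) ∨ regFrame ℓ ρ j t = regFrame ℓ ρ i ℓ ∨
        regFrame ℓ ρ j t = regFrame ℓ ρ i (ℓ + 1)))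
    fun j _ => CompP.forall_finset hM0 _ fun t _ => ?_).congr fun A ρ => ?_
  · have reg : ∀ i t, Comp M keep 0 (fun _ ρ => regFrame ℓ ρ i t) := fun i t => var (hr i t)
    exact ((var hx).eqP (reg j t)).not.and ((CompP.arc hM0 hx (hr j t)).imp
      (((reg j t).eqP (reg i _)).or (((reg j t).eqP (reg i _)).or ((reg j t).eqP (reg i _)))))
  · simp [Avoids]

/-- Register `6 * ℓ + 4` is reserved for the vertex visited by the search; `6 * ℓ + 2` and `6 * ℓ +
3` are left for the quantified vertices. -/
theorem Comp.levelZone (hℓ : 0 < ℓ) (hM : 6 * ℓ + 4 < M) (i : Fin 3) {s t u v : ℕ}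
    (hs : s < 6 * ℓ + 4) (ht : t < 6 * ℓ + 4) (hu : u < 6 * ℓ + 4) (hv : v < 6 * ℓ + 4)
    (hu0 : 0 < u) (hv0 : 0 < v) : Comp M False 3 (fun A ρ =>
      _root_.level (ρ 0) (Arc (ρ 0) A) (Zone (Arc (ρ 0) A) ℓ (regFrame ℓ ρ) i (ρ s) (ρ t))
        (ρ u) (ρ v)) := by
  have := Comp.level (CompP.zone (M := M) hℓ (by omega) i (hs.trans hM) (ht.trans hM) hM) hu0 hv0
    (by omega : 0 < 6 * ℓ + 4) (hu.trans hM) (hv.trans hM) hM hu.ne hv.ne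
  convert this using 1
  funext A ρ
  have h : ∀ z, regFrame ℓ (Function.update ρ (6 * ℓ + 4) z) = regFrame ℓ ρ :=
    regFrame_update hℓ (by omega) ρ
  simp only [levelExpr, h, Function.update_self, Function.update_of_ne hs.ne,
    Function.update_of_ne ht.ne, Function.update_of_ne (by omega : 0 ≠ 6 * ℓ + 4)]
  rfl

theorem CompP.inLeg (hℓ : 0 < ℓ) (hM : 6 * ℓ + 4 < M) (i : Fin 3) {x : ℕ} (hx0 : 0 < x)
    (hx : x < 6 * ℓ + 4) : CompP M False 3 (fun A ρ =>
      InLeg (ρ 0) (Arc (ρ 0) A) ℓ (regFrame ℓ ρ) i (ρ x)) := by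
  have hM0 : 0 < M := by omega
  have hr : ∀ i t, 0 < frameReg ℓ i t ∧ frameReg ℓ i t < 6 * ℓ + 4 := fun i t =>
    ⟨(frameReg_mem hℓ i t).1, (frameReg_mem hℓ i t).2.trans_lt (by omega)⟩
  have between : ∀ a b, CompP M False 3 (fun A ρ =>
      Between (ρ 0) (Arc (ρ 0) A) ℓ (regFrame ℓ ρ) i (regFrame ℓ ρ i a) (regFrame ℓ ρ i b)
        (ρ x)) := fun a b =>
    ((Comp.levelZone hℓ hM i (hr i a).2 (hr i b).2 (hr i a).2 hx (hr i a).1 hx0).add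
      (Comp.levelZone hℓ hM i (hr i a).2 (hr i b).2 (hr i b).2 hx (hr i b).1 hx0)
      (by omega) fun _ _ _ => level_le).eqP
      (Comp.levelZone hℓ hM i (hr i a).2 (hr i b).2 (hr i a).2 (hr i b).2 (hr i a).1 (hr i b).1)
  exact (CompP.exists_finset hM0 _ fun t _ => (((Comp.var hM0 (hx.trans hM)).eqP
    (Comp.var hM0 ((hr i t).2.trans hM))).mono (Nat.zero_le 3))).or
    ((between _ _).or (between _ _))

theorem CompP.longLeg (hℓ : 0 < ℓ) (hM : 6 * ℓ + 4 < M) (i : Fin 3) :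
    CompP M False 4 (fun A ρ => LongLeg (ρ 0) (Arc (ρ 0) A) ℓ (regFrame ℓ ρ) i) := by
  have hM0 : 0 < M := by omega
  have hr : ∀ i t, frameReg ℓ i t < M := fun i t => (frameReg_mem hℓ i t).2.trans_lt (by omega)
  have reg : ∀ i t, Comp M False 0 (fun _ ρ => regFrame ℓ ρ i t) := fun i t =>
    Comp.var hM0 (hr i t)
  have hx : 6 * ℓ + 3 < M := by omega
  refine (CompP.forall_finset hM0 _ fun s _ => ((reg i _).eqP (reg i s)).not.mono
    (Nat.zero_le 4)).and ?_
  have h1 := ((CompP.inLeg hℓ hM i (by omega) (by omega : 6 * ℓ + 3 < _)).imp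
    (CompP.forall_finset hM0 (Finset.range (ℓ - 1)) fun s _ =>
      ((CompP.arc hM0 (hr i s) hx).imp (CompP.exists_finset hM0 (Finset.range (s + 2))
        fun t _ => (Comp.var hM0 hx).eqP (reg i t))).mono (Nat.zero_le 3))).forall_lt
        (by omega : 0 < 6 * ℓ + 3) hx
  refine h1.congr fun A ρ => ?_
  have h : ∀ z, regFrame ℓ (Function.update ρ (6 * ℓ + 3) z) = regFrame ℓ ρ :=
    regFrame_update hℓ (by omega) ρ
  have h' : ∀ z i s, Function.update ρ (6 * ℓ + 3) z (frameReg ℓ i s) = regFrame ℓ ρ i s :=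
    fun z i s => congrFun (congrFun (h z) i) s
  simp only [h, h', Function.update_self, Function.update_of_ne (by omega : 0 ≠ 6 * ℓ + 3)]

/-- The separation condition dominates: two quantifiers over vertices around searches of cost `O(n ^
3)`. Quantifiers over legs and frame positions have ranges depending only on `ℓ` and are unrolled in
the program. -/
theorem CompP.certificate (hℓ : 0 < ℓ) (hM : 6 * ℓ + 4 < M) :
    CompP M False 5 (fun A ρ => Certificate (ρ 0) (Arc (ρ 0) A) ℓ (regFrame ℓ ρ)) := by
  have hM0 : 0 < M := by omega
  have hr : ∀ i t, 0 < frameReg ℓ i t ∧ frameReg ℓ i t < 6 * ℓ + 4 := fun i t =>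
    ⟨(frameReg_mem hℓ i t).1, (frameReg_mem hℓ i t).2.trans_lt (by omega)⟩
  have var : ∀ {x}, x < M → Comp M False 0 (fun _ ρ => ρ x) := fun h => Comp.var hM0 h
  have reg : ∀ i t, Comp M False 0 (fun _ ρ => regFrame ℓ ρ i t) := fun i t =>
    var ((hr i t).2.trans hM)
  have hx : 6 * ℓ + 2 < M := by omega
  have hy : 6 * ℓ + 3 < M := by omega
  have hstep := CompP.forall_finset (k := 5) (keep := False) hM0 (Finset.univ : Finset (Fin 3))
    fun i _ => CompP.forall_finset hM0 (Finset.range (2 * ℓ) \ {ℓ - 1, ℓ}) fun t _ =>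
      (((reg i t).eqP (reg i (t + 1))).or (CompP.arc hM0 ((hr i t).2.trans hM)
        ((hr i (t + 1)).2.trans hM))).mono (Nat.zero_le 5)
  have hlinked := CompP.forall_finset (k := 5) (keep := False) hM0 (Finset.univ : Finset (Fin 3))
    fun i _ => CompP.forall_finset hM0 ({ℓ - 1, ℓ} : Finset ℕ) fun t _ =>
      CompP.mono ((Comp.levelZone hℓ hM i (hr i t).2 (hr i (t + 1)).2 (hr i t).2
        (hr i (t + 1)).2 (hr i t).1 (hr i (t + 1)).1).ltP ((var hM0).mono (Nat.zero_le 3)))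
        (by omega : 3 ≤ 5)
  have hapex := CompP.forall_finset (k := 5) (keep := False) hM0 (Finset.univ : Finset (Fin 3))
    fun i _ => ((CompP.inLeg hℓ hM i (by omega) (by omega : 6 * ℓ + 3 < _)).imp
      (((var hy).eqP (reg i 0)).not.mono (Nat.zero_le 3))).forall_lt (by omega) hy |>.mono
      (by omega : 3 + 1 ≤ 5)
  have hsep := CompP.forall_finset (keep := False) hM0
    (Finset.univ.filter fun q : Fin 3 × Fin 3 => q.1 ≠ q.2)
    fun q _ => ((((CompP.inLeg hℓ hM q.1 (by omega) (by omega : 6 * ℓ + 2 < _)).imp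
      ((CompP.inLeg hℓ hM q.2 (by omega) (by omega : 6 * ℓ + 3 < _)).imp
      (CompP.mono (k' := 3) (((var hx).eqP (var hy)).not.and
        (((CompP.arc hM0 hx hy).imp (((var hx).eqP (reg q.1 (2 * ℓ))).and
          ((var hy).eqP (reg q.2 (2 * ℓ))))).and ((((var hx).eqP (reg q.1 (2 * ℓ))).and
          ((var hy).eqP (reg q.2 (2 * ℓ)))).imp (CompP.arc hM0 hx hy))))
        (Nat.zero_le 3)))).forall_lt (by omega) hy).forall_lt (by omega) hx)
  have hlong := CompP.exists_finset (k := 5) (keep := False) hM0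
    (Finset.univ.filter fun q : Fin 3 × Fin 3 => q.1 ≠ q.2)
    fun q _ => CompP.mono ((CompP.longLeg hℓ hM q.1).and (CompP.longLeg hℓ hM q.2))
      (by omega : 4 ≤ 5)
  refine (hstep.and (hlinked.and (hapex.and (hsep.and hlong)))).congr fun A ρ => ?_
  have h : ∀ ρ z, regFrame ℓ (Function.update ρ (6 * ℓ + 3) z) = regFrame ℓ ρ :=
    fun ρ => regFrame_update hℓ (by omega) ρ
  have h' : ∀ z, regFrame ℓ (Function.update ρ (6 * ℓ + 2) z) = regFrame ℓ ρ :=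
    regFrame_update hℓ (by omega) ρ
  simp only [h, h', Function.update_self, Function.update_of_ne (by omega : 0 ≠ 6 * ℓ + 3),
    Function.update_of_ne (by omega : 0 ≠ 6 * ℓ + 2), Finset.mem_univ, forall_const,
    Function.update_of_ne (by omega : 6 * ℓ + 2 ≠ 6 * ℓ + 3), Finset.mem_filter, true_and,
    Prod.forall, Prod.exists]
  constructor
  · rintro ⟨h1, h2, h3, h4, i, j, hij, h5⟩
    exact ⟨h1, h2, h3, fun i j hij u hu v hv hu' hv' =>
      have := h4 i j hij u hu v hv hu' hv'
      ⟨this.1, ⟨this.2.1, this.2.2⟩⟩, i, j, hij, h5⟩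
  · rintro ⟨h1, h2, h3, h4, i, j, hij, h5⟩
    exact ⟨h1, h2, h3, fun i j hij u hu v hv hu' hv' =>
      have := h4 i j hij u hu v hv hu' hv'
      ⟨this.1, this.2.mp, this.2.mpr⟩, i, j, hij, h5⟩

end Program

/-! ### Correctness for graphs on `Fin n`, and the main theorem -/

theorem arc_adjMatrix {n : ℕ} (G : SimpleGraph (Fin n)) :
    Arc n (adjMatrix G) = (G.map Fin.valEmbedding).Adj := by
  funext u v
  refine propext ⟨?_, ?_⟩
  · rintro ⟨-, h⟩
    unfold adjMatrix at h
    split_ifs at h with h'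
    obtain ⟨hu, hv, h⟩ := h'
    exact (SimpleGraph.map_adj_apply (f := Fin.valEmbedding)).2 h
  · rintro ⟨-, u, v, h, rfl, rfl⟩
    exact ⟨u.isLt, if_pos ⟨u.isLt, v.isLt, h⟩⟩

theorem hasLongPyramid_iff_certificate {n ℓ : ℕ} (G : SimpleGraph (Fin n)) (hℓ : 5 ≤ ℓ)
    (σ : ℕ → ℕ) (hσ : σ 0 = n) : HasLongPyramid G ℓ ↔
      ∃ ρ : ℕ → ℕ, (∀ i, i = 0 ∨ 6 * ℓ + 1 < i → ρ i = σ i) ∧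
        (∀ i, 1 ≤ i → i ≤ 6 * ℓ + 1 → ρ i < σ 0) ∧
        Certificate (ρ 0) (Arc (ρ 0) (adjMatrix G)) ℓ (regFrame ℓ ρ) := by
  have h1 : HasLongPyramid G ℓ ↔
      ∃ a b X, SetPyramid (G.map (Fin.valEmbedding (n := n))) ℓ a b X := by
    rw [hasLongPyramid_iff]
    constructor
    · rintro ⟨a, b, X, h⟩
      exact ⟨_, _, _, h.map _⟩
    · rintro ⟨a, b, X, h⟩
      exact h.of_map
  rw [h1, exists_setPyramid_iff (n := n) (fun u v h => ?_) hℓ]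
  · constructor
    · rintro ⟨ρ, hρ, h⟩
      refine ⟨fun i => if 1 ≤ i ∧ i ≤ 6 * ℓ + 1 then ρ i else σ i, fun i hi => if_neg (by omega),
        fun i hi hi' => ?_, ?_⟩
      · rw [hσ]
        exact (if_pos ⟨hi, hi'⟩).trans_lt (hρ i hi hi')
      · have h0 : (if 1 ≤ 0 ∧ 0 ≤ 6 * ℓ + 1 then ρ 0 else σ 0) = n := by simpa using hσ
        simp only [h0, arc_adjMatrix]
        convert h using 1
        funext i t
        exact if_pos (frameReg_mem (by omega) i t)
    · rintro ⟨ρ, h0, hρ, h⟩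
      rw [h0 0 (Or.inl rfl), hσ, arc_adjMatrix] at h
      exact ⟨ρ, hσ ▸ hρ, h⟩
  · obtain ⟨-, u, v, -, rfl, -⟩ := h
    exact u.isLt

end GraphRAM

theorem theorem2p3 (ℓ : ℕ) (hℓ : 5 ≤ ℓ) :
    ∃ (p : GraphRAM.Prog) (T : ℕ → ℕ),
      (fun n : ℕ => (T n : ℝ)) =O[Filter.atTop] (fun n : ℕ => (n : ℝ) ^ (6 * ℓ + 8)) ∧
      ∀ (n : ℕ) (G : SimpleGraph (Fin n)),
        GraphRAM.DecidesWithin p G (HasLongPyramid G ℓ) (T n) := by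
  open GraphRAM in
  classical
  set M := 6 * ℓ + 5 with hM
  -- Guessing the frame multiplies `n ^ 5` by `n ^ (6 * ℓ + 1)`, which gives the exponent `6 * ℓ +
  -- 6`.
  have hcomp := (CompP.exists_block (6 * ℓ + 1) (by omega)
    (CompP.certificate (M := M) (ℓ := ℓ) (by omega) (by omega))).mono
    (by omega : _ ≤ 6 * ℓ + 8)
  obtain ⟨p, C, hp⟩ := Comp.prog hcomp M le_rfl
  -- Register `1` is initially zero, so the test asks whether `n` is positive. The empty graph has
  -- no apex and is rejected directly.
  refine ⟨.branch (.lt 1 0) (.seq p (.instr (.copy 0 M))) (.instr (.const 0 0)),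
    fun n => C * n ^ (6 * ℓ + 8) + 2, ?_, fun n G => ?_⟩
  · refine Asymptotics.IsBigO.of_bound (C + 2 : ℝ) ?_
    filter_upwards [Filter.eventually_ge_atTop 1] with n hn
    have h : (1 : ℝ) ≤ (n : ℝ) ^ (6 * ℓ + 8) := one_le_pow₀ (by exact_mod_cast hn)
    rw [Real.norm_of_nonneg (by positivity), Real.norm_of_nonneg (by positivity)]
    push_cast
    nlinarith
  · refine Within.branch (T := C * n ^ (6 * ℓ + 8) + 1) (fun h => ?_) (fun h => ?_)
    · simp only [Test.eval, initial, decide_eq_true_eq, if_true, one_ne_zero, if_false] at h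
      have hv : Valid M (initial n).reg := ⟨by simpa [initial] using h, fun i hi _ => by
        simpa [initial, hi.ne'] using h⟩
      refine Within.seq ((hp (adjMatrix G) _ hv).mono (by simp [initial]) ?_)
      rintro τ ⟨hτ, -, -⟩
      refine Within.instr ?_
      simp only [Instr.exec, State.setReg_reg, if_true, hτ, indic]
      have key := hasLongPyramid_iff_certificate G hℓ (initial n).reg (by simp [initial])
      exact ⟨fun h => if_pos (key.1 h), fun h => if_neg fun h' => h (key.2 h')⟩
    · simp only [Test.eval, initial, decide_eq_false_iff_not, if_true, one_ne_zero, if_false,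
        not_lt, Nat.le_zero] at h
      subst h
      refine (Within.instr ?_).mono (by omega) fun _ h => h
      refine ⟨fun ⟨v₀, _⟩ => v₀.elim0, fun _ => by simp [Instr.exec]⟩
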